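/- Let $\mathbb T^d=(\mathbb R/2\pi\mathbb Z)^d$ with the flat metric $\delta$ inherited from the Euclidean metric of $\mathbb R^d$, and identify every tangent space with $\mathbb R^d$. For $0<\beta<1$ and $f:\mathbb T^d\to\mathbb R^m$ put $\|f\|_\beta=\sup_\psi\|f(\psi)\|+\sup_{\psi\neq\psi'}\|f(\psi)-f(\psi')\|/\delta(\psi,\psi')^\beta$; $f$ is $\beta$-Hölder if $\|f\|_\beta<\infty$. Let $A_0:\mathbb T^d\to\mathbb T^d$ be a real analytic Anosov diffeomorphism: $A_0$ and $A_0^{-1}$ are real analytic, $A_0$ has a dense orbit $\{A_0^m\psi\}_{m\in\mathbb Z}$, and there is a continuous $DA_0$-invariant splitting $\mathbb R^d=W^s(\psi)\oplus W^u(\psi)$ into subspaces of constant dimension, with constants $\Theta>0$, $0<\lambda<1$ such that, for all $n\ge 0$, $\|DA_0^n w\|\le\Theta\lambda^n\|w\|$ for $w\in W^s(\psi)$ and $\|DA_0^{-n}w\|\le\Theta\lambda^n\|w\|$ for $w\in W^u(\psi)$. Let $F:\mathbb T^d\to\mathbb R^d$ be real analytic and $A_\varepsilon(\psi)=A_0(\psi)+\varepsilon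 F(\psi) \bmod 2\pi$. Assume that there are $\beta_0\in(0,1)$, $\beta_0$-Hölder vector fields $\mathbf v_1,\dots,\mathbf v_d$ that form a basis of $\mathbb R^d$ at every point of $\mathbb T^d$, and $\beta_0$-Hölder functions $\Lambda_1,\dots,\Lambda_d:\mathbb T^d\to\mathbb R$ with $$DA_0(\psi)\mathbf v_i(\psi)=\Lambda_i(\psi)\,\mathbf v_i(A_0\psi),$$ and that, with $\Lambda_i^{[n]}(\psi)=\prod_{j=0}^{n-1}\Lambda_i(A_0^j\psi)$, there is $N_0$ such that for all $n>N_0$ and $i=1,\dots,d-1$ $$\|\Lambda_i^{[n]}\|_\infty\,\|(\Lambda_{i+1}^{[n]})^{-1}\|_\infty<1 .$$ Call a family $f_\varepsilon$ of functions on $\mathbb T^d$ analytic in $\varepsilon$ and $\beta$-Hölder in $\psi$ for $|\varepsilon|<\bar\varepsilon$ if $f_\varepsilon(\psi)=\sum_{n\ge0}\varepsilon^n a_n(\psi)$ for $|\varepsilon|<\bar\varepsilon$, where $\|a_n\|_\beta\le KC^n$ for all $n$ with constants $K,C\ge 0$ such that $C\bar\varepsilon\le1$. Then there are maps $H_\varepsilon:\mathbb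 T^d\to\mathbb T^d$ of the form $H_\varepsilon(\psi)=\psi+h_\varepsilon(\psi) \bmod 2\pi$, with $h_\varepsilon:\mathbb T^d\to\mathbb R^d$ and $h_0=0$, and there is $\bar\beta>0$ such that for every $\beta\in(0,\bar\beta)$ there is $\bar\varepsilon=\bar\varepsilon(\beta)>0$ for which the following holds. 1. The family $h_\varepsilon$ is analytic in $\varepsilon$ and $\beta$-Hölder in $\psi$ for $|\varepsilon|<\bar\varepsilon$, and for these $\varepsilon$ the map $H_\varepsilon$ is a homeomorphism with $H_\varepsilon\circ A_0=A_\varepsilon\circ H_\varepsilon$. 2. There are vector fields $\mathbf v_{i,\varepsilon}:\mathbb T^d\to\mathbb R^d$ and functions $L_{i,\varepsilon}:\mathbb T^d\to\mathbb R$, $i=1,\dots,d$, analytic in $\varepsilon$ and $\beta$-Hölder in $\psi$ for $|\varepsilon|<\bar\varepsilon$, with $\mathbf v_{i,0}=\mathbf v_i$ and $L_{i,0}=\Lambda_i$, such that for all $|\varepsilon|<\bar\varepsilon$ and all $\psi\in\mathbb T^d$ the vectors $\mathbf v_{1,\varepsilon}(\psi),\dots,\mathbf v_{d,\varepsilon}(\psi)$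 are linearly independent and $$DA_\varepsilon(H_\varepsilon(\psi))\,\mathbf v_{i,\varepsilon}(\psi)=L_{i,\varepsilon}(\psi)\,\mathbf v_{i,\varepsilon}(A_0\psi),\qquad i=1,\dots,d.$$ -/

import Mathlib

open scoped NNReal ENNReal

noncomputable section

namespace ToralAnosov

/-- `ℝ^d` with the Euclidean norm; it is also the tangent space of the torus at every point. -/
abbrev E (d : ℕ) : Type := EuclideanSpace ℝ (Fin d)

/-- The torus `(ℝ / 2πℤ)^d` with the flat metric inherited from the Euclidean metric of `ℝ^d`. -/
abbrev Torus (d : ℕ) : Type := PiLp 2 (fun _ : Fin d => AddCircle (2 * Real.pi))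

instance two_pi_pos_fact : Fact (0 < 2 * Real.pi) := ⟨Real.two_pi_pos⟩

variable {d : ℕ}

/-- The covering projection `ℝ^d → T^d`, i.e. reduction mod `2π`. -/
def proj (x : E d) : Torus d := WithLp.toLp 2 (fun i => (x i : AddCircle (2 * Real.pi)))

/-- The representative in `(-π, π]^d` of a point of the torus. -/
def rep (ψ : Torus d) : E d :=
  WithLp.toLp 2 (fun i => (AddCircle.equivIoc (2 * Real.pi) (-Real.pi) (ψ i) : ℝ))

/-- The differential at `ψ` of a map of the torus, computed in the chart `u ↦ ψ + u` around `ψ`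
and the chart `w ↦ f ψ + w` around `f ψ`. -/
def tderiv (f : Torus d → Torus d) (ψ : Torus d) : E d →L[ℝ] E d :=
  fderiv ℝ (fun u : E d => rep (f (ψ + proj u) - f ψ)) 0

/-- A real analytic map `T^d → T^d`: it is induced by a real analytic map `ℝ^d → ℝ^d`. -/
def IsAnalyticMap (f : Torus d → Torus d) : Prop :=
  ∃ g : E d → E d, AnalyticOnNhd ℝ g Set.univ ∧ ∀ x, proj (g x) = f (proj x)

/-- A real analytic function `T^d → ℝ^d`: its `2πℤ^d`-periodic lift is real analytic. -/
def IsAnalyticField (F : Torus d → E d) : Prop :=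
  AnalyticOnNhd ℝ (fun x : E d => F (proj x)) Set.univ

/-- A family of subspaces that depends continuously on the point. -/
def ContinuousSubspaces (W : Torus d → Submodule ℝ (E d)) : Prop :=
  Continuous fun ψ => (W ψ).starProjection

/-- The data of an Anosov splitting: `Ws` and `Wu` are complementary, of constant dimension,
continuous, invariant, and uniformly contracted in the future, resp. in the past. -/
structure IsHyperbolicSplitting (A : Equiv.Perm (Torus d))
    (Ws Wu : Torus d → Submodule ℝ (E d)) : Prop where
  isCompl : ∀ ψ, IsCompl (Ws ψ) (Wu ψ)
  dim_const : ∃ ds du : ℕ, ∀ ψ, Module.finrank ℝ (Ws ψ) = ds ∧ Module.finrank ℝ (Wu ψ) = du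
  invariant_s : ∀ ψ, (Ws ψ).map (tderiv A ψ).toLinearMap = Ws (A ψ)
  invariant_u : ∀ ψ, (Wu ψ).map (tderiv A ψ).toLinearMap = Wu (A ψ)
  continuous_s : ContinuousSubspaces Ws
  continuous_u : ContinuousSubspaces Wu
  hyperbolic : ∃ Θ l : ℝ, 0 < Θ ∧ 0 < l ∧ l < 1 ∧ ∀ (n : ℕ) (ψ : Torus d),
    (∀ w ∈ Ws ψ, ‖tderiv (A ^ n : Equiv.Perm (Torus d)) ψ w‖ ≤ Θ * l ^ n * ‖w‖) ∧
    (∀ w ∈ Wu ψ, ‖tderiv ((A⁻¹) ^ n : Equiv.Perm (Torus d)) ψ w‖ ≤ Θ * l ^ n * ‖w‖)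

/-- A real analytic Anosov diffeomorphism of the torus with a dense orbit. -/
structure IsAnalyticAnosov (A : Equiv.Perm (Torus d)) : Prop where
  analytic : IsAnalyticMap A
  analytic_symm : IsAnalyticMap A.symm
  dense_orbit : ∃ ψ, Dense (Set.range fun m : ℤ => (A ^ m : Equiv.Perm (Torus d)) ψ)
  splitting : ∃ Ws Wu, IsHyperbolicSplitting A Ws Wu

/-- The perturbed map `A_ε = A₀ + ε F mod 2π`. -/
def perturbed (A : Equiv.Perm (Torus d)) (F : Torus d → E d) (ε : ℝ) (ψ : Torus d) : Torus d :=
  A ψ + proj (ε • F ψ)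

/-- The sup norm, with values in `[0, ∞]`. -/
def supNorm {V : Type*} [NormedAddCommGroup V] (f : Torus d → V) : ℝ≥0∞ := ⨆ ψ, ‖f ψ‖ₑ

/-- The Hölder norm `‖f‖_β = ‖f‖_∞ + |f|_β`, with values in `[0, ∞]`. -/
def holderNorm {V : Type*} [NormedAddCommGroup V] (β : ℝ≥0) (f : Torus d → V) : ℝ≥0∞ :=
  supNorm f + eHolderNorm β f

/-- `f` is `β`-Hölder continuous. -/
def IsHolder {V : Type*} [NormedAddCommGroup V] (β : ℝ≥0) (f : Torus d → V) : Prop :=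
  holderNorm β f < ∞

/-- The cocycle product `Λ^{[n]}(ψ) = ∏_{j<n} Λ(A^j ψ)`. -/
def cocycle (A : Equiv.Perm (Torus d)) (Λ : Torus d → ℝ) (n : ℕ) (ψ : Torus d) : ℝ :=
  ∏ j ∈ Finset.range n, Λ ((A ^ j : Equiv.Perm (Torus d)) ψ)

/-- The domination condition: from some time on, the rate of the `i`-th direction is strictly
smaller than that of the next one. -/
def IsDominated (A : Equiv.Perm (Torus d)) (Λ : Fin d → Torus d → ℝ) : Prop :=
  ∃ N₀ : ℕ, ∀ n > N₀, ∀ i j : Fin d, (i : ℕ) + 1 = j →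
    supNorm (cocycle A (Λ i) n) * supNorm (fun ψ => (cocycle A (Λ j) n ψ)⁻¹) < 1

/-- The family `f_ε` is analytic in `ε` on `|ε| < ε₀` and `β`-Hölder in `ψ`: there
`f_ε = ∑ εⁿ aₙ`, where the `β`-Hölder norms of the coefficients grow at most like `ε₀⁻ⁿ`, so that
the series converges in the `β`-Hölder norm on `|ε| < ε₀`. -/
def IsAnalyticHolder {V : Type*} [NormedAddCommGroup V] [NormedSpace ℝ V]
    (β : ℝ≥0) (ε₀ : ℝ) (f : ℝ → Torus d → V) : Prop :=
  ∃ (a : ℕ → Torus d → V) (K C : ℝ≥0), (C : ℝ) * ε₀ ≤ 1 ∧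
    (∀ n, holderNorm β (a n) ≤ ((K * C ^ n : ℝ≥0) : ℝ≥0∞)) ∧
    ∀ ε : ℝ, |ε| < ε₀ → ∀ ψ, HasSum (fun n => ε ^ n • a n ψ) (f ε ψ)

theorem proj_add (x y : E d) : proj (x + y) = proj x + proj y := by
  ext i; simp [proj]

theorem proj_rep (ψ : Torus d) : proj (rep ψ) = ψ := by
  ext i; simp [proj, rep]

/-- The differential on the torus is the ordinary differential of any lift. -/
theorem tderiv_eq_of_lift {f : Torus d → Torus d} {g : E d → E d}
    (hg : ∀ x, proj (g x) = f (proj x)) {x : E d} (hx : ContinuousAt g x) :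
    tderiv f (proj x) = fderiv ℝ g x := by
  have hsub : ∀ a b : E d, proj (a - b) = proj a - proj b := by
    intro a b; ext i; simp [proj]
  have key : (fun u : E d => rep (f (proj x + proj u) - f (proj x)))
      =ᶠ[nhds 0] fun u => g (x + u) - g x := by
    have hc : ContinuousAt (fun u : E d => g (x + u) - g x) 0 := by
      refine ContinuousAt.sub ?_ continuousAt_const
      refine ContinuousAt.comp (g := g) (f := fun u => x + u) (by simpa using hx) (by fun_prop)
    have hb := hc.preimage_mem_nhds (Metric.ball_mem_nhds _ Real.pi_pos)
    filter_upwards [hb] with u hu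
    have hu' : ‖g (x + u) - g x‖ < Real.pi := by simpa using hu
    rw [← proj_add, ← hg, ← hg, ← hsub]
    ext i
    have h1 : ‖(g (x + u) - g x) i‖ < Real.pi := (PiLp.norm_apply_le _ i).trans_lt hu'
    rw [Real.norm_eq_abs, abs_lt] at h1
    exact AddCircle.equivIoc_coe_of_mem (p := 2 * Real.pi) (a := -Real.pi)
      ⟨h1.1, by linarith [h1.2]⟩
  rw [tderiv, key.fderiv_eq, fderiv_sub_const]
  simpa using fderiv_comp_add_left (𝕜 := ℝ) (f := g) (x := (0 : E d)) x

end ToralAnosov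

end

open ToralAnosov

/-!
Both assertions come from the analytic implicit function theorem in a space of Hölder functions on
the torus, in which `ε ↦ h_ε`, `ε ↦ v_{i,ε}` and `ε ↦ L_{i,ε}` are curves through
`0`, `v_i` and `Λ_i`.

For the conjugacy the unknown is the displacement `h`, and the equation is `h ∘ A₀ = incr(h) + ε F`,
where `incr(h)(ψ)` is the increment of a lift of `A₀` under the displacement `h(ψ)`. Its
linearization at `h = 0` is `u ↦ u ∘ A₀ - DA₀ u`. In the coordinates of the frame `v_i` it splits
into the scalar operators `x ↦ x ∘ A₀ - Λ_i x`. For the eigenfields the unknowns are the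
coordinates of `v_{i,ε}` along `v_k`, `k ≠ i`, together with `L_{i,ε}`; the linearization
splits into the twisted operators `x ↦ Λ_i · (x ∘ A₀) - Λ_k x`.

A twisted operator is bijective on bounded functions as soon as one cocycle product dominates the
other along some iterate, and then also on `β`-Hölder functions for small `β`, since composition
with `A₀ⁿ` costs only a factor `Lip(A₀ⁿ)^β`. Between different directions the domination is a
hypothesis. For the conjugacy it says that every `Λ_i` is uniformly contracting or uniformly
expanding: a dimension count, based on the domination, shows that each `v_i` is everywhere stable
or everywhere unstable.

That `H_ε` is a homeomorphism does not use regularity: small bounded solutions of intertwining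
equations between two nearby maps are unique, so a displacement conjugating `A_ε` back to `A₀`
yields a two-sided inverse of `H_ε`.
-/

noncomputable section

namespace ToralAnosov

open Filter Topology

section GaugeBound

variable {T V W Z : Type*} [NormedAddCommGroup V] [NormedAddCommGroup W] [NormedAddCommGroup Z]
  {ρ : T → T → ℝ≥0} {f : T → V} {a b : ℝ}

/-- `f` is bounded by `a`, and Lipschitz with constant `b` with respect to the gauge `ρ`. No
property of the gauge is needed: `ρ = dist ^ β` gives Hölder functions and `ρ = 2` all bounded
functions. -/
def GaugeBound (ρ : T → T → ℝ≥0) (f : T → V) (a b : ℝ) : Prop :=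
  (∀ x, ‖f x‖ ≤ a) ∧ ∀ x y, ‖f x - f y‖ ≤ b * ρ x y

/-- `φ` expands the gauge `ρ` at most by the factor `L`. The normalization `1 ≤ L` makes `L` also
a bound for the composition operator of `φ`. -/
structure GaugeLipschitz (ρ : T → T → ℝ≥0) (φ : T → T) (L : ℝ≥0) : Prop where
  one_le : 1 ≤ L
  le : ∀ x y, ρ (φ x) (φ y) ≤ L * ρ x y

namespace GaugeBound

theorem mono (hf : GaugeBound ρ f a b) {a' b' : ℝ} (ha : a ≤ a') (hb : b ≤ b') :
    GaugeBound ρ f a' b' :=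
  ⟨fun x => (hf.1 x).trans ha, fun x y => (hf.2 x y).trans (by gcongr)⟩

theorem add {g : T → V} {a' b' : ℝ} (hf : GaugeBound ρ f a b) (hg : GaugeBound ρ g a' b') :
    GaugeBound ρ (f + g) (a + a') (b + b') := by
  refine ⟨fun x => norm_add_le_of_le (hf.1 x) (hg.1 x), fun x y => ?_⟩
  rw [Pi.add_apply, Pi.add_apply, add_sub_add_comm, add_mul]
  exact norm_add_le_of_le (hf.2 x y) (hg.2 x y)

theorem comp (hf : GaugeBound ρ f a b) (hb : 0 ≤ b) {φ : T → T} {L : ℝ≥0}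
    (hφ : GaugeLipschitz ρ φ L) : GaugeBound ρ (f ∘ φ) a (L * b) := by
  refine ⟨fun x => hf.1 (φ x), fun x y => ?_⟩
  calc ‖f (φ x) - f (φ y)‖ ≤ b * ρ (φ x) (φ y) := hf.2 _ _
    _ ≤ b * (L * ρ x y) := by gcongr; exact_mod_cast hφ.le x y
    _ = L * b * ρ x y := by ring

variable [NormedSpace ℝ V] [NormedSpace ℝ W] [NormedSpace ℝ Z]

theorem const_smul (hf : GaugeBound ρ f a b) (c : ℝ) :
    GaugeBound ρ (c • f) (‖c‖ * a) (‖c‖ * b) := by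
  refine ⟨fun x => ?_, fun x y => ?_⟩
  · rw [Pi.smul_apply, norm_smul]
    exact mul_le_mul_of_nonneg_left (hf.1 x) (norm_nonneg c)
  · rw [Pi.smul_apply, Pi.smul_apply, ← smul_sub, norm_smul, mul_assoc]
    exact mul_le_mul_of_nonneg_left (hf.2 x y) (norm_nonneg c)

theorem neg (hf : GaugeBound ρ f a b) : GaugeBound ρ (-f) a b := by
  simpa only [neg_smul, one_smul, norm_neg, norm_one, one_mul] using hf.const_smul (-1)

theorem bilinear (B : V →L[ℝ] W →L[ℝ] Z) {g : T → W} {a' b' : ℝ} (hf : GaugeBound ρ f a b)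
    (hg : GaugeBound ρ g a' b') :
    GaugeBound ρ (fun x => B (f x) (g x)) (‖B‖ * a * a') (‖B‖ * (b * a' + a * b')) := by
  refine ⟨fun x => ?_, fun x y => ?_⟩
  · have ha : 0 ≤ a := (norm_nonneg _).trans (hf.1 x)
    exact (B.le_opNorm₂ _ _).trans (by gcongr; exacts [hf.1 x, hg.1 x])
  · have ha : 0 ≤ a := (norm_nonneg _).trans (hf.1 x)
    have hb : 0 ≤ b * ρ x y := (norm_nonneg _).trans (hf.2 x y)
    calc ‖B (f x) (g x) - B (f y) (g y)‖
        = ‖B (f x - f y) (g x) + B (f y) (g x - g y)‖ := by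
          simp only [map_sub, sub_apply, sub_add_sub_cancel]
      _ ≤ ‖B‖ * ‖f x - f y‖ * ‖g x‖ + ‖B‖ * ‖f y‖ * ‖g x - g y‖ :=
        norm_add_le_of_le (B.le_opNorm₂ _ _) (B.le_opNorm₂ _ _)
      _ ≤ ‖B‖ * (b * ρ x y) * a' + ‖B‖ * a * (b' * ρ x y) := by
        gcongr
        exacts [hf.2 x y, hg.1 x, hf.1 y, hg.2 x y]
      _ = ‖B‖ * (b * a' + a * b') * ρ x y := by ring

theorem isometry_comp_iff (e : V →ₗᵢ[ℝ] W) : GaugeBound ρ (e ∘ f) a b ↔ GaugeBound ρ f a b := by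
  simp only [GaugeBound, Function.comp_apply, ← map_sub, e.norm_map]

end GaugeBound

theorem GaugeLipschitz.iterate {φ : T → T} {L : ℝ≥0} (hφ : GaugeLipschitz ρ φ L) (n : ℕ) :
    GaugeLipschitz ρ φ^[n] (L ^ n) := by
  refine ⟨one_le_pow₀ hφ.one_le, fun x y => ?_⟩
  induction n with
  | zero => simp
  | succ n ih =>
    rw [Function.iterate_succ_apply', Function.iterate_succ_apply', pow_succ', mul_assoc]
    exact (hφ.le _ _).trans (by gcongr)

end GaugeBound

section HolderFun

variable {T : Type*}

/-- The space of bounded functions that are Lipschitz with respect to the gauge `ρ`, as a subspace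
of the space of all functions. -/
def gaugeSubmodule (ρ : T → T → ℝ≥0) (V : Type*) [NormedAddCommGroup V] [NormedSpace ℝ V] :
    Submodule ℝ (T → V) where
  carrier := {f | ∃ a b, GaugeBound ρ f a b}
  add_mem' := fun ⟨_, _, hf⟩ ⟨_, _, hg⟩ => ⟨_, _, hf.add hg⟩
  zero_mem' := ⟨0, 0, by simp [GaugeBound]⟩
  smul_mem' := fun c _ ⟨_, _, hf⟩ => ⟨_, _, hf.const_smul c⟩

/-- The Banach space of bounded functions that are Lipschitz with respect to the gauge `ρ`. For
`ρ = dist ^ β` this is the space of `β`-Hölder functions, for `ρ = 2` the space of all bounded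
functions with the sup norm. -/
def HolderFun (ρ : T → T → ℝ≥0) (V : Type*) [NormedAddCommGroup V] [NormedSpace ℝ V] : Type _ :=
  gaugeSubmodule ρ V

namespace HolderFun

variable {ρ : T → T → ℝ≥0} {V W Z : Type*} [NormedAddCommGroup V] [NormedSpace ℝ V]
  [NormedAddCommGroup W] [NormedSpace ℝ W] [NormedAddCommGroup Z] [NormedSpace ℝ Z]

instance : AddCommGroup (HolderFun ρ V) := inferInstanceAs (AddCommGroup (gaugeSubmodule ρ V))

instance : Module ℝ (HolderFun ρ V) := inferInstanceAs (Module ℝ (gaugeSubmodule ρ V))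

/-- The underlying function. -/
@[coe] def toFun (f : HolderFun ρ V) : T → V := f.1

instance : CoeFun (HolderFun ρ V) (fun _ => T → V) := ⟨toFun⟩

@[ext] theorem ext {f g : HolderFun ρ V} (h : ∀ x, f x = g x) : f = g := Subtype.ext (funext h)

@[simp] theorem add_apply (f g : HolderFun ρ V) (x : T) : (f + g) x = f x + g x := rfl
@[simp] theorem sub_apply (f g : HolderFun ρ V) (x : T) : (f - g) x = f x - g x := rfl
@[simp] theorem neg_apply (f : HolderFun ρ V) (x : T) : (-f) x = -f x := rfl
@[simp] theorem zero_apply (x : T) : (0 : HolderFun ρ V) x = 0 := rfl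
@[simp] theorem smul_apply (c : ℝ) (f : HolderFun ρ V) (x : T) : (c • f) x = c • f x := rfl

/-- The element of the space with given values. -/
def mk (f : T → V) (hf : ∃ a b, GaugeBound ρ f a b) : HolderFun ρ V := ⟨f, hf⟩

@[simp] theorem mk_apply (f : T → V) (hf : ∃ a b, GaugeBound ρ f a b) (x : T) :
    mk f hf x = f x := rfl

instance : Norm (HolderFun ρ V) := ⟨fun f => sInf {C : ℝ | 0 ≤ C ∧ GaugeBound ρ f C C}⟩

theorem norm_nonneg_and_gaugeBound (f : HolderFun ρ V) : 0 ≤ ‖f‖ ∧ GaugeBound ρ f ‖f‖ ‖f‖ := by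
  have hne : {C : ℝ | 0 ≤ C ∧ GaugeBound ρ f C C}.Nonempty := by
    obtain ⟨a, b, hf⟩ := f.2
    exact ⟨max 0 (max a b), le_max_left _ _, hf.mono (le_max_of_le_right (le_max_left a b))
      (le_max_of_le_right (le_max_right a b))⟩
  have hcl : IsClosed {C : ℝ | 0 ≤ C ∧ GaugeBound ρ f C C} := by
    simp only [GaugeBound, Set.ofPred_and, Set.ofPred_forall]
    refine isClosed_Ici.inter (IsClosed.inter ?_ ?_)
    · exact isClosed_iInter fun x => isClosed_le continuous_const continuous_id
    · exact isClosed_iInter fun x => isClosed_iInter fun y =>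
        isClosed_le continuous_const (continuous_id.mul continuous_const)
  exact hcl.csInf_mem hne ⟨0, fun C hC => hC.1⟩

theorem gaugeBound (f : HolderFun ρ V) : GaugeBound ρ f ‖f‖ ‖f‖ := f.norm_nonneg_and_gaugeBound.2

theorem norm_apply_le (f : HolderFun ρ V) (x : T) : ‖f x‖ ≤ ‖f‖ := f.gaugeBound.1 x

theorem norm_sub_apply_le (f : HolderFun ρ V) (x y : T) : ‖f x - f y‖ ≤ ‖f‖ * ρ x y :=
  f.gaugeBound.2 x y

theorem norm_le {f : HolderFun ρ V} {C : ℝ} (hC : 0 ≤ C) (hf : GaugeBound ρ f C C) : ‖f‖ ≤ C :=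
  csInf_le ⟨0, fun _ hC => hC.1⟩ ⟨hC, hf⟩

instance : NormedAddCommGroup (HolderFun ρ V) :=
  AddGroupNorm.toNormedAddCommGroup
    { toFun := norm
      map_zero' := le_antisymm (norm_le le_rfl (by simp [GaugeBound]))
        (norm_nonneg_and_gaugeBound _).1
      add_le' := fun f g => norm_le
        (add_nonneg f.norm_nonneg_and_gaugeBound.1 g.norm_nonneg_and_gaugeBound.1)
        (f.gaugeBound.add g.gaugeBound)
      neg' := fun f => by
        have norm_neg_le (g : HolderFun ρ V) : ‖-g‖ ≤ ‖g‖ :=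
          norm_le g.norm_nonneg_and_gaugeBound.1 g.gaugeBound.neg
        exact le_antisymm (norm_neg_le f) (by simpa only [neg_neg] using norm_neg_le (-f))
      eq_zero_of_map_eq_zero' := fun f hf => by
        ext x
        exact norm_le_zero_iff.1 ((f.norm_apply_le x).trans (le_of_eq hf)) }

instance : NormedSpace ℝ (HolderFun ρ V) where
  norm_smul_le c f := norm_le (mul_nonneg (norm_nonneg c) (norm_nonneg f))
    (f.gaugeBound.const_smul c)

/-- Evaluation at a point. -/
def eval (x : T) : HolderFun ρ V →L[ℝ] V :=
  LinearMap.mkContinuous { toFun := fun f => f x, map_add' := fun _ _ => rfl,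
                           map_smul' := fun _ _ => rfl } 1
    (fun f => by rw [one_mul]; exact f.norm_apply_le x)

@[simp] theorem eval_apply (x : T) (f : HolderFun ρ V) : eval x f = f x := rfl

theorem sum_apply {ι : Type*} (s : Finset ι) (f : ι → HolderFun ρ V) (x : T) :
    (∑ i ∈ s, f i) x = ∑ i ∈ s, f i x := map_sum (eval x) f s

theorem gaugeBound_sub_of_tendsto {u : ℕ → HolderFun ρ V} {l : T → V}
    (hl : ∀ x, Tendsto (fun n => u n x) atTop (𝓝 (l x))) {n N : ℕ} {δ : ℝ}
    (hu : ∀ m ≥ N, ‖u n - u m‖ ≤ δ) : GaugeBound ρ (fun x => u n x - l x) δ δ := by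
  refine ⟨fun x => ?_, fun x y => ?_⟩
  · refine le_of_tendsto ((tendsto_const_nhds.sub (hl x)).norm) ?_
    filter_upwards [eventually_ge_atTop N] with m hm
    exact ((u n - u m).norm_apply_le x).trans (hu m hm)
  · refine le_of_tendsto (((tendsto_const_nhds.sub (hl x)).sub
      (tendsto_const_nhds.sub (hl y))).norm) ?_
    filter_upwards [eventually_ge_atTop N] with m hm
    exact ((u n - u m).norm_sub_apply_le x y).trans (by gcongr; exact hu m hm)

instance [CompleteSpace V] : CompleteSpace (HolderFun ρ V) := by
  refine Metric.complete_of_cauchySeq_tendsto fun u hu => ?_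
  choose l hl using fun x => cauchySeq_tendsto_of_complete (u := fun n => u n x)
    (hu.map (eval x).uniformContinuous)
  have hclose : ∀ δ > 0, ∃ N, ∀ n ≥ N, GaugeBound ρ (fun x => u n x - l x) δ δ := by
    intro δ hδ
    obtain ⟨N, hN⟩ := Metric.cauchySeq_iff.1 hu δ hδ
    refine ⟨N, fun n hn => gaugeBound_sub_of_tendsto hl (N := N) fun m hm => ?_⟩
    exact (dist_eq_norm (u n) (u m) ▸ hN n hn m hm).le
  have hmem : ∃ a b, GaugeBound ρ l a b := by
    obtain ⟨N, hN⟩ := hclose 1 one_pos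
    have hl_eq : ((u N : T → V) + -fun x => u N x - l x) = l := by ext x; simp
    exact ⟨_, _, hl_eq ▸ (u N).gaugeBound.add (hN N le_rfl).neg⟩
  refine ⟨mk l hmem, Metric.tendsto_atTop.2 fun δ hδ => ?_⟩
  obtain ⟨N, hN⟩ := hclose (δ / 2) (half_pos hδ)
  refine ⟨N, fun n hn => ?_⟩
  rw [dist_eq_norm]
  exact (norm_le (half_pos hδ).le (hN n hn)).trans_lt (half_lt_self hδ)

/-- Constant functions. -/
def const (v : V) : HolderFun ρ V := mk (fun _ => v) ⟨‖v‖, 0, fun _ => le_rfl, by simp⟩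

@[simp] theorem const_apply (v : V) (x : T) : (const v : HolderFun ρ V) x = v := rfl

/-- Composition with a map that is Lipschitz with respect to the gauge. -/
def comp {φ : T → T} {L : ℝ≥0} (hφ : GaugeLipschitz ρ φ L) : HolderFun ρ V →L[ℝ] HolderFun ρ V :=
  LinearMap.mkContinuous
    { toFun := fun f => mk (f ∘ φ) ⟨_, _, f.gaugeBound.comp (norm_nonneg f) hφ⟩
      map_add' := fun _ _ => rfl
      map_smul' := fun _ _ => rfl } L
    (fun f => norm_le (by positivity) ((f.gaugeBound.comp (norm_nonneg f) hφ).mono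
      (le_mul_of_one_le_left (norm_nonneg f) (mod_cast hφ.one_le)) le_rfl))

@[simp] theorem comp_apply {φ : T → T} {L : ℝ≥0} (hφ : GaugeLipschitz ρ φ L)
    (f : HolderFun ρ V) (x : T) : comp hφ f x = f (φ x) := rfl

theorem gaugeBound_bilin (B : V →L[ℝ] W →L[ℝ] Z) (f : HolderFun ρ V) (g : HolderFun ρ W) :
    GaugeBound ρ (fun x => B (f x) (g x)) (2 * ‖B‖ * ‖f‖ * ‖g‖) (2 * ‖B‖ * ‖f‖ * ‖g‖) := by
  have hBfg : 0 ≤ ‖B‖ * ‖f‖ * ‖g‖ := by positivity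
  exact (f.gaugeBound.bilinear B g.gaugeBound).mono (by linarith) (by linarith)

/-- Pointwise application of a continuous bilinear map. -/
def bilin (B : V →L[ℝ] W →L[ℝ] Z) : HolderFun ρ V →L[ℝ] HolderFun ρ W →L[ℝ] HolderFun ρ Z :=
  LinearMap.mkContinuous₂
    (LinearMap.mk₂ ℝ (fun f g => mk (fun x => B (f x) (g x)) ⟨_, _, gaugeBound_bilin B f g⟩)
      (fun f f' g => by ext x; simp) (fun c f g => by ext x; simp)
      (fun f g g' => by ext x; simp) (fun c f g => by ext x; simp)) (2 * ‖B‖)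
    (fun f g => norm_le (by positivity) (gaugeBound_bilin B f g))

@[simp] theorem bilin_apply (B : V →L[ℝ] W →L[ℝ] Z) (f : HolderFun ρ V) (g : HolderFun ρ W)
    (x : T) : bilin B f g x = B (f x) (g x) := rfl

theorem norm_bilin_le (B : V →L[ℝ] W →L[ℝ] Z) :
    ‖(bilin B : HolderFun ρ V →L[ℝ] HolderFun ρ W →L[ℝ] HolderFun ρ Z)‖ ≤ 2 * ‖B‖ :=
  LinearMap.mkContinuous₂_norm_le _ (by positivity) _

/-- Pointwise multiplication of a vector-valued function by a scalar one. -/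
abbrev smulL : HolderFun ρ ℝ →L[ℝ] HolderFun ρ V →L[ℝ] HolderFun ρ V :=
  bilin (ContinuousLinearMap.lsmul ℝ ℝ)

/-- Pointwise application of operator-valued functions to vector-valued ones. -/
abbrev applyL : HolderFun ρ (V →L[ℝ] W) →L[ℝ] HolderFun ρ V →L[ℝ] HolderFun ρ W :=
  bilin (ContinuousLinearMap.id ℝ (V →L[ℝ] W))

theorem norm_applyL_le (q : HolderFun ρ (V →L[ℝ] W)) :
    ‖(applyL q : HolderFun ρ V →L[ℝ] HolderFun ρ W)‖ ≤ 2 * ‖q‖ :=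
  ContinuousLinearMap.le_of_opNorm_le _ ((norm_bilin_le _).trans
    (mul_le_of_le_one_right zero_le_two ContinuousLinearMap.norm_id_le)) q

/-- Pointwise application of a linear isometry. -/
def mapIsometry (e : V →ₗᵢ[ℝ] W) : HolderFun ρ V →ₗᵢ[ℝ] HolderFun ρ W where
  toFun f := mk (e ∘ f) ⟨_, _, (GaugeBound.isometry_comp_iff e).2 f.gaugeBound⟩
  map_add' _ _ := by ext x; simp
  map_smul' _ _ := by ext x; simp
  norm_map' f := by
    change sInf {C | 0 ≤ C ∧ GaugeBound ρ (e ∘ f) C C} = sInf {C | 0 ≤ C ∧ GaugeBound ρ f C C}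
    simp only [GaugeBound.isometry_comp_iff]

/-- Pointwise application of a continuous multilinear map depending on the point, by induction on
the number of variables. -/
def multilin : (n : ℕ) →
    HolderFun ρ (V [×n]→L[ℝ] W) →L[ℝ] (HolderFun ρ V) [×n]→L[ℝ] (HolderFun ρ W)
  | 0 => (continuousMultilinearCurryFin0 ℝ (HolderFun ρ V)
        (HolderFun ρ W)).symm.toLinearIsometry.toContinuousLinearMap ∘L
      (mapIsometry (continuousMultilinearCurryFin0 ℝ V W).toLinearIsometry).toContinuousLinearMap
  | n + 1 => (continuousMultilinearCurryLeftEquiv ℝ (fun _ : Fin (n + 1) => HolderFun ρ V)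
        (HolderFun ρ W)).symm.toLinearIsometry.toContinuousLinearMap ∘L
      ContinuousLinearMap.compL ℝ _ _ _ (multilin n) ∘L applyL ∘L
      (mapIsometry (continuousMultilinearCurryLeftEquiv ℝ (fun _ : Fin (n + 1) => V)
        W).toLinearIsometry).toContinuousLinearMap

@[simp] theorem multilin_apply (n : ℕ) (q : HolderFun ρ (V [×n]→L[ℝ] W))
    (u : Fin n → HolderFun ρ V) (x : T) : multilin n q u x = q x (fun i => u i x) := by
  induction n with
  | zero =>
    change q x 0 = _
    congr 1
    exact Subsingleton.elim _ _
  | succ n ih =>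
    refine (ih (applyL (mapIsometry (continuousMultilinearCurryLeftEquiv ℝ
      (fun _ : Fin (n + 1) => V) W).toLinearIsometry q) (u 0)) (Fin.tail u)).trans ?_
    change q x (Fin.cons (u 0 x) fun i => u i.succ x) = _
    congr 1
    exact Fin.cons_self_tail fun i => u i x

theorem norm_multilin_le (n : ℕ) (q : HolderFun ρ (V [×n]→L[ℝ] W)) :
    ‖multilin n q‖ ≤ 2 ^ n * ‖q‖ := by
  induction n with
  | zero =>
    rw [pow_zero, one_mul]
    exact (((continuousMultilinearCurryFin0 ℝ (HolderFun ρ V) (HolderFun ρ W)).symm.norm_map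
      _).trans ((mapIsometry _).norm_map q)).le
  | succ n ih =>
    let ι := (continuousMultilinearCurryLeftEquiv ℝ (fun _ : Fin (n + 1) => V) W).toLinearIsometry
    calc ‖multilin (n + 1) q‖
        = ‖(multilin n).comp (applyL (mapIsometry ι q) : HolderFun ρ V →L[ℝ] _)‖ :=
          (continuousMultilinearCurryLeftEquiv ℝ (fun _ : Fin (n + 1) => HolderFun ρ V)
            (HolderFun ρ W)).symm.norm_map _
      _ ≤ 2 ^ n * (2 * ‖q‖) := by
        refine (ContinuousLinearMap.opNorm_comp_le _ _).trans ?_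
        gcongr
        · exact ContinuousLinearMap.opNorm_le_bound _ (by positivity) ih
        · exact (norm_applyL_le _).trans_eq (by rw [LinearIsometry.norm_map])
      _ = 2 ^ (n + 1) * ‖q‖ := by ring

end HolderFun

end HolderFun

theorem isUnit_one_sub_of_norm_pow_lt_one {R : Type*} [NormedRing R] [HasSummableGeomSeries R]
    (t : R) (n : ℕ) (ht : ‖t ^ n‖ < 1) : IsUnit (1 - t) := by
  have hunit : IsUnit (1 - t ^ n) := isUnit_one_sub_of_norm_lt_one ht
  have hcomm : Commute (1 - t) (∑ i ∈ Finset.range n, t ^ i) :=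
    (Commute.one_left _).sub_left (.sum_right _ _ _ fun i _ => (Commute.refl t).pow_right i)
  rw [← mul_neg_geom_sum, hcomm.isUnit_mul_iff] at hunit
  exact hunit.1

theorem prod_range_inv_iterate {T M : Type*} [CommMonoid M] (φ : Equiv.Perm T) (c : T → M) (n : ℕ)
    (x : T) : ∏ j ∈ Finset.range n, c (φ⁻¹ ((⇑φ⁻¹)^[j] x)) =
      ∏ j ∈ Finset.range n, c (φ^[j] ((⇑φ⁻¹)^[n] x)) := by
  rw [← Finset.prod_range_reflect]
  refine Finset.prod_congr rfl fun j hj => ?_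
  rw [Finset.mem_range] at hj
  have hsplit : (⇑φ⁻¹)^[n] x = (⇑φ⁻¹)^[j] (φ⁻¹ ((⇑φ⁻¹)^[n - 1 - j] x)) := by
    rw [← Function.iterate_succ_apply' (⇑φ⁻¹), ← Function.iterate_add_apply]
    congr 2
    omega
  have hinv : Function.LeftInverse φ (φ⁻¹ : Equiv.Perm T) := φ.apply_symm_apply
  rw [hsplit, (hinv.iterate j) _]

section WeightedComposition

namespace HolderFun

variable {T : Type*} {ρ : T → T → ℝ≥0} {V : Type*} [NormedAddCommGroup V] [NormedSpace ℝ V]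
  {φ : T → T} {L : ℝ≥0} (hφ : GaugeLipschitz ρ φ L)

/-- The weighted composition operator `w ↦ c · (w ∘ φ)`. -/
def wcomp (c : HolderFun ρ ℝ) : HolderFun ρ ℝ →L[ℝ] HolderFun ρ ℝ := smulL c ∘L comp hφ

@[simp] theorem wcomp_apply (c w : HolderFun ρ ℝ) (x : T) : wcomp hφ c w x = c x * w (φ x) := rfl

theorem wcomp_pow_apply (c w : HolderFun ρ ℝ) (n : ℕ) (x : T) :
    (wcomp hφ c ^ n) w x = (∏ j ∈ Finset.range n, c (φ^[j] x)) * w (φ^[n] x) := by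
  induction n generalizing w with
  | zero => simp
  | succ n ih =>
    rw [pow_succ, mul_apply_eq_comp, ih, wcomp_apply, Finset.prod_range_succ,
      Function.iterate_succ_apply', mul_assoc]

theorem wcomp_pow_eq (c : HolderFun ρ ℝ) (n : ℕ) :
    wcomp hφ c ^ n = wcomp (hφ.iterate n) ((wcomp hφ c ^ n) (const 1)) := by
  ext w x
  rw [wcomp_apply, wcomp_pow_apply, wcomp_pow_apply, const_apply, mul_one]

theorem lasota_yorke {c w : HolderFun ρ ℝ} {κ a b : ℝ} (hc : ∀ x, |c x| ≤ κ) (hb : 0 ≤ b)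
    (hw : GaugeBound ρ w a b) :
    GaugeBound ρ (wcomp hφ c w) (κ * a) (‖c‖ * a + κ * L * b) := by
  have hmul := GaugeBound.bilinear (ContinuousLinearMap.lsmul ℝ ℝ)
    (show GaugeBound ρ c κ ‖c‖ from ⟨hc, c.norm_sub_apply_le⟩) (hw.comp hb hφ)
  rw [ContinuousLinearMap.opNorm_lsmul, one_mul, one_mul, ← mul_assoc] at hmul
  exact hmul

/-- The two constants of the Lasota–Yorke inequality are propagated by the weight `b + M a`. -/
theorem gaugeBound_wcomp_pow {c : HolderFun ρ ℝ} {κ q M : ℝ} (hκ : 0 ≤ κ) (hc : ∀ x, |c x| ≤ κ)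
    (hκq : κ ≤ q) (hκL : κ * L ≤ q) (hM : 0 ≤ M) (hcM : ‖c‖ = M * (q - κ)) (w : HolderFun ρ ℝ)
    (k : ℕ) : GaugeBound ρ ((wcomp hφ c ^ k) w) (κ ^ k * ‖w‖)
      ((q ^ k * (1 + M) - M * κ ^ k) * ‖w‖) := by
  induction k with
  | zero => simpa using w.gaugeBound
  | succ k ih =>
    have hweight : 0 ≤ q ^ k * (1 + M) - M * κ ^ k := by
      have hpow : κ ^ k ≤ q ^ k := pow_le_pow_left₀ hκ hκq k
      nlinarith [pow_nonneg hκ k]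
    rw [pow_succ', mul_apply_eq_comp]
    refine (lasota_yorke hφ hc (by positivity) ih).mono (by rw [pow_succ']; linarith) ?_
    calc ‖c‖ * (κ ^ k * ‖w‖) + κ * L * ((q ^ k * (1 + M) - M * κ ^ k) * ‖w‖)
        ≤ ‖c‖ * (κ ^ k * ‖w‖) + q * ((q ^ k * (1 + M) - M * κ ^ k) * ‖w‖) := by gcongr
      _ = (q ^ (k + 1) * (1 + M) - M * κ ^ (k + 1)) * ‖w‖ := by rw [hcM]; ring

theorem exists_norm_wcomp_pow_lt_one {c : HolderFun ρ ℝ} {κ : ℝ} (hκ : 0 ≤ κ)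
    (hc : ∀ x, |c x| ≤ κ) (hκL : κ * L < 1) : ∃ k, ‖wcomp hφ c ^ k‖ < 1 := by
  obtain ⟨q, hκLq, hq⟩ := exists_between hκL
  have hκq : κ < q := (le_mul_of_one_le_right hκ (mod_cast hφ.one_le)).trans_lt hκLq
  have hq0 : 0 ≤ q := hκ.trans hκq.le
  set M : ℝ := ‖c‖ / (q - κ)
  have hM : 0 ≤ M := div_nonneg (norm_nonneg c) (sub_nonneg.2 hκq.le)
  have hcM : ‖c‖ = M * (q - κ) := (div_mul_cancel₀ _ (sub_pos.2 hκq).ne').symm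
  have hnorm (k : ℕ) : ‖wcomp hφ c ^ k‖ ≤ q ^ k * (1 + M) := by
    refine ContinuousLinearMap.opNorm_le_bound _ (by positivity) fun w => ?_
    refine norm_le (by positivity)
      ((gaugeBound_wcomp_pow hφ hκ hc hκq.le hκLq.le hM hcM w k).mono ?_ ?_) <;> gcongr
    · exact (pow_le_pow_left₀ hκ hκq.le k).trans
        (le_mul_of_one_le_right (by positivity) (by linarith))
    · exact sub_le_self _ (by positivity)
  have hlim : Tendsto (fun k => q ^ k * (1 + M)) atTop (𝓝 0) := by
    simpa using (tendsto_pow_atTop_nhds_zero_of_lt_one hq0 hq).mul_const (1 + M)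
  obtain ⟨k, hk⟩ := (hlim.eventually_lt_const zero_lt_one).exists
  exact ⟨k, (hnorm k).trans_lt hk⟩

theorem isUnit_one_sub_wcomp (c : HolderFun ρ ℝ) (n : ℕ) {κ : ℝ} (hκ : 0 ≤ κ)
    (hc : ∀ x, |∏ j ∈ Finset.range n, c (φ^[j] x)| ≤ κ) (hκL : κ * (L : ℝ) ^ n < 1) :
    IsUnit (1 - wcomp hφ c) := by
  obtain ⟨k, hk⟩ := exists_norm_wcomp_pow_lt_one (hφ.iterate n)
    (c := (wcomp hφ c ^ n) (const 1)) hκ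
    (fun x => by rw [wcomp_pow_apply, const_apply, mul_one]; exact hc x) (mod_cast hκL)
  rw [← wcomp_pow_eq, ← pow_mul] at hk
  exact isUnit_one_sub_of_norm_pow_lt_one _ _ hk

/-- The operator `w ↦ a · w - b · (w ∘ φ)`, the form that linearized conjugacy equations take in a
frame of invariant directions. -/
def twist (a b : HolderFun ρ ℝ) : HolderFun ρ ℝ →L[ℝ] HolderFun ρ ℝ := smulL a - wcomp hφ b

@[simp] theorem twist_apply (a b w : HolderFun ρ ℝ) (x : T) :
    twist hφ a b w x = a x * w x - b x * w (φ x) := rfl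

theorem smulL_bijective {a a' : HolderFun ρ ℝ} (haa' : ∀ x, a x * a' x = 1) :
    Function.Bijective (smulL a : HolderFun ρ V → HolderFun ρ V) :=
  Function.bijective_iff_has_inverse.2 ⟨smulL a',
    fun w => by ext x; simp [smul_smul, haa' x],
    fun w => by ext x; simp [smul_smul, mul_comm (a' x), haa' x]⟩

theorem twist_eq_smulL_comp_one_sub_wcomp {a a' : HolderFun ρ ℝ} (haa' : ∀ x, a x * a' x = 1)
    (b : HolderFun ρ ℝ) : twist hφ a b = smulL a ∘L (1 - wcomp hφ (smulL a' b)) := by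
  ext w x
  change a x * w x - b x * w (φ x) = a x * (w x - (a' x * b x) * w (φ x))
  linear_combination (b x * w (φ x)) * haa' x

theorem twist_bijective_of_right_lt {a a' : HolderFun ρ ℝ} (haa' : ∀ x, a x * a' x = 1)
    (b : HolderFun ρ ℝ) (n : ℕ) {κ : ℝ} (hκ : 0 ≤ κ)
    (hc : ∀ x, |∏ j ∈ Finset.range n, (a' (φ^[j] x) * b (φ^[j] x))| ≤ κ)
    (hκL : κ * (L : ℝ) ^ n < 1) : Function.Bijective (twist hφ a b) := by
  have hunit := isUnit_one_sub_wcomp hφ (smulL a' b) n hκ hc hκL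
  rw [ContinuousLinearMap.isUnit_iff_bijective] at hunit
  rw [twist_eq_smulL_comp_one_sub_wcomp hφ haa' b]
  exact (smulL_bijective haa').comp hunit

theorem comp_bijective {φ : Equiv.Perm T} {L' : ℝ≥0} (hφ : GaugeLipschitz ρ φ L)
    (hφ' : GaugeLipschitz ρ (φ⁻¹ : Equiv.Perm T) L') :
    Function.Bijective (comp hφ : HolderFun ρ V → HolderFun ρ V) :=
  Function.bijective_iff_has_inverse.2
    ⟨comp hφ', fun w => by ext x; simp, fun w => by ext x; simp⟩

theorem twist_eq_smulL_comp_comp_one_sub_wcomp {φ : Equiv.Perm T} {L' : ℝ≥0}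
    (hφ : GaugeLipschitz ρ φ L) (hφ' : GaugeLipschitz ρ (φ⁻¹ : Equiv.Perm T) L')
    (a : HolderFun ρ ℝ) {b b' : HolderFun ρ ℝ} (hbb' : ∀ x, b x * b' x = 1) :
    twist hφ a b = smulL (-b) ∘L comp hφ ∘L (1 - wcomp hφ' (comp hφ' (smulL b' a))) := by
  ext w x
  change a x * w x - b x * w (φ x) = (-b x) * (w (φ x) - (b' (φ⁻¹ (φ x)) * a (φ⁻¹ (φ x))) *
    w (φ⁻¹ (φ x)))
  rw [show φ⁻¹ (φ x) = x from φ.symm_apply_apply x]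
  linear_combination (-(a x * w x)) * hbb' x

theorem twist_bijective_of_left_lt {φ : Equiv.Perm T} {L' : ℝ≥0} (hφ : GaugeLipschitz ρ φ L)
    (hφ' : GaugeLipschitz ρ (φ⁻¹ : Equiv.Perm T) L') (a : HolderFun ρ ℝ) {b b' : HolderFun ρ ℝ}
    (hbb' : ∀ x, b x * b' x = 1) (n : ℕ) {κ : ℝ} (hκ : 0 ≤ κ)
    (hc : ∀ x, |∏ j ∈ Finset.range n, (b' (φ^[j] x) * a (φ^[j] x))| ≤ κ)
    (hκL : κ * (L' : ℝ) ^ n < 1) : Function.Bijective (twist hφ a b) := by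
  have hunit := isUnit_one_sub_wcomp hφ' (comp hφ' (smulL b' a)) n hκ (fun x => by
    exact (prod_range_inv_iterate φ (fun y => b' y * a y) n x).symm ▸ hc _) hκL
  rw [ContinuousLinearMap.isUnit_iff_bijective] at hunit
  rw [twist_eq_smulL_comp_comp_one_sub_wcomp hφ hφ' a hbb']
  exact (smulL_bijective (a' := -b') fun x => by simpa using hbb' x).comp
    ((comp_bijective hφ hφ').comp hunit)

end HolderFun

end WeightedComposition

section Frame

variable {T ι : Type*} [Fintype ι] {ρ : T → T → ℝ≥0} {V : Type*} [NormedAddCommGroup V]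
  [NormedSpace ℝ V]

/-- The vectors `v k x` are linearly independent, with a lower bound `c` for their combinations
that is uniform in `x`. -/
def IsUniformFrame (v : ι → T → V) (c : ℝ) : Prop :=
  0 < c ∧ ∀ x (a : ι → ℝ), c * ‖a‖ ≤ ‖∑ k, a k • v k x‖

namespace IsUniformFrame

variable {v : ι → T → V} {c : ℝ}

theorem norm_le (hv : IsUniformFrame v c) (x : T) (a : ι → ℝ) :
    ‖a‖ ≤ c⁻¹ * ‖∑ k, a k • v k x‖ := by
  rw [inv_mul_eq_div, le_div_iff₀ hv.1, mul_comm]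
  exact hv.2 x a

theorem linearIndependent (hv : IsUniformFrame v c) (x : T) :
    LinearIndependent ℝ (fun k => v k x) := by
  refine Fintype.linearIndependent_iff.2 fun a ha => ?_
  have hnorm := hv.norm_le x a
  rw [ha, norm_zero, mul_zero, norm_le_zero_iff] at hnorm
  exact congrFun hnorm

theorem exists_coords [FiniteDimensional ℝ V] (hv : IsUniformFrame v c)
    (hι : Fintype.card ι = Module.finrank ℝ V) (x : T) (w : V) :
    ∃ a : ι → ℝ, ∑ k, a k • v k x = w := by
  have hspan := (hv.linearIndependent x).span_eq_top_of_card_eq_finrank' hι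
  exact (Submodule.mem_span_range_iff_exists_fun ℝ).1 (hspan ▸ Submodule.mem_top)

theorem gaugeBound_coords (hv : IsUniformFrame v c) {u : T → V} {A B M N : ℝ}
    (hu : GaugeBound ρ u A B) (hvMN : ∀ k, GaugeBound ρ (v k) M N) {a : T → ι → ℝ}
    (ha : ∀ x, ∑ k, a x k • v k x = u x) :
    GaugeBound ρ a (c⁻¹ * A) (c⁻¹ * (B + Fintype.card ι * (c⁻¹ * A * N))) := by
  have hc : 0 < c⁻¹ := inv_pos.2 hv.1
  have hbound (x : T) : ‖a x‖ ≤ c⁻¹ * A :=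
    (hv.norm_le x (a x)).trans (by rw [ha]; gcongr; exact hu.1 x)
  refine ⟨hbound, fun x y => ?_⟩
  have hdiff : ∑ k, (a x - a y) k • v k x = (u x - u y) - ∑ k, a y k • (v k x - v k y) := by
    simp only [Pi.sub_apply, sub_smul, smul_sub, Finset.sum_sub_distrib, ha]
    abel
  have hsum : ‖∑ k, a y k • (v k x - v k y)‖ ≤ Fintype.card ι * (c⁻¹ * A * (N * ρ x y)) := by
    rw [← nsmul_eq_mul, ← Finset.card_univ]
    refine (norm_sum_le _ _).trans (Finset.sum_le_card_nsmul _ _ _ fun k _ => ?_)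
    rw [norm_smul]
    exact mul_le_mul ((norm_le_pi_norm (a y) k).trans (hbound y)) ((hvMN k).2 x y)
      (norm_nonneg _) ((norm_nonneg _).trans (hbound y))
  calc ‖a x - a y‖ ≤ c⁻¹ * ‖∑ k, (a x - a y) k • v k x‖ := hv.norm_le x _
    _ ≤ c⁻¹ * (B * ρ x y + Fintype.card ι * (c⁻¹ * A * (N * ρ x y))) := by
      rw [hdiff]
      gcongr
      exact norm_sub_le_of_le (hu.2 x y) hsum
    _ = c⁻¹ * (B + Fintype.card ι * (c⁻¹ * A * N)) * ρ x y := by ring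

theorem linearIndependent_of_sum_norm_sub_lt (hv : IsUniformFrame v c) {x : T} {w : ι → V}
    (hw : ∑ k, ‖w k - v k x‖ < c) : LinearIndependent ℝ w := by
  refine Fintype.linearIndependent_iff.2 fun a ha => ?_
  have hsum : ∑ k, a k • v k x = -∑ k, a k • (w k - v k x) := by
    simp only [smul_sub, Finset.sum_sub_distrib, ha, zero_sub, neg_neg]
  have hle : c * ‖a‖ ≤ (∑ k, ‖w k - v k x‖) * ‖a‖ := by
    refine (hv.2 x a).trans ?_
    rw [hsum, norm_neg, Finset.sum_mul]
    refine norm_sum_le_of_le _ fun k _ => ?_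
    rw [norm_smul, mul_comm]
    gcongr
    exact norm_le_pi_norm a k
  have hnorm : ‖a‖ ≤ 0 := le_of_mul_le_mul_left (by linarith) (sub_pos.2 hw)
  exact congrFun (norm_le_zero_iff.1 hnorm)

theorem of_sphere (hc : 0 < c)
    (h : ∀ x, ∀ a ∈ Metric.sphere (0 : ι → ℝ) 1, c ≤ ‖∑ k, a k • v k x‖) :
    IsUniformFrame v c := by
  refine ⟨hc, fun x a => ?_⟩
  obtain rfl | ha := eq_or_ne a 0
  · simp
  have hpos : 0 < ‖a‖ := norm_pos_iff.2 ha
  have hunit := h x (‖a‖⁻¹ • a) (by simp [norm_smul, hpos.ne'])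
  simp only [Pi.smul_apply, smul_assoc, ← Finset.smul_sum] at hunit
  rwa [norm_smul, norm_inv, norm_norm, inv_mul_eq_div, le_div_iff₀ hpos] at hunit

theorem exists_of_continuous [TopologicalSpace T] [CompactSpace T] (hv : ∀ k, Continuous (v k))
    (hli : ∀ x, LinearIndependent ℝ fun k => v k x) : ∃ c, IsUniformFrame v c := by
  have hcont : Continuous fun p : T × (ι → ℝ) => ‖∑ k, p.2 k • v k p.1‖ := by fun_prop
  obtain hempty | hne :=
    (Set.univ ×ˢ Metric.sphere (0 : ι → ℝ) 1 : Set (T × (ι → ℝ))).eq_empty_or_nonempty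
  · refine ⟨1, .of_sphere one_pos fun x a ha => ?_⟩
    exact absurd (Set.mk_mem_prod (Set.mem_univ x) ha) (hempty ▸ Set.notMem_empty _)
  · obtain ⟨⟨x₀, a₀⟩, ⟨-, ha₀⟩, hmin⟩ := (isCompact_univ.prod (isCompact_sphere _ _)).exists_isMinOn
      hne hcont.continuousOn
    refine ⟨_, .of_sphere (norm_pos_iff.2 fun hzero => ?_) fun x a ha =>
      hmin (Set.mk_mem_prod (Set.mem_univ x) ha)⟩
    have ha₀0 : a₀ = 0 := funext (Fintype.linearIndependent_iff.1 (hli x₀) a₀ hzero)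
    exact Metric.ne_of_mem_sphere ha₀ one_ne_zero ha₀0

end IsUniformFrame

namespace HolderFun

/-- The synthesis map `a ↦ ∑ aₖ vₖ` of a frame. -/
def frameL (v : ι → HolderFun ρ V) : (ι → HolderFun ρ ℝ) →L[ℝ] HolderFun ρ V :=
  ∑ k, (smulL.flip (v k)) ∘L (ContinuousLinearMap.proj k)

@[simp] theorem frameL_apply (v : ι → HolderFun ρ V) (a : ι → HolderFun ρ ℝ) (x : T) :
    frameL v a x = ∑ k, a k x • v k x := by
  rw [frameL, _root_.sum_apply, sum_apply]
  rfl

theorem frameL_bijective [FiniteDimensional ℝ V] (hι : Fintype.card ι = Module.finrank ℝ V)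
    {v : ι → HolderFun ρ V} {c : ℝ} (hv : IsUniformFrame (fun k => v k) c) :
    Function.Bijective (frameL v) := by
  constructor
  · rw [injective_iff_map_eq_zero]
    intro a ha
    ext k x
    have hnorm := hv.norm_le x (fun k => a k x)
    rw [← frameL_apply, ha, zero_apply, norm_zero, mul_zero, norm_le_zero_iff] at hnorm
    exact congrFun hnorm k
  · intro u
    choose a ha using fun x => hv.exists_coords hι x (u x)
    have hbound := hv.gaugeBound_coords u.gaugeBound (M := ∑ k, ‖v k‖) (N := ∑ k, ‖v k‖)
      (fun k => (v k).gaugeBound.mono (Finset.single_le_sum (fun k _ => norm_nonneg (v k))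
        (Finset.mem_univ k)) (Finset.single_le_sum (fun k _ => norm_nonneg (v k))
        (Finset.mem_univ k))) ha
    refine ⟨fun k => mk (fun x => a x k) ⟨_, _, fun x => (norm_le_pi_norm _ k).trans (hbound.1 x),
      fun x y => (norm_le_pi_norm (a x - a y) k).trans (hbound.2 x y)⟩, ?_⟩
    ext x
    rw [frameL_apply]
    exact ha x

end HolderFun

end Frame

section Superposition

variable {T : Type*} {ρ : T → T → ℝ≥0} {X V : Type*} [NormedAddCommGroup X] [NormedSpace ℝ X]
  [NormedAddCommGroup V] [NormedSpace ℝ V]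

theorem radius_pos_of_norm_le_geometric {p : FormalMultilinearSeries ℝ X V} {K C : ℝ} (hC : 0 ≤ C)
    (hp : ∀ n, ‖p n‖ ≤ K * C ^ n) : 0 < p.radius := by
  have hK : 0 ≤ K := by simpa using (norm_nonneg _).trans (hp 0)
  set s : ℝ≥0 := (C.toNNReal + 1)⁻¹
  have hCs : C * s ≤ 1 := by
    rw [NNReal.coe_inv, NNReal.coe_add, Real.coe_toNNReal C hC, NNReal.coe_one,
      mul_inv_le_iff₀ (by positivity)]
    linarith
  refine lt_of_lt_of_le (by positivity) (p.le_radius_of_bound (r := s) K fun n => ?_)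
  calc ‖p n‖ * (s : ℝ) ^ n ≤ K * C ^ n * (s : ℝ) ^ n := by gcongr; exact hp n
    _ = K * (C * s) ^ n := by rw [mul_pow, mul_assoc]
    _ ≤ K := mul_le_of_le_one_right hK (pow_le_one₀ (by positivity) hCs)

theorem exists_superposition [CompleteSpace V] (Φ : T → X → V)
    (q : ∀ n, HolderFun ρ (X [×n]→L[ℝ] V)) {K C r : ℝ} (hC : 0 ≤ C) (hr : 0 < r)
    (hq : ∀ n, ‖q n‖ ≤ K * C ^ n)
    (hsum : ∀ x u, ‖u‖ < r → HasSum (fun n => q n x (fun _ => u)) (Φ x u)) :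
    ∃ N : HolderFun ρ X → HolderFun ρ V,
      HasFPowerSeriesAt N (fun n => HolderFun.multilin n (q n)) 0 ∧
      ∀ᶠ u in 𝓝 (0 : HolderFun ρ X), ∀ x, N u x = Φ x (u x) := by
  set p : FormalMultilinearSeries ℝ (HolderFun ρ X) (HolderFun ρ V) :=
    fun n => HolderFun.multilin n (q n)
  have hradius : 0 < p.radius := by
    refine radius_pos_of_norm_le_geometric (mul_nonneg zero_le_two hC) (K := K) fun n => ?_
    calc ‖p n‖ ≤ 2 ^ n * ‖q n‖ := HolderFun.norm_multilin_le n (q n)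
      _ ≤ 2 ^ n * (K * C ^ n) := by gcongr; exact hq n
      _ = K * (2 * C) ^ n := by ring
  have hN := p.hasFPowerSeriesOnBall hradius
  refine ⟨p.sum, hN.hasFPowerSeriesAt, ?_⟩
  filter_upwards [Metric.ball_mem_nhds (0 : HolderFun ρ X) hr,
    Metric.eball_mem_nhds (0 : HolderFun ρ X) hradius] with u hur hup x
  have hseries := (hN.hasSum hup).mapL (HolderFun.eval x)
  simp only [zero_add, p, HolderFun.eval_apply, HolderFun.multilin_apply] at hseries
  exact hseries.unique (hsum x (u x) ((u.norm_apply_le x).trans_lt (by simpa using hur)))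

end Superposition

section TaylorBounds

variable {X V : Type*} [NormedAddCommGroup X] [NormedSpace ℝ X] [NormedAddCommGroup V]
  [NormedSpace ℝ V]

theorem exists_norm_changeOrigin_mul_pow_le (p : FormalMultilinearSeries ℝ X V) {s : ℝ≥0}
    (hs : (s + s : ℝ≥0∞) < p.radius) :
    ∃ S : ℝ, ∀ z : X, ‖z‖ ≤ s → ∀ n, ‖p.changeOrigin z n‖ * (s : ℝ) ^ n ≤ S := by
  have hsum := p.changeOriginSeries_summable_aux₁ hs
  have hsum_fiber := (NNReal.summable_sigma.1 hsum).1
  set S : ℝ≥0 := ∑' t : Σ k l : ℕ, { s : Finset (Fin (k + l)) // s.card = l },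
    ‖p (t.1 + t.2.1)‖₊ * s ^ t.2.1 * s ^ t.1 with hS
  refine ⟨S, fun z hz n => ?_⟩
  have hzs : ‖z‖₊ ≤ s := hz
  have hzp : (‖z‖₊ : ℝ≥0∞) < p.radius :=
    lt_of_le_of_lt (by exact_mod_cast hzs.trans (le_add_of_nonneg_left zero_le)) hs
  suffices ‖p.changeOrigin z n‖₊ * s ^ n ≤ S by exact_mod_cast this
  calc ‖p.changeOrigin z n‖₊ * s ^ n
      ≤ (∑' t : Σ l : ℕ, { s : Finset (Fin (n + l)) // s.card = l },
          ‖p (n + t.1)‖₊ * ‖z‖₊ ^ t.1) * s ^ n := by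
        gcongr
        exact p.nnnorm_changeOrigin_le n hzp
    _ = ∑' t : Σ l : ℕ, { s : Finset (Fin (n + l)) // s.card = l },
          ‖p (n + t.1)‖₊ * ‖z‖₊ ^ t.1 * s ^ n := by rw [NNReal.tsum_mul_right]
    _ ≤ ∑' t : Σ l : ℕ, { s : Finset (Fin (n + l)) // s.card = l },
          ‖p (n + t.1)‖₊ * s ^ t.1 * s ^ n := by
        refine Summable.tsum_le_tsum (fun t => ?_)
          ((p.changeOriginSeries_summable_aux₂ hzp n).mul_right _) (hsum_fiber n)
        gcongr
    _ ≤ S := by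
        rw [hS, hsum.tsum_sigma' hsum_fiber]
        exact (NNReal.summable_sigma.1 hsum).2.le_tsum n fun _ _ => zero_le

variable [CompleteSpace V]

theorem norm_iteratedFDeriv_le_of_hasFPowerSeriesOnBall {f : X → V}
    {p : FormalMultilinearSeries ℝ X V} {x : X} {r : ℝ≥0∞} (hf : HasFPowerSeriesOnBall f p x r)
    (n : ℕ) : ‖iteratedFDeriv ℝ n f x‖ ≤ n.factorial * ‖p n‖ := by
  refine ContinuousMultilinearMap.opNorm_le_bound (by positivity) fun v => ?_
  rw [hf.iteratedFDeriv_eq_sum_of_completeSpace]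
  calc ‖∑ σ : Equiv.Perm (Fin n), p n fun i => v (σ i)‖
      ≤ ∑ _σ : Equiv.Perm (Fin n), ‖p n‖ * ∏ i, ‖v i‖ := by
        refine norm_sum_le_of_le _ fun σ _ => ((p n).le_opNorm _).trans_eq ?_
        rw [Equiv.prod_comp σ (fun i => ‖v i‖)]
    _ = n.factorial * ‖p n‖ * ∏ i, ‖v i‖ := by
        rw [Finset.sum_const, Finset.card_univ, Fintype.card_perm, Fintype.card_fin,
          nsmul_eq_mul, mul_assoc]

/-- The Taylor series of `f` at `y` converges to `f` on the ball of radius `r`, and its coefficients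
are bounded by `K C ^ n`. -/
structure HasTaylorBound (f : X → V) (r K C : ℝ) (y : X) : Prop where
  norm_iteratedFDeriv_le : ∀ n, ‖iteratedFDeriv ℝ n f y‖ ≤ K * C ^ n * n.factorial
  hasSum : ∀ u, ‖u‖ < r →
    HasSum (fun n => ((n.factorial : ℝ)⁻¹ • iteratedFDeriv ℝ n f y) fun _ => u) (f (y + u))

omit [CompleteSpace V] in
theorem HasTaylorBound.mono {f : X → V} {r K C r' K' C' : ℝ} {y : X}
    (h : HasTaylorBound f r K C y) (hr : r' ≤ r) (hK : K ≤ K') (hC₀ : 0 ≤ C) (hC : C ≤ C')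
    (hK₀ : 0 ≤ K') : HasTaylorBound f r' K' C' y :=
  ⟨fun n => (h.norm_iteratedFDeriv_le n).trans (by gcongr), fun u hu => h.hasSum u (hu.trans_le hr)⟩

theorem eventually_hasTaylorBound {f : X → V} {x : X} (hf : AnalyticAt ℝ f x) :
    ∃ r > 0, ∃ K C : ℝ, 0 ≤ C ∧ ∀ᶠ y in 𝓝 x, HasTaylorBound f r K C y := by
  obtain ⟨p, R, hp⟩ := hf
  obtain ⟨s, hs, hsR⟩ : ∃ s : ℝ≥0, 0 < s ∧ (s + s : ℝ≥0∞) < R := by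
    obtain ⟨t, ht, htR⟩ := ENNReal.lt_iff_exists_nnreal_btwn.1 hp.r_pos
    refine ⟨t / 2, half_pos (mod_cast ht), ?_⟩
    rwa [← ENNReal.coe_add, add_halves]
  obtain ⟨S, hS⟩ := exists_norm_changeOrigin_mul_pow_le p (hsR.trans_le hp.r_le)
  refine ⟨s, hs, S, (s : ℝ)⁻¹, by positivity, ?_⟩
  filter_upwards [Metric.ball_mem_nhds x (NNReal.coe_pos.2 hs)] with y hy
  have hys : ‖y - x‖₊ < s := mem_ball_iff_norm.1 hy
  have hyR : (‖y - x‖₊ : ℝ≥0∞) + s < R := lt_trans (by gcongr; simp) hsR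
  have hpy := hp.changeOrigin (lt_of_le_of_lt le_self_add hyR)
  rw [add_sub_cancel] at hpy
  refine ⟨fun n => ?_, fun u hu => hpy.hasSum_iteratedFDeriv ?_⟩
  · have hcoeff : ‖p.changeOrigin (y - x) n‖ ≤ S * (s : ℝ)⁻¹ ^ n := by
      rw [inv_pow, ← div_eq_mul_inv, le_div_iff₀ (by positivity)]
      exact hS _ (NNReal.coe_le_coe.2 hys.le) n
    rw [mul_comm]
    exact (norm_iteratedFDeriv_le_of_hasFPowerSeriesOnBall hpy n).trans (by gcongr)
  · have hus : ‖u‖₊ < s := hu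
    rw [Metric.mem_eball, edist_zero_right, lt_tsub_iff_right, add_comm, enorm_eq_nnnorm]
    exact lt_trans (by gcongr; simp) hyR

theorem exists_forall_mem_hasTaylorBound {f : X → V} {S : Set X} (hf : AnalyticOnNhd ℝ f S)
    (hS : IsCompact S) :
    ∃ r > 0, ∃ K C : ℝ, 0 ≤ K ∧ 0 ≤ C ∧ ∀ y ∈ S, HasTaylorBound f r K C y := by
  refine hS.induction_on (p := fun s => ∃ r > 0, ∃ K C : ℝ, 0 ≤ K ∧ 0 ≤ C ∧
    ∀ y ∈ s, HasTaylorBound f r K C y) ?_ ?_ ?_ ?_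
  · exact ⟨1, one_pos, 0, 0, le_rfl, le_rfl, fun y hy => hy.elim⟩
  · rintro s t hst ⟨r, hr, K, C, hK, hC, ht⟩
    exact ⟨r, hr, K, C, hK, hC, fun y hy => ht y (hst hy)⟩
  · rintro s t ⟨r, hr, K, C, hK, hC, hs⟩ ⟨r', hr', K', C', _, hC', ht⟩
    have hKK' : 0 ≤ max K K' := hK.trans (le_max_left _ _)
    refine ⟨min r r', lt_min hr hr', max K K', max C C', hKK', hC.trans (le_max_left _ _), ?_⟩
    rintro y (hy | hy)
    · exact (hs y hy).mono (min_le_left _ _) (le_max_left _ _) hC (le_max_left _ _) hKK'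
    · exact (ht y hy).mono (min_le_right _ _) (le_max_right _ _) hC' (le_max_right _ _) hKK'
  · intro x hx
    obtain ⟨r, hr, K, C, hC, h⟩ := eventually_hasTaylorBound (hf x hx)
    exact ⟨{y | HasTaylorBound f r K C y}, mem_nhdsWithin_of_mem_nhds h, r, hr, max K 0, C,
      le_max_right _ _, hC, fun y hy => hy.mono le_rfl (le_max_left _ _) hC le_rfl
        (le_max_right _ _)⟩

end TaylorBounds

section Gauge

variable {T : Type*} [MetricSpace T] {V : Type*} [NormedAddCommGroup V]

/-- The gauge of `β`-Hölder continuity. -/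
def gauge (β : ℝ≥0) (x y : T) : ℝ≥0 := nndist x y ^ (β : ℝ)

theorem coe_gauge (β : ℝ≥0) (x y : T) : (gauge β x y : ℝ) = dist x y ^ (β : ℝ) := by
  simp [gauge, NNReal.coe_rpow]

@[simp] theorem coe_gauge_one (x y : T) : (gauge 1 x y : ℝ) = dist x y := by simp [coe_gauge]

theorem gaugeLipschitz_of_lipschitzWith (β : ℝ≥0) {φ : T → T} {L : ℝ≥0} (hL : 1 ≤ L)
    (hφ : LipschitzWith L φ) : GaugeLipschitz (gauge β) φ (L ^ (β : ℝ)) := by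
  refine ⟨NNReal.one_le_rpow hL β.2, fun x y => ?_⟩
  rw [gauge, gauge, ← NNReal.mul_rpow]
  exact NNReal.rpow_le_rpow (hφ.nndist_le x y) β.2

theorem holderWith_iff_gauge {β C : ℝ≥0} {f : T → V} :
    HolderWith C β f ↔ ∀ x y, ‖f x - f y‖ ≤ C * gauge β x y := by
  refine forall₂_congr fun x y => ?_
  rw [edist_nndist, edist_nndist, ← ENNReal.coe_rpow_of_nonneg _ β.coe_nonneg, ← dist_eq_norm]
  norm_cast

theorem le_max_mul_rpow_of_le {t a b r s y : ℝ} (hr : 0 ≤ r) (hrs : r ≤ s) (ht : 0 ≤ t)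
    (ha : 0 ≤ a) (hya : y ≤ a) (hyb : y ≤ b * t ^ s) : y ≤ max a b * t ^ r := by
  have hmax : 0 ≤ max a b := ha.trans (le_max_left _ _)
  rcases le_total 1 t with ht1 | ht1
  · exact (hya.trans (le_max_left _ _)).trans
      (le_mul_of_one_le_right hmax (Real.one_le_rpow ht1 hr))
  rcases ht.eq_or_lt with rfl | ht0
  · rcases hr.eq_or_lt with rfl | hr0
    · simpa using Or.inl hya
    · simpa [Real.zero_rpow hr0.ne', Real.zero_rpow (hr0.trans_le hrs).ne'] using hyb
  · exact hyb.trans (mul_le_mul (le_max_right _ _)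
      (Real.rpow_le_rpow_of_exponent_ge ht0 ht1 hrs) (by positivity) hmax)

theorem GaugeBound.of_exponent_le {β β' : ℝ≥0} (hβ : β ≤ β') {f : T → V} {a b : ℝ} (ha : 0 ≤ a)
    (hf : GaugeBound (gauge β') f a b) : GaugeBound (gauge β) f a (max (2 * a) b) := by
  refine ⟨hf.1, fun x y => ?_⟩
  have hosc : ‖f x - f y‖ ≤ 2 * a := two_mul a ▸ norm_sub_le_of_le (hf.1 x) (hf.1 y)
  have hlip := hf.2 x y
  rw [coe_gauge] at hlip ⊢
  exact le_max_mul_rpow_of_le β.2 (mod_cast hβ) dist_nonneg (by positivity) hosc hlip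

theorem HolderFun.exists_of_lipschitz [NormedSpace ℝ V] {β : ℝ≥0} (hβ : β ≤ 1) {f : T → V}
    {a b : ℝ} (ha : 0 ≤ a) (hb : 0 ≤ b) (hfa : ∀ x, ‖f x‖ ≤ a)
    (hfb : ∀ x y, ‖f x - f y‖ ≤ b * dist x y) :
    ∃ g : HolderFun (gauge (T := T) β) V, (∀ x, g x = f x) ∧ ‖g‖ ≤ 2 * a + b := by
  have hbound : GaugeBound (gauge β) f a (max (2 * a) b) :=
    GaugeBound.of_exponent_le hβ ha ⟨hfa, by simpa using hfb⟩
  exact ⟨mk f ⟨_, _, hbound⟩, fun x => rfl, norm_le (by positivity)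
    (hbound.mono (by linarith) (max_le (by linarith) (by linarith)))⟩

end Gauge

section HolderNorm

variable {d : ℕ} {V : Type*} [NormedAddCommGroup V]

theorem holderNorm_le_of_gaugeBound {β a b : ℝ≥0} {f : Torus d → V}
    (hf : GaugeBound (gauge β) f a b) : holderNorm β f ≤ ((a + b : ℝ≥0) : ℝ≥0∞) := by
  rw [holderNorm, ENNReal.coe_add]
  refine add_le_add (iSup_le fun ψ => ?_) (holderWith_iff_gauge.2 hf.2).eHolderNorm_le
  rw [enorm_eq_nnnorm]
  exact_mod_cast hf.1 ψ

theorem exists_gaugeBound_of_isHolder {β : ℝ≥0} {f : Torus d → V} (hf : IsHolder β f) :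
    ∃ a b : ℝ≥0, GaugeBound (gauge β) f a b := by
  have hsup : supNorm f < ∞ := lt_of_le_of_lt le_self_add hf
  obtain ⟨C, hC⟩ := eHolderNorm_lt_top.1 (lt_of_le_of_lt le_add_self hf)
  refine ⟨(supNorm f).toNNReal, C, fun ψ => ?_, holderWith_iff_gauge.1 hC⟩
  have hle : ‖f ψ‖ₑ ≤ supNorm f := le_iSup (fun ψ => ‖f ψ‖ₑ) ψ
  exact_mod_cast ENNReal.toNNReal_mono hsup.ne hle

theorem continuous_of_isHolder {β : ℝ≥0} (hβ : 0 < β) {f : Torus d → V} (hf : IsHolder β f) :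
    Continuous f := by
  obtain ⟨a, b, hab⟩ := exists_gaugeBound_of_isHolder hf
  exact (holderWith_iff_gauge.2 hab.2).continuous hβ

variable [NormedSpace ℝ V]

theorem HolderFun.holderNorm_le {β β' : ℝ≥0} (hβ : β ≤ β')
    (f : HolderFun (gauge (T := Torus d) β') V) : holderNorm β f ≤ ((3 * ‖f‖₊ : ℝ≥0) : ℝ≥0∞) := by
  have hbound := GaugeBound.of_exponent_le hβ (norm_nonneg f) f.gaugeBound
  rw [max_eq_left (by linarith [norm_nonneg f])] at hbound
  refine (holderNorm_le_of_gaugeBound (a := ‖f‖₊) (b := 2 * ‖f‖₊) hbound).trans_eq ?_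
  congr 1
  ring

theorem HolderFun.exists_of_isHolder {β β' : ℝ≥0} (hβ : β ≤ β') {f : Torus d → V}
    (hf : IsHolder β' f) : ∃ g : HolderFun (gauge (T := Torus d) β) V, ∀ ψ, g ψ = f ψ := by
  obtain ⟨a, b, hab⟩ := exists_gaugeBound_of_isHolder hf
  exact ⟨mk f ⟨_, _, hab.of_exponent_le hβ a.2⟩, fun ψ => rfl⟩

end HolderNorm

section Torus

variable {d : ℕ}

theorem proj_sub (x y : E d) : proj (x - y) = proj x - proj y := by
  ext i; simp [proj]

theorem proj_zero : proj (0 : E d) = 0 := by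
  ext; simp [proj]

theorem norm_proj_le (x : E d) : ‖proj x‖ ≤ ‖x‖ := by
  rw [PiLp.norm_eq_of_L2, PiLp.norm_eq_of_L2]
  gcongr
  exact QuotientAddGroup.norm_mk_le_norm

theorem rep_apply_mem (ψ : Torus d) (i : Fin d) : rep ψ i ∈ Set.Ioc (-Real.pi) Real.pi := by
  obtain ⟨hlower, hupper⟩ := (AddCircle.equivIoc (2 * Real.pi) (-Real.pi) (ψ i)).2
  exact ⟨hlower, hupper.trans_eq (by ring)⟩

theorem norm_rep (ψ : Torus d) : ‖rep ψ‖ = ‖ψ‖ := by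
  have hcoord (i : Fin d) : ‖rep ψ i‖ = ‖ψ i‖ := by
    have hproj : ((rep ψ i : ℝ) : AddCircle (2 * Real.pi)) = ψ i := by
      conv_rhs => rw [← proj_rep ψ]
      rfl
    rw [← hproj, Real.norm_eq_abs, eq_comm,
      AddCircle.norm_coe_eq_abs_iff _ Real.two_pi_pos.ne', abs_of_pos Real.two_pi_pos, abs_le]
    constructor <;> linarith [(rep_apply_mem ψ i).1, (rep_apply_mem ψ i).2]
  simp only [PiLp.norm_eq_of_L2, hcoord]

theorem lipschitzWith_proj : LipschitzWith 1 (proj : E d → Torus d) :=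
  LipschitzWith.of_dist_le_mul fun x y => by
    rw [dist_eq_norm, dist_eq_norm, ← proj_sub, NNReal.coe_one, one_mul]
    exact norm_proj_le _

theorem continuous_proj : Continuous (proj : E d → Torus d) := lipschitzWith_proj.continuous

theorem exists_isCompact_rep (d : ℕ) : ∃ S : Set (E d), IsCompact S ∧ ∀ ψ : Torus d, rep ψ ∈ S :=
  ⟨WithLp.toLp 2 '' (Set.univ.pi fun _ : Fin d => Set.Icc (-Real.pi) Real.pi),
    (isCompact_univ_pi fun _ => isCompact_Icc).image (PiLp.continuous_toLp 2 _),
    fun ψ => ⟨_, fun i _ => Set.Ioc_subset_Icc_self (rep_apply_mem ψ i), rfl⟩⟩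

instance : CompactSpace (Torus d) := by
  obtain ⟨S, hS, hrep⟩ := exists_isCompact_rep d
  exact ⟨(hS.image continuous_proj).of_isClosed_subset isClosed_univ
    fun ψ _ => ⟨rep ψ, hrep ψ, proj_rep ψ⟩⟩

theorem dist_eq_norm_rep (ψ ψ' : Torus d) : dist ψ ψ' = ‖rep (ψ - ψ')‖ := by
  rw [norm_rep, dist_eq_norm]

theorem map_add_proj {A : Torus d → Torus d} {g : E d → E d} (hg : ∀ x, proj (g x) = A (proj x))
    (ψ : Torus d) (u : E d) : A (ψ + proj u) = proj (g (rep ψ + u)) := by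
  rw [hg, proj_add, proj_rep]

end Torus

section QuasiPeriodic

variable {d : ℕ} {V : Type*} [NormedAddCommGroup V]

/-- A function on `ℝ^d` whose increments are periodic, such as a lift of a map of the torus. -/
def IsQuasiPeriodic (f : E d → V) : Prop :=
  ∀ k, proj k = 0 → ∀ x u, f (x + k + u) - f (x + k) = f (x + u) - f x

/-- The increment of a quasi-periodic function, as a function of a point of the torus and of a
displacement. -/
def incr (f : E d → V) (ψ : Torus d) (u : E d) : V := f (rep ψ + u) - f (rep ψ)

namespace IsQuasiPeriodic

theorem sub_eq {f : E d → V} (hf : IsQuasiPeriodic f) {x y : E d} (hxy : proj x = proj y)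
    (u : E d) : f (x + u) - f x = f (y + u) - f y := by
  have := hf (x - y) (by rw [proj_sub, hxy, sub_self]) y u
  rwa [add_sub_cancel] at this

theorem incr_proj {f : E d → V} (hf : IsQuasiPeriodic f) (x u : E d) :
    incr f (proj x) u = f (x + u) - f x :=
  hf.sub_eq (proj_rep _) u

theorem of_factorsThrough {f : E d → V} (hf : f.FactorsThrough proj) : IsQuasiPeriodic f := by
  intro k hk x u
  rw [hf (show proj (x + k + u) = proj (x + u) by simp [proj_add, hk]),
    hf (show proj (x + k) = proj x by simp [proj_add, hk])]

theorem factorsThrough_fderiv [NormedSpace ℝ V] {f : E d → V} (hf : IsQuasiPeriodic f) :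
    (fderiv ℝ f).FactorsThrough proj := by
  intro x y hxy
  have hderiv (z : E d) : fderiv ℝ f z = fderiv ℝ (fun u => f (z + u) - f z) 0 := by
    rw [fderiv_sub_const, fderiv_comp_add_left, add_zero]
  rw [hderiv x, hderiv y, funext (hf.sub_eq hxy)]

theorem of_factorsThrough_fderiv [NormedSpace ℝ V] {f : E d → V} (hf : Differentiable ℝ f)
    (h : (fderiv ℝ f).FactorsThrough proj) : IsQuasiPeriodic f := by
  intro k hk x u
  have hf_shift : Differentiable ℝ fun z => f (z + k) := hf.comp (by fun_prop)
  have hderiv (z : E d) : fderiv ℝ (fun z => f (z + k) - f z) z = 0 := by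
    rw [fderiv_fun_sub (hf_shift z) (hf z), fderiv_comp_add_right,
      h (show proj (z + k) = proj z by rw [proj_add, hk, add_zero]), sub_self]
  have hconst := is_const_of_fderiv_eq_zero (hf_shift.sub hf) hderiv (x + u) x
  rw [add_right_comm]
  exact sub_eq_sub_iff_sub_eq_sub.1 hconst

end IsQuasiPeriodic

theorem exists_bound_of_factorsThrough_proj {f : E d → V} (hf : Continuous f)
    (h : f.FactorsThrough proj) : ∃ C : ℝ, 0 ≤ C ∧ ∀ x, ‖f x‖ ≤ C := by
  obtain ⟨S, hS, hrep⟩ := exists_isCompact_rep d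
  obtain ⟨C, hC⟩ := hS.exists_bound_of_continuousOn hf.continuousOn
  have hbound (x : E d) : ‖f x‖ ≤ C := by
    rw [← h (proj_rep (proj x))]
    exact hC _ (hrep _)
  exact ⟨C, (norm_nonneg _).trans (hbound 0), hbound⟩

theorem norm_sub_rep_le {f : E d → V} {L : ℝ} (hL : ∀ x y, ‖f x - f y‖ ≤ L * ‖x - y‖)
    (h : f.FactorsThrough proj) (ψ ψ' : Torus d) :
    ‖f (rep ψ) - f (rep ψ')‖ ≤ L * dist ψ ψ' := by
  have hrep : proj (rep ψ) = proj (rep ψ' + rep (ψ - ψ')) := by simp [proj_add, proj_rep]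
  rw [h hrep, dist_eq_norm_rep]
  exact (hL _ _).trans_eq (by rw [add_sub_cancel_left])

variable [NormedSpace ℝ V] [CompleteSpace V]

theorem IsQuasiPeriodic.exists_lipschitzWith {f : E d → V} (h : IsQuasiPeriodic f)
    (hf : AnalyticOnNhd ℝ f Set.univ) : ∃ L : ℝ≥0, LipschitzWith L f := by
  obtain ⟨C, hC₀, hC⟩ := exists_bound_of_factorsThrough_proj
    (continuousOn_univ.1 hf.fderiv.continuousOn) h.factorsThrough_fderiv
  exact ⟨⟨C, hC₀⟩, lipschitzWith_of_nnnorm_fderiv_le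
    (fun x => (hf x trivial).differentiableAt) hC⟩

theorem HolderFun.exists_of_factorsThrough_proj {β : ℝ≥0} (hβ : β ≤ 1) {f : E d → V}
    (hf : AnalyticOnNhd ℝ f Set.univ) (h : f.FactorsThrough proj) :
    ∃ g : HolderFun (gauge (T := Torus d) β) V, ∀ x, g (proj x) = f x := by
  obtain ⟨L, hL⟩ := (IsQuasiPeriodic.of_factorsThrough h).exists_lipschitzWith hf
  obtain ⟨C, hC₀, hC⟩ :=
    exists_bound_of_factorsThrough_proj (continuousOn_univ.1 hf.continuousOn) h
  have hL' (x y : E d) : ‖f x - f y‖ ≤ L * ‖x - y‖ := by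
    simpa only [dist_eq_norm] using hL.dist_le_mul x y
  obtain ⟨g, hg, -⟩ := exists_of_lipschitz hβ hC₀ L.2 (fun ψ : Torus d => hC (rep ψ))
    (norm_sub_rep_le hL' h)
  exact ⟨g, fun x => (hg _).trans (h (proj_rep _))⟩

end QuasiPeriodic

section TorusSuperposition

variable {d : ℕ} {V : Type*} [NormedAddCommGroup V] [NormedSpace ℝ V]

/-- The Taylor coefficients of the increments of `f` at `x`. -/
def incrCoeff (f : E d → V) (n : ℕ) (x : E d) : (E d) [×n]→L[ℝ] V :=
  (n.factorial : ℝ)⁻¹ • iteratedFDeriv ℝ n (fun u => f (x + u) - f x) 0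

theorem incrCoeff_zero (f : E d → V) (x : E d) : incrCoeff f 0 x = 0 := by
  ext m; simp [incrCoeff]

theorem incrCoeff_succ (f : E d → V) (n : ℕ) (x : E d) :
    incrCoeff f (n + 1) x = ((n + 1).factorial : ℝ)⁻¹ • iteratedFDeriv ℝ (n + 1) f x := by
  have hderiv : fderiv ℝ (fun u => f (x + u) - f x) = fderiv ℝ (fun u => f (x + u)) :=
    funext fun u => fderiv_sub_const _
  have hshift : iteratedFDeriv ℝ (n + 1) (fun u => f (x + u) - f x) 0 =
      iteratedFDeriv ℝ (n + 1) (fun u => f (x + u)) 0 := by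
    ext m
    rw [iteratedFDeriv_succ_apply_right, iteratedFDeriv_succ_apply_right, hderiv]
  rw [incrCoeff, hshift, iteratedFDeriv_comp_add_left, add_zero]

theorem norm_incrCoeff_succ (f : E d → V) (n : ℕ) (x : E d) :
    ‖incrCoeff f (n + 1) x‖ = ((n + 1).factorial : ℝ)⁻¹ * ‖iteratedFDeriv ℝ (n + 1) f x‖ := by
  rw [incrCoeff_succ, norm_smul, norm_inv, RCLike.norm_natCast]

theorem IsQuasiPeriodic.factorsThrough_incrCoeff {f : E d → V} (hf : IsQuasiPeriodic f) (n : ℕ) :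
    (incrCoeff f n).FactorsThrough proj := by
  intro x y hxy
  rw [incrCoeff, incrCoeff, funext (hf.sub_eq hxy)]

theorem HasTaylorBound.norm_incrCoeff_le {f : E d → V} {r K C : ℝ} {x : E d}
    (hf : HasTaylorBound f r K C x) (hK : 0 ≤ K) (n : ℕ) :
    ‖incrCoeff f n x‖ ≤ K * C ^ n := by
  cases n with
  | zero => simpa [incrCoeff_zero] using hK
  | succ n =>
    rw [norm_incrCoeff_succ, inv_mul_le_iff₀ (by positivity), mul_comm]
    exact hf.norm_iteratedFDeriv_le (n + 1)

theorem HasTaylorBound.hasSum_incrCoeff {f : E d → V} {r K C : ℝ} {x : E d}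
    (hf : HasTaylorBound f r K C x) {u : E d} (hu : ‖u‖ < r) :
    HasSum (fun n => incrCoeff f n x fun _ => u) (f (x + u) - f x) := by
  refine ((hf.hasSum u hu).sub (hasSum_ite_eq 0 (f x))).congr_fun fun n => ?_
  cases n with
  | zero => simp [incrCoeff_zero]
  | succ n => simp [incrCoeff_succ]

variable [CompleteSpace V]

theorem norm_incrCoeff_sub_le {f : E d → V} (hf : AnalyticOnNhd ℝ f Set.univ) {K C : ℝ}
    (hK : 0 ≤ K) (hC : 0 ≤ C) (hbound : ∀ n x, ‖incrCoeff f n x‖ ≤ K * C ^ n) (n : ℕ)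
    (x y : E d) : ‖incrCoeff f n x - incrCoeff f n y‖ ≤ K * C * (2 * C) ^ n * ‖x - y‖ := by
  cases n with
  | zero => rw [incrCoeff_zero, incrCoeff_zero, sub_self, norm_zero]; positivity
  | succ n =>
    have hderiv (z : E d) : ‖fderiv ℝ (iteratedFDeriv ℝ (n + 1) f) z‖ ≤
        (n + 1).factorial * (K * C * (2 * C) ^ (n + 1)) := by
      have htwo : (n + 2 : ℝ) ≤ 2 ^ (n + 1) := mod_cast Nat.lt_two_pow_self (n := n + 1)
      calc ‖fderiv ℝ (iteratedFDeriv ℝ (n + 1) f) z‖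
          = (n + 2).factorial * ‖incrCoeff f (n + 2) z‖ := by
            rw [norm_fderiv_iteratedFDeriv, norm_incrCoeff_succ,
              mul_inv_cancel_left₀ (by positivity)]
        _ ≤ (n + 2).factorial * (K * C ^ (n + 2)) := by gcongr; exact hbound (n + 2) z
        _ = (n + 2) * (n + 1).factorial * (K * C ^ (n + 2)) := by
            rw [Nat.factorial_succ (n + 1)]
            push_cast
            ring
        _ ≤ 2 ^ (n + 1) * (n + 1).factorial * (K * C ^ (n + 2)) := by gcongr
        _ = (n + 1).factorial * (K * C * (2 * C) ^ (n + 1)) := by ring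
    rw [incrCoeff_succ, incrCoeff_succ, ← smul_sub, norm_smul, norm_inv, RCLike.norm_natCast,
      inv_mul_le_iff₀ (by positivity), ← mul_assoc]
    exact Convex.norm_image_sub_le_of_norm_fderiv_le (𝕜 := ℝ)
      (fun z _ => (hf.iteratedFDeriv (n + 1) z trivial).differentiableAt)
      (fun z _ => hderiv z) convex_univ (Set.mem_univ y) (Set.mem_univ x)

theorem HolderFun.exists_incrCoeff {β : ℝ≥0} (hβ : β ≤ 1) {f : E d → V}
    (hf : AnalyticOnNhd ℝ f Set.univ) (hper : IsQuasiPeriodic f) {K C : ℝ}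
    (hK : 0 ≤ K) (hC : 0 ≤ C) (hbound : ∀ n x, ‖incrCoeff f n x‖ ≤ K * C ^ n) (n : ℕ) :
    ∃ q : HolderFun (gauge (T := Torus d) β) ((E d) [×n]→L[ℝ] V),
      (∀ ψ, q ψ = incrCoeff f n (rep ψ)) ∧ ‖q‖ ≤ (2 * K + K * C) * (2 * C) ^ n := by
  obtain ⟨q, hq, hqnorm⟩ := exists_of_lipschitz hβ (by positivity) (by positivity)
    (fun ψ : Torus d => hbound n (rep ψ))
    (norm_sub_rep_le (norm_incrCoeff_sub_le hf hK hC hbound n) (hper.factorsThrough_incrCoeff n))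
  refine ⟨q, hq, hqnorm.trans ?_⟩
  have : K * C ^ n ≤ K * (2 * C) ^ n := by gcongr; linarith
  linarith

theorem exists_incr_superposition {β : ℝ≥0} (hβ : β ≤ 1) {f : E d → V}
    (hf : AnalyticOnNhd ℝ f Set.univ) (hper : IsQuasiPeriodic f) :
    ∃ (N : HolderFun (gauge (T := Torus d) β) (E d) → HolderFun (gauge (T := Torus d) β) V)
      (N' : HolderFun (gauge (T := Torus d) β) (E d) →L[ℝ] HolderFun (gauge (T := Torus d) β) V),
      AnalyticAt ℝ N 0 ∧ N 0 = 0 ∧ HasFDerivAt N N' 0 ∧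
      (∀ u ψ, N' u ψ = fderiv ℝ f (rep ψ) (u ψ)) ∧ ∀ᶠ u in 𝓝 0, ∀ ψ, N u ψ = incr f ψ (u ψ) := by
  obtain ⟨S, hS, hrep⟩ := exists_isCompact_rep d
  obtain ⟨r, hr, K, C, hK, hC, hTaylor⟩ :=
    exists_forall_mem_hasTaylorBound (hf.mono (Set.subset_univ S)) hS
  have hbound (n : ℕ) (x : E d) : ‖incrCoeff f n x‖ ≤ K * C ^ n := by
    rw [← hper.factorsThrough_incrCoeff n (proj_rep (proj x))]
    exact (hTaylor _ (hrep _)).norm_incrCoeff_le hK n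
  choose q hq hqnorm using HolderFun.exists_incrCoeff hβ hf hper hK hC hbound
  obtain ⟨N, hN, hNincr⟩ := exists_superposition (incr f) q (by positivity) hr hqnorm
    fun ψ u hu => by
      simp only [hq]
      exact (hTaylor _ (hrep ψ)).hasSum_incrCoeff hu
  refine ⟨N, continuousMultilinearCurryFin1 ℝ (HolderFun _ (E d)) (HolderFun _ V)
    (HolderFun.multilin 1 (q 1)), hN.analyticAt, ?_,
    hN.hasFDerivAt, fun u ψ => ?_, hNincr⟩
  · ext ψ
    simp [hNincr.self_of_nhds ψ, incr]
  · simp [hq, incrCoeff_succ]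

end TorusSuperposition

section Implicit

variable {P X Y : Type*} [NormedAddCommGroup P] [NormedSpace ℝ P] [CompleteSpace P]
  [NormedAddCommGroup X] [NormedSpace ℝ X] [CompleteSpace X]
  [NormedAddCommGroup Y] [NormedSpace ℝ Y] [CompleteSpace Y]

theorem exists_analytic_implicit {G : P × X → Y} (hG : AnalyticAt ℝ G (0, 0)) (hG₀ : G (0, 0) = 0)
    {L : X →L[ℝ] Y} (hbij : Function.Bijective L) (hL : HasFDerivAt (fun x => G (0, x)) L 0) :
    ∃ φ : P → X, AnalyticAt ℝ φ 0 ∧ φ 0 = 0 ∧ ∀ᶠ p in 𝓝 (0 : P), G (p, φ p) = 0 := by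
  have hpartial : fderiv ℝ G (0, 0) ∘L .inr ℝ P X = L :=
    (hG.differentiableAt.hasFDerivAt.comp (0 : X) (hasFDerivAt_prodMk_right 0 0)).unique hL
  have hinv : (fderiv ℝ G (0, 0) ∘L .inr ℝ P X).IsInvertible :=
    ⟨.ofBijective L (LinearMap.ker_eq_bot.2 hbij.1) (LinearMap.range_eq_top.2 hbij.2),
      (ContinuousLinearEquiv.coe_ofBijective _ _ _).trans hpartial.symm⟩
  have hGω : ContDiffAt ℝ ⊤ G (0, 0) := hG.contDiffAt
  refine ⟨hGω.implicitFunction (by simp) hinv, (hGω.contDiffAt_implicitFunction _ hinv).analyticAt,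
    hGω.implicitFunction_apply_self _ hinv, ?_⟩
  rw [← hG₀]
  exact hGω.eventually_apply_implicitFunction _ hinv

end Implicit

section AnalyticFamilies

variable {d : ℕ} {V : Type*} [NormedAddCommGroup V] [NormedSpace ℝ V]

theorem eventually_isAnalyticHolder {β' : ℝ≥0} {f : ℝ → HolderFun (gauge (T := Torus d) β') V}
    (hf : AnalyticAt ℝ f 0) :
    ∀ᶠ ε₀ in 𝓝[>] (0 : ℝ), ∀ β ≤ β', IsAnalyticHolder β ε₀ (fun ε ψ => f ε ψ) := by
  obtain ⟨p, R, hp⟩ := hf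
  obtain ⟨s, hs₀, hsR⟩ := ENNReal.lt_iff_exists_nnreal_btwn.1 hp.r_pos
  have hs₀' : 0 < s := mod_cast hs₀
  obtain ⟨K, -, hKbound⟩ := p.nnnorm_mul_pow_le_of_lt_radius (hsR.trans_le hp.r_le)
  filter_upwards [Ioc_mem_nhdsGT (NNReal.coe_pos.2 hs₀')] with ε₀ ⟨_, hεs⟩ β hβ
  refine ⟨fun n => p.coeff n, 3 * K, s⁻¹, ?_, fun n => ?_, fun ε hε ψ => ?_⟩
  · rwa [NNReal.coe_inv, inv_mul_le_iff₀ (mod_cast hs₀'), mul_one]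
  · refine ((p.coeff n).holderNorm_le hβ).trans ?_
    rw [ENNReal.coe_le_coe, mul_assoc]
    gcongr
    have hcoeff : ‖p.coeff n‖₊ ≤ ‖p n‖₊ := by
      simpa using (p n).le_opNNNorm (fun _ => (1 : ℝ))
    rw [inv_pow, ← div_eq_mul_inv, le_div_iff₀ (by positivity)]
    exact (mul_le_mul_left hcoeff _).trans (hKbound n)
  · have hmem : ε ∈ Metric.eball (0 : ℝ) R := by
      rw [Metric.mem_eball, edist_zero_right]
      refine lt_trans ?_ hsR
      rw [enorm_eq_nnnorm, ENNReal.coe_lt_coe]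
      exact hε.trans_le hεs
    have hsum := (hp.hasSum hmem).mapL (HolderFun.eval ψ)
    simpa only [FormalMultilinearSeries.apply_eq_pow_smul_coeff, HolderFun.eval_apply,
      HolderFun.smul_apply, zero_add] using hsum

end AnalyticFamilies

section Lifts

variable {d : ℕ}

theorem IsAnalyticMap.exists_lift {f : Torus d → Torus d} (hf : IsAnalyticMap f) :
    ∃ g : E d → E d, AnalyticOnNhd ℝ g Set.univ ∧ (∀ x, proj (g x) = f (proj x)) ∧
      IsQuasiPeriodic g ∧ ∀ x, tderiv f (proj x) = fderiv ℝ g x := by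
  obtain ⟨g, hg, hgf⟩ := hf
  have htderiv (x : E d) : tderiv f (proj x) = fderiv ℝ g x :=
    tderiv_eq_of_lift hgf (hg x trivial).continuousAt
  refine ⟨g, hg, hgf, .of_factorsThrough_fderiv (fun x => (hg x trivial).differentiableAt) ?_,
    htderiv⟩
  intro x y hxy
  rw [← htderiv, ← htderiv, hxy]

theorem IsAnalyticMap.comp {f f' : Torus d → Torus d} (hf : IsAnalyticMap f)
    (hf' : IsAnalyticMap f') : IsAnalyticMap (f ∘ f') := by
  obtain ⟨g, hg, hgf⟩ := hf
  obtain ⟨g', hg', hgf'⟩ := hf'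
  exact ⟨g ∘ g', fun x _ => (hg _ trivial).comp (hg' x trivial), fun x => by simp [hgf, hgf']⟩

theorem isAnalyticMap_id : IsAnalyticMap (id : Torus d → Torus d) :=
  ⟨id, fun _ _ => analyticAt_id, fun _ => rfl⟩

theorem tderiv_comp {f f' : Torus d → Torus d} (hf : IsAnalyticMap f)
    (hf' : IsAnalyticMap f') (ψ : Torus d) :
    tderiv (f ∘ f') ψ = tderiv f (f' ψ) ∘L tderiv f' ψ := by
  obtain ⟨g, hg, hgf, -, hgt⟩ := hf.exists_lift
  obtain ⟨g', hg', hgf', -, hgt'⟩ := hf'.exists_lift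
  have hlift (x : E d) : proj ((g ∘ g') x) = (f ∘ f') (proj x) := by simp [hgf, hgf']
  have hd := hg (g' (rep ψ)) trivial
  have hd' := hg' (rep ψ) trivial
  have htderiv := tderiv_eq_of_lift hlift (x := rep ψ) (hd.comp hd').continuousAt
  rwa [fderiv_comp _ hd.differentiableAt hd'.differentiableAt, ← hgt, ← hgt', hgf', proj_rep]
    at htderiv

theorem tderiv_id (ψ : Torus d) :
    tderiv (id : Torus d → Torus d) ψ = ContinuousLinearMap.id ℝ _ := by
  have := tderiv_eq_of_lift (f := id) (g := id) (fun _ => rfl) (x := rep ψ) continuousAt_id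
  rwa [proj_rep, fderiv_id] at this

theorem IsAnalyticMap.exists_lipschitzWith {f : Torus d → Torus d} (hf : IsAnalyticMap f) :
    ∃ L : ℝ≥0, LipschitzWith L f := by
  obtain ⟨g, hg, hgf, hper, -⟩ := hf.exists_lift
  obtain ⟨L, hL⟩ := hper.exists_lipschitzWith hg
  refine ⟨L, LipschitzWith.of_dist_le_mul fun ψ ψ' => ?_⟩
  have hψ : f ψ = proj (g (rep ψ' + rep (ψ - ψ'))) := by simp [hgf, proj_add, proj_rep]
  have hψ' : f ψ' = proj (g (rep ψ')) := by rw [hgf, proj_rep]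
  calc dist (f ψ) (f ψ') ≤ dist (g (rep ψ' + rep (ψ - ψ'))) (g (rep ψ')) := by
        rw [hψ, hψ', dist_eq_norm, dist_eq_norm, ← proj_sub]
        exact norm_proj_le _
    _ ≤ L * dist ψ ψ' := by
        refine (hL.dist_le_mul _ _).trans_eq ?_
        rw [dist_eq_norm, add_sub_cancel_left, dist_eq_norm_rep]

variable {A : Equiv.Perm (Torus d)}

theorem isAnalyticMap_pow (hA : IsAnalyticMap A) (n : ℕ) :
    IsAnalyticMap (A ^ n : Equiv.Perm (Torus d)) := by
  induction n with
  | zero => exact isAnalyticMap_id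
  | succ n ih => rw [pow_succ]; exact ih.comp hA

theorem tderiv_pow_zero (ψ : Torus d) :
    tderiv (A ^ 0 : Equiv.Perm (Torus d)) ψ = ContinuousLinearMap.id ℝ _ :=
  tderiv_id ψ

theorem tderiv_pow_succ (hA : IsAnalyticMap A) (n : ℕ) (ψ : Torus d) :
    tderiv (A ^ (n + 1) : Equiv.Perm (Torus d)) ψ =
      tderiv A ((A ^ n : Equiv.Perm (Torus d)) ψ) ∘L tderiv (A ^ n : Equiv.Perm (Torus d)) ψ := by
  rw [pow_succ']
  exact tderiv_comp hA (isAnalyticMap_pow hA n) ψ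

theorem tderiv_inv_pow_tderiv_pow (hA : IsAnalyticMap A) (hA' : IsAnalyticMap (A⁻¹ : Equiv.Perm _))
    (n : ℕ) (ψ : Torus d) (w : E d) :
    tderiv (A⁻¹ ^ n : Equiv.Perm (Torus d)) ((A ^ n : Equiv.Perm (Torus d)) ψ)
      (tderiv (A ^ n : Equiv.Perm (Torus d)) ψ w) = w := by
  have hid : (⇑(A⁻¹ ^ n) ∘ ⇑(A ^ n) : Torus d → Torus d) = id := by
    rw [← Equiv.Perm.coe_mul, inv_pow, inv_mul_cancel, Equiv.Perm.coe_one]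
  rw [← ContinuousLinearMap.comp_apply,
    ← tderiv_comp (isAnalyticMap_pow hA' n) (isAnalyticMap_pow hA n) ψ, hid, tderiv_id,
    ContinuousLinearMap.id_apply]

theorem tderiv_inv_tderiv (hA : IsAnalyticMap A) (hA' : IsAnalyticMap (A⁻¹ : Equiv.Perm _))
    (ψ : Torus d) (w : E d) :
    tderiv (A⁻¹ : Equiv.Perm (Torus d)) (A ψ) (tderiv A ψ w) = w := by
  simpa using tderiv_inv_pow_tderiv_pow hA hA' 1 ψ w

theorem cocycle_succ (A : Equiv.Perm (Torus d)) (Λ : Torus d → ℝ) (n : ℕ) (ψ : Torus d) :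
    cocycle A Λ (n + 1) ψ = cocycle A Λ n ψ * Λ ((A ^ n : Equiv.Perm (Torus d)) ψ) :=
  Finset.prod_range_succ _ _

theorem cocycle_ne_zero {Λ : Torus d → ℝ} (h : ∀ ψ, Λ ψ ≠ 0) (n : ℕ) (ψ : Torus d) :
    cocycle A Λ n ψ ≠ 0 := Finset.prod_ne_zero_iff.2 fun _ _ => h _

theorem cocycle_eq_iterate (A : Equiv.Perm (Torus d)) (Λ : Torus d → ℝ) (n : ℕ) (ψ : Torus d) :
    cocycle A Λ n ψ = ∏ j ∈ Finset.range n, Λ (A^[j] ψ) := by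
  simp only [cocycle, Equiv.Perm.iterate_eq_pow]

theorem cocycle_inv (A : Equiv.Perm (Torus d)) (Λ : Torus d → ℝ) (n : ℕ) (ψ : Torus d) :
    cocycle A⁻¹ (fun φ => (Λ (A⁻¹ φ))⁻¹) n ψ =
      (cocycle A Λ n ((A⁻¹ ^ n : Equiv.Perm (Torus d)) ψ))⁻¹ := by
  rw [cocycle_eq_iterate, cocycle_eq_iterate, prod_range_inv_iterate A (fun φ => (Λ φ)⁻¹),
    Finset.prod_inv_distrib, Equiv.Perm.iterate_eq_pow A⁻¹ n]

/-- The derivative of `A` maps the line spanned by the field `v` to itself, with rate `Λ`. -/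
def IsEigenfield (A : Equiv.Perm (Torus d)) (v : Torus d → E d) (Λ : Torus d → ℝ) : Prop :=
  ∀ ψ, tderiv A ψ (v ψ) = Λ ψ • v (A ψ)

namespace IsEigenfield

variable {v : Torus d → E d} {Λ : Torus d → ℝ}

theorem tderiv_pow (h : IsEigenfield A v Λ) (hA : IsAnalyticMap A) (n : ℕ) (ψ : Torus d) :
    tderiv (A ^ n : Equiv.Perm (Torus d)) ψ (v ψ) =
      cocycle A Λ n ψ • v ((A ^ n : Equiv.Perm (Torus d)) ψ) := by
  induction n with
  | zero => simp [cocycle, tderiv_id]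
  | succ n ih =>
    rw [tderiv_pow_succ hA, ContinuousLinearMap.comp_apply, ih, map_smul, h, smul_smul,
      cocycle_succ, pow_succ', Equiv.Perm.mul_apply]

theorem ne_zero (h : IsEigenfield A v Λ) (hA : IsAnalyticMap A)
    (hA' : IsAnalyticMap (A⁻¹ : Equiv.Perm _)) (hv : ∀ ψ, v ψ ≠ 0) (ψ : Torus d) : Λ ψ ≠ 0 := by
  intro hΛ
  have hinv := tderiv_inv_tderiv hA hA' ψ (v ψ)
  rw [h, hΛ, zero_smul, map_zero] at hinv
  exact hv ψ hinv.symm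

theorem inv (h : IsEigenfield A v Λ) (hA : IsAnalyticMap A)
    (hA' : IsAnalyticMap (A⁻¹ : Equiv.Perm _)) (hv : ∀ ψ, v ψ ≠ 0) :
    IsEigenfield A⁻¹ v fun φ => (Λ (A⁻¹ φ))⁻¹ := by
  intro ψ
  have hinv := tderiv_inv_tderiv hA hA' (A⁻¹ ψ) (v (A⁻¹ ψ))
  rw [h, map_smul, show A (A⁻¹ ψ) = ψ by simp] at hinv
  simp only [← hinv, smul_smul, inv_mul_cancel₀ (h.ne_zero hA hA' hv _), one_smul]

end IsEigenfield

end Lifts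

section Hyperbolic

variable {d : ℕ} {A : Equiv.Perm (Torus d)} {Ws Wu : Torus d → Submodule ℝ (E d)}

theorem exists_forall_le_norm {V : Type*} [NormedAddCommGroup V] {v : Torus d → V}
    (hv : Continuous v) (hv₀ : ∀ ψ, v ψ ≠ 0) : ∃ m > 0, ∀ ψ, m ≤ ‖v ψ‖ := by
  obtain ⟨ψ, -, hψ⟩ := isCompact_univ.exists_isMinOn (Set.univ_nonempty (α := Torus d))
    hv.norm.continuousOn
  exact ⟨‖v ψ‖, norm_pos_iff.2 (hv₀ ψ), fun φ => hψ (Set.mem_univ φ)⟩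

theorem exists_forall_norm_le {V : Type*} [SeminormedAddCommGroup V] {v : Torus d → V}
    (hv : Continuous v) : ∃ M > 0, ∀ ψ, ‖v ψ‖ ≤ M := by
  obtain ⟨M, hM⟩ := isCompact_univ.exists_bound_of_continuousOn hv.continuousOn
  exact ⟨max M 1, by positivity, fun ψ => (hM ψ trivial).trans (le_max_left _ _)⟩

theorem map_tderiv_inv (hA : IsAnalyticMap A) (hA' : IsAnalyticMap (A⁻¹ : Equiv.Perm _))
    {W : Torus d → Submodule ℝ (E d)}
    (hW : ∀ ψ, (W ψ).map (tderiv A ψ).toLinearMap = W (A ψ)) (ψ : Torus d) :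
    (W ψ).map (tderiv (A⁻¹ : Equiv.Perm (Torus d)) ψ).toLinearMap = W (A⁻¹ ψ) := by
  obtain ⟨φ, rfl⟩ := A.surjective ψ
  have hid : (tderiv (A⁻¹ : Equiv.Perm (Torus d)) (A φ)).toLinearMap ∘ₗ
      (tderiv A φ).toLinearMap = LinearMap.id :=
    LinearMap.ext (tderiv_inv_tderiv hA hA' φ)
  rw [← hW, ← Submodule.map_comp, hid, Submodule.map_id, show A⁻¹ (A φ) = φ by simp]

namespace IsHyperbolicSplitting

theorem symm (hs : IsHyperbolicSplitting A Ws Wu) (hA : IsAnalyticMap A)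
    (hA' : IsAnalyticMap (A⁻¹ : Equiv.Perm _)) : IsHyperbolicSplitting A⁻¹ Wu Ws := by
  obtain ⟨ds, du, hdim⟩ := hs.dim_const
  obtain ⟨Θ, l, hΘ, hl₀, hl₁, h⟩ := hs.hyperbolic
  exact
    { isCompl := fun ψ => (hs.isCompl ψ).symm
      dim_const := ⟨du, ds, fun ψ => (hdim ψ).symm⟩
      invariant_s := map_tderiv_inv hA hA' hs.invariant_u
      invariant_u := map_tderiv_inv hA hA' hs.invariant_s
      continuous_s := hs.continuous_u
      continuous_u := hs.continuous_s
      hyperbolic := ⟨Θ, l, hΘ, hl₀, hl₁, fun n ψ => (h n ψ).symm⟩ }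

theorem exists_add_eq (hs : IsHyperbolicSplitting A Ws Wu) (ψ : Torus d) (w : E d) :
    ∃ s ∈ Ws ψ, ∃ u ∈ Wu ψ, s + u = w :=
  Submodule.mem_sup.1 ((hs.isCompl ψ).sup_eq_top ▸ Submodule.mem_top)

theorem tderiv_pow_mem (hs : IsHyperbolicSplitting A Ws Wu)
    (hA : IsAnalyticMap A) (n : ℕ) {ψ : Torus d} {w : E d} (hw : w ∈ Wu ψ) :
    tderiv (A ^ n : Equiv.Perm (Torus d)) ψ w ∈ Wu ((A ^ n : Equiv.Perm (Torus d)) ψ) := by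
  induction n with
  | zero => exact (tderiv_pow_zero (A := A) ψ) ▸ hw
  | succ n ih =>
    rw [tderiv_pow_succ hA, ContinuousLinearMap.comp_apply, pow_succ', Equiv.Perm.mul_apply,
      ← hs.invariant_u]
    exact Submodule.mem_map_of_mem ih

theorem exists_norm_tderiv_pow_le (hs : IsHyperbolicSplitting A Ws Wu) {ψ : Torus d} {w : E d}
    (hw : w ∈ Ws ψ) : ∃ B, ∀ n : ℕ, ‖tderiv (A ^ n : Equiv.Perm (Torus d)) ψ w‖ ≤ B := by
  obtain ⟨Θ, l, hΘ, hl₀, hl₁, h⟩ := hs.hyperbolic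
  refine ⟨Θ * ‖w‖, fun n => ((h n ψ).1 w hw).trans ?_⟩
  gcongr
  exact mul_le_of_le_one_right hΘ.le (pow_le_one₀ hl₀.le hl₁.le)

theorem tendsto_norm_tderiv_pow_of_mem (hs : IsHyperbolicSplitting A Ws Wu)
    (hA : IsAnalyticMap A) (hA' : IsAnalyticMap (A⁻¹ : Equiv.Perm _)) {ψ : Torus d} {u : E d}
    (hu : u ∈ Wu ψ) (hu₀ : u ≠ 0) :
    Tendsto (fun n : ℕ => ‖tderiv (A ^ n : Equiv.Perm (Torus d)) ψ u‖) atTop atTop := by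
  obtain ⟨Θ, l, hΘ, hl₀, hl₁, h⟩ := hs.hyperbolic
  have hexp : Tendsto (fun n : ℕ => ‖u‖ / Θ * l⁻¹ ^ n) atTop atTop :=
    (tendsto_pow_atTop_atTop_of_one_lt ((one_lt_inv₀ hl₀).2 hl₁)).const_mul_atTop
      (div_pos (norm_pos_iff.2 hu₀) hΘ)
  refine tendsto_atTop_mono (fun n => ?_) hexp
  have hback := (h n ((A ^ n : Equiv.Perm (Torus d)) ψ)).2 _ (hs.tderiv_pow_mem hA n hu)
  rw [tderiv_inv_pow_tderiv_pow hA hA'] at hback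
  rwa [inv_pow, ← div_eq_mul_inv, div_div, div_le_iff₀ (by positivity), mul_comm]

theorem tendsto_norm_tderiv_pow (hs : IsHyperbolicSplitting A Ws Wu)
    (hA : IsAnalyticMap A) (hA' : IsAnalyticMap (A⁻¹ : Equiv.Perm _)) {ψ : Torus d} {w : E d}
    (hw : w ∉ Ws ψ) :
    Tendsto (fun n : ℕ => ‖tderiv (A ^ n : Equiv.Perm (Torus d)) ψ w‖) atTop atTop := by
  obtain ⟨s, hsW, u, huW, rfl⟩ := hs.exists_add_eq ψ w
  obtain ⟨B, hB⟩ := hs.exists_norm_tderiv_pow_le hsW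
  have hu₀ : u ≠ 0 := by rintro rfl; exact hw (by rwa [add_zero])
  refine tendsto_atTop_mono (fun n => ?_) (tendsto_atTop_add_const_right _ (-B)
    (hs.tendsto_norm_tderiv_pow_of_mem hA hA' huW hu₀))
  rw [map_add, add_comm (tderiv _ ψ s)]
  linarith [hB n, norm_sub_le_norm_add (tderiv (A ^ n : Equiv.Perm (Torus d)) ψ u)
    (tderiv (A ^ n : Equiv.Perm (Torus d)) ψ s)]

theorem exists_norm_sub_starProjection_le (hs : IsHyperbolicSplitting A Ws Wu)
    (hA : IsAnalyticMap A) (ψ : Torus d) (w : E d) : ∃ B, ∀ n : ℕ,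
      ‖tderiv (A ^ n : Equiv.Perm (Torus d)) ψ w -
        (Wu ((A ^ n : Equiv.Perm (Torus d)) ψ)).starProjection
          (tderiv (A ^ n : Equiv.Perm (Torus d)) ψ w)‖ ≤ B := by
  obtain ⟨s, hsW, u, huW, rfl⟩ := hs.exists_add_eq ψ w
  obtain ⟨B, hB⟩ := hs.exists_norm_tderiv_pow_le hsW
  refine ⟨B + B, fun n => ?_⟩
  rw [map_add, map_add, Submodule.starProjection_eq_self_iff.2 (hs.tderiv_pow_mem hA n huW),
    add_sub_add_right_eq_sub]
  exact norm_sub_le_of_le (hB n) ((Submodule.norm_starProjection_apply_le _ _).trans (hB n))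

variable {v : Torus d → E d} {Λ : Torus d → ℝ}

theorem tendsto_cocycle (hs : IsHyperbolicSplitting A Ws Wu)
    (hA : IsAnalyticMap A) (hA' : IsAnalyticMap (A⁻¹ : Equiv.Perm _)) (hv : Continuous v)
    (h : IsEigenfield A v Λ) {ψ : Torus d} (hψ : v ψ ∉ Ws ψ) :
    Tendsto (fun n => |cocycle A Λ n ψ|) atTop atTop := by
  obtain ⟨M, hM, hvM⟩ := exists_forall_norm_le hv
  refine tendsto_atTop_mono (fun n => ?_)
    ((hs.tendsto_norm_tderiv_pow hA hA' hψ).atTop_div_const hM)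
  rw [div_le_iff₀ hM, h.tderiv_pow hA, norm_smul, Real.norm_eq_abs]
  gcongr
  exact hvM _

theorem exists_mem_unstable (hs : IsHyperbolicSplitting A Ws Wu)
    (hA : IsAnalyticMap A) (hA' : IsAnalyticMap (A⁻¹ : Equiv.Perm _)) (hv : Continuous v)
    (h : IsEigenfield A v Λ) {ψ : Torus d} (hψ : v ψ ∉ Ws ψ) : ∃ φ, v φ ∈ Wu φ := by
  by_contra! hnot
  have hne (φ : Torus d) : v φ - (Wu φ).starProjection (v φ) ≠ 0 := fun h₀ =>
    hnot φ (Submodule.starProjection_eq_self_iff.1 (sub_eq_zero.1 h₀).symm)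
  obtain ⟨m, hm, hmle⟩ := exists_forall_le_norm (hv.sub (hs.continuous_u.clm_apply hv)) hne
  obtain ⟨B, hB⟩ := hs.exists_norm_sub_starProjection_le hA ψ (v ψ)
  obtain ⟨n, hn⟩ := ((hs.tendsto_cocycle hA hA' hv h hψ).eventually_gt_atTop (B / m)).exists
  refine hn.not_ge ((le_div_iff₀ hm).2 (le_trans ?_ (hB n)))
  rw [h.tderiv_pow hA, map_smul, ← smul_sub, norm_smul, Real.norm_eq_abs]
  gcongr
  exact hmle _

theorem exists_cocycle_le (hs : IsHyperbolicSplitting A Ws Wu)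
    (hA : IsAnalyticMap A) (hv : Continuous v) (hv₀ : ∀ ψ, v ψ ≠ 0) (h : IsEigenfield A v Λ)
    (hmem : ∀ ψ, v ψ ∈ Ws ψ) {κ : ℝ} (hκ : 0 < κ) : ∃ n : ℕ, ∀ ψ, |cocycle A Λ n ψ| ≤ κ := by
  obtain ⟨Θ, l, hΘ, hl₀, hl₁, hdecay⟩ := hs.hyperbolic
  obtain ⟨m, hm, hmle⟩ := exists_forall_le_norm hv hv₀
  obtain ⟨M, _, hvM⟩ := exists_forall_norm_le hv
  have hlim : Tendsto (fun n : ℕ => Θ * l ^ n * M / m) atTop (𝓝 0) := by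
    simpa using (((tendsto_pow_atTop_nhds_zero_of_lt_one hl₀.le hl₁).const_mul Θ).mul_const
      M).div_const m
  obtain ⟨n, hn⟩ := (hlim.eventually_lt_const hκ).exists
  refine ⟨n, fun ψ => le_trans ?_ hn.le⟩
  rw [le_div_iff₀ hm]
  have hψ := (hdecay n ψ).1 _ (hmem ψ)
  rw [h.tderiv_pow hA, norm_smul, Real.norm_eq_abs] at hψ
  calc |cocycle A Λ n ψ| * m ≤ |cocycle A Λ n ψ| * ‖v ((A ^ n : Equiv.Perm (Torus d)) ψ)‖ := by
        gcongr; exact hmle _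
    _ ≤ Θ * l ^ n * ‖v ψ‖ := hψ
    _ ≤ Θ * l ^ n * M := by gcongr; exact hvM _

end IsHyperbolicSplitting

end Hyperbolic

section Purity

variable {d : ℕ} {A : Equiv.Perm (Torus d)}

/-- The products of `Λ` along long orbit segments are uniformly smaller than those of `Λ'`, even
along different orbits. -/
def IsDominatedBy (A : Equiv.Perm (Torus d)) (Λ Λ' : Torus d → ℝ) : Prop :=
  ∀ᶠ n in atTop, ∃ κ : ℝ, 0 ≤ κ ∧ κ < 1 ∧ ∀ ψ φ, |cocycle A Λ n ψ| ≤ κ * |cocycle A Λ' n φ|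

theorem IsDominatedBy.trans {Λ Λ' Λ'' : Torus d → ℝ} (h : IsDominatedBy A Λ Λ')
    (h' : IsDominatedBy A Λ' Λ'') : IsDominatedBy A Λ Λ'' := by
  filter_upwards [h, h'] with n ⟨κ, hκ₀, hκ₁, hκ⟩ ⟨κ', hκ₀', hκ₁', hκ'⟩
  refine ⟨κ * κ', by positivity, mul_lt_one_of_nonneg_of_lt_one_left hκ₀ hκ₁ hκ₁'.le,
    fun ψ φ => (hκ ψ φ).trans ?_⟩
  rw [mul_assoc]
  gcongr
  exact hκ' φ φ

namespace IsDominated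

variable {Λ : Fin d → Torus d → ℝ}

theorem isDominatedBy_of_add_one_eq (h : IsDominated A Λ) {i j : Fin d} (hij : (i : ℕ) + 1 = j)
    (hΛ : ∀ ψ, Λ j ψ ≠ 0) : IsDominatedBy A (Λ i) (Λ j) := by
  obtain ⟨N₀, h⟩ := h
  filter_upwards [eventually_gt_atTop N₀] with n hn
  have hlt := h n hn i j hij
  refine ⟨_, ENNReal.toReal_nonneg, ENNReal.toReal_lt_of_lt_ofReal (by simpa using hlt),
    fun ψ φ => ?_⟩
  have hle : ‖cocycle A (Λ i) n ψ‖ₑ * ‖(cocycle A (Λ j) n φ)⁻¹‖ₑ ≤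
      supNorm (cocycle A (Λ i) n) * supNorm (fun ψ => (cocycle A (Λ j) n ψ)⁻¹) :=
    mul_le_mul' (le_iSup (fun ψ => ‖cocycle A (Λ i) n ψ‖ₑ) ψ)
      (le_iSup (fun φ => ‖(cocycle A (Λ j) n φ)⁻¹‖ₑ) φ)
  have hreal := ENNReal.toReal_mono (hlt.trans ENNReal.one_lt_top).ne hle
  rwa [ENNReal.toReal_mul, toReal_enorm, toReal_enorm, norm_inv, Real.norm_eq_abs,
    Real.norm_eq_abs, ← div_eq_mul_inv,
    div_le_iff₀ (abs_pos.2 (cocycle_ne_zero hΛ n φ))] at hreal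

theorem isDominatedBy_of_lt (h : IsDominated A Λ) (hΛ : ∀ i ψ, Λ i ψ ≠ 0) {i j : Fin d}
    (hij : i < j) : IsDominatedBy A (Λ i) (Λ j) := by
  obtain ⟨k, hk⟩ := Nat.exists_eq_add_of_lt hij
  induction k generalizing j with
  | zero => exact h.isDominatedBy_of_add_one_eq hk.symm (hΛ j)
  | succ k ih =>
    let j' : Fin d := ⟨i + k + 1, by omega⟩
    exact (ih (j := j') (Fin.lt_def.2 (by simp only [j']; omega)) rfl).trans
      (h.isDominatedBy_of_add_one_eq (i := j') hk.symm (hΛ j))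

end IsDominated

theorem card_le_finrank_of_forall_mem {K V ι : Type*} [DivisionRing K] [AddCommGroup V]
    [Module K V] {v : ι → V} (hv : LinearIndependent K v) (s : Finset ι) (W : Submodule K V)
    [FiniteDimensional K W] (h : ∀ k ∈ s, v k ∈ W) : s.card ≤ Module.finrank K W := by
  have hli : LinearIndependent K (fun k : s => (⟨v k, h k k.2⟩ : W)) :=
    .of_comp W.subtype (hv.comp _ Subtype.val_injective)
  simpa using hli.fintype_card_le_finrank

namespace IsHyperbolicSplitting

variable {Ws Wu : Torus d → Submodule ℝ (E d)}

theorem mem_unstable_of_isDominatedBy (hs : IsHyperbolicSplitting A Ws Wu) (hA : IsAnalyticMap A)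
    (hA' : IsAnalyticMap (A⁻¹ : Equiv.Perm _)) {v v' : Torus d → E d} {Λ Λ' : Torus d → ℝ}
    (hv : Continuous v) (hv' : Continuous v') (hv'₀ : ∀ ψ, v' ψ ≠ 0) (h : IsEigenfield A v Λ)
    (h' : IsEigenfield A v' Λ') (hdom : IsDominatedBy A Λ Λ') {ψ : Torus d} (hψ : v ψ ∉ Ws ψ)
    (φ : Torus d) : v' φ ∈ Wu φ := by
  by_contra hφ
  have hgrow := hs.tendsto_cocycle hA hA' hv h hψ
  have hgrow' := (hs.symm hA hA').tendsto_cocycle hA' (by rwa [inv_inv]) hv' (h'.inv hA hA' hv'₀) hφ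
  obtain ⟨n, hn, hn', κ, -, hκ₁, hκ⟩ := ((hgrow.eventually_gt_atTop 1).and
    ((hgrow'.eventually_gt_atTop 1).and hdom)).exists
  have hlt : |cocycle A Λ' n ((A⁻¹ ^ n : Equiv.Perm (Torus d)) φ)| < 1 := by
    rw [cocycle_inv, abs_inv] at hn'
    by_contra! hge
    exact hn'.not_ge (inv_le_one_of_one_le₀ hge)
  have hle := hκ ψ ((A⁻¹ ^ n : Equiv.Perm (Torus d)) φ)
  nlinarith [abs_nonneg (cocycle A Λ' n ((A⁻¹ ^ n : Equiv.Perm (Torus d)) φ))]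

theorem mem_stable_of_isDominatedBy (hs : IsHyperbolicSplitting A Ws Wu) (hA : IsAnalyticMap A)
    (hA' : IsAnalyticMap (A⁻¹ : Equiv.Perm _)) {v v' : Torus d → E d} {Λ Λ' : Torus d → ℝ}
    (hv : Continuous v) (hv' : Continuous v') (hv'₀ : ∀ ψ, v' ψ ≠ 0) (h : IsEigenfield A v Λ)
    (h' : IsEigenfield A v' Λ') (hdom : IsDominatedBy A Λ Λ') {φ : Torus d} (hφ : v' φ ∉ Wu φ)
    (ψ : Torus d) : v ψ ∈ Ws ψ := by
  by_contra hψ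
  exact hφ (hs.mem_unstable_of_isDominatedBy hA hA' hv hv' hv'₀ h h' hdom hψ φ)

/-- Otherwise domination forces `dim Wu ≥ d - i` and `dim Ws ≥ i + 1`. -/
theorem forall_mem_stable_or_forall_mem_unstable (hs : IsHyperbolicSplitting A Ws Wu)
    (hA : IsAnalyticMap A) (hA' : IsAnalyticMap (A⁻¹ : Equiv.Perm _)) {v : Fin d → Torus d → E d}
    {Λ : Fin d → Torus d → ℝ} (hv : ∀ i, Continuous (v i))
    (hli : ∀ ψ, LinearIndependent ℝ fun i => v i ψ) (h : ∀ i, IsEigenfield A (v i) (Λ i))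
    (hdom : IsDominated A Λ) (i : Fin d) : (∀ ψ, v i ψ ∈ Ws ψ) ∨ ∀ ψ, v i ψ ∈ Wu ψ := by
  have hv₀ (i : Fin d) (ψ : Torus d) : v i ψ ≠ 0 := (hli ψ).ne_zero i
  have hlt {i j : Fin d} (hij : i < j) : IsDominatedBy A (Λ i) (Λ j) :=
    hdom.isDominatedBy_of_lt (fun i => (h i).ne_zero hA hA' (hv₀ i)) hij
  by_contra! hcon
  obtain ⟨⟨ψ, hψ⟩, ⟨φ, hφ⟩⟩ := hcon
  obtain ⟨ψu, hψu⟩ := hs.exists_mem_unstable hA hA' (hv i) (h i) hψ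
  obtain ⟨ψs, hψs⟩ := (hs.symm hA hA').exists_mem_unstable hA' (by rwa [inv_inv]) (hv i)
    ((h i).inv hA hA' (hv₀ i)) hφ
  have hu : (Finset.Ici i).card ≤ Module.finrank ℝ (Wu ψu) := by
    refine card_le_finrank_of_forall_mem (hli ψu) _ _ fun k hk => ?_
    rcases (Finset.mem_Ici.1 hk).eq_or_lt with rfl | hk
    · exact hψu
    · exact hs.mem_unstable_of_isDominatedBy hA hA' (hv i) (hv k) (hv₀ k) (h i) (h k) (hlt hk) hψ ψu
  have hst : (Finset.Iic i).card ≤ Module.finrank ℝ (Ws ψs) := by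
    refine card_le_finrank_of_forall_mem (hli ψs) _ _ fun k hk => ?_
    rcases (Finset.mem_Iic.1 hk).eq_or_lt with rfl | hk
    · exact hψs
    · exact hs.mem_stable_of_isDominatedBy hA hA' (hv k) (hv i) (hv₀ i) (h k) (h i) (hlt hk) hφ ψs
  obtain ⟨ds, du, hdim⟩ := hs.dim_const
  have hsum := Submodule.finrank_add_eq_of_isCompl (hs.isCompl ψu)
  rw [(hdim ψu).1, (hdim ψu).2, finrank_euclideanSpace_fin] at hsum
  rw [(hdim ψu).2, Fin.card_Ici] at hu
  rw [(hdim ψs).1, Fin.card_Iic] at hst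
  omega

theorem exists_cocycle_le_or_inv_cocycle_le (hs : IsHyperbolicSplitting A Ws Wu)
    (hA : IsAnalyticMap A) (hA' : IsAnalyticMap (A⁻¹ : Equiv.Perm _)) {v : Torus d → E d}
    {Λ : Torus d → ℝ} (hv : Continuous v) (hv₀ : ∀ ψ, v ψ ≠ 0) (h : IsEigenfield A v Λ)
    (hmem : (∀ ψ, v ψ ∈ Ws ψ) ∨ ∀ ψ, v ψ ∈ Wu ψ) {κ : ℝ} (hκ : 0 < κ) :
    ∃ n : ℕ, (∀ ψ, |cocycle A Λ n ψ| ≤ κ) ∨ ∀ ψ, |(cocycle A Λ n ψ)⁻¹| ≤ κ := by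
  rcases hmem with hmem | hmem
  · exact (hs.exists_cocycle_le hA hv hv₀ h hmem hκ).imp fun n hn => Or.inl hn
  · obtain ⟨n, hn⟩ := (hs.symm hA hA').exists_cocycle_le hA' hv hv₀ (h.inv hA hA' hv₀) hmem hκ
    refine ⟨n, Or.inr fun ψ => ?_⟩
    have hψ := hn ((A ^ n : Equiv.Perm (Torus d)) ψ)
    rwa [cocycle_inv, inv_pow, show (A ^ n)⁻¹ ((A ^ n) ψ) = ψ by simp] at hψ

end IsHyperbolicSplitting

end Purity

section Rates

variable {d : ℕ} {A : Equiv.Perm (Torus d)}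

theorem eventually_mul_rpow_pow_lt_one {κ : ℝ} (hκ : κ < 1) {L : ℝ≥0} (hL : L ≠ 0) (n : ℕ) :
    ∀ᶠ β : ℝ≥0 in 𝓝 0, κ * ((L ^ (β : ℝ) : ℝ≥0) : ℝ) ^ n < 1 := by
  have hcont : Continuous fun β : ℝ≥0 => κ * ((L ^ (β : ℝ) : ℝ≥0) : ℝ) ^ n := by
    simp only [NNReal.coe_rpow]
    exact continuous_const.mul (((Real.continuous_const_rpow (a := (L : ℝ))
      (by exact_mod_cast hL)).comp NNReal.continuous_coe).pow n)
  exact (hcont.tendsto 0).eventually_lt_const (by simpa using hκ)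

theorem HolderFun.exists_inv {T : Type*} {ρ : T → T → ℝ≥0} (a : HolderFun ρ ℝ) {m : ℝ}
    (hm : 0 < m) (ha : ∀ x, m ≤ |a x|) : ∃ a' : HolderFun ρ ℝ, ∀ x, a x * a' x = 1 := by
  have hne (x : T) : a x ≠ 0 := abs_pos.1 (hm.trans_le (ha x))
  refine ⟨mk (fun x => (a x)⁻¹) ⟨m⁻¹, ‖a‖ / (m * m), fun x => ?_, fun x y => ?_⟩,
    fun x => mul_inv_cancel₀ (hne x)⟩
  · rw [norm_inv, Real.norm_eq_abs]
    exact inv_anti₀ hm (ha x)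
  · rw [inv_sub_inv (hne x) (hne y), norm_div, norm_mul, norm_sub_rev, div_mul_eq_mul_div]
    exact div_le_div₀ (by positivity) (a.norm_sub_apply_le x y) (by positivity)
      (mul_le_mul (ha x) (ha y) hm.le (norm_nonneg _))

theorem abs_prod_inv_mul_le {f g : Torus d → ℝ} (hf₀ : ∀ ψ, f ψ ≠ 0) {n : ℕ} {κ : ℝ}
    (h : ∀ ψ, |cocycle A g n ψ| ≤ κ * |cocycle A f n ψ|) (ψ : Torus d) :
    |∏ j ∈ Finset.range n, ((f (A^[j] ψ))⁻¹ * g (A^[j] ψ))| ≤ κ := by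
  rw [Finset.prod_mul_distrib, Finset.prod_inv_distrib, ← cocycle_eq_iterate,
    ← cocycle_eq_iterate, abs_mul, abs_inv,
    inv_mul_le_iff₀ (abs_pos.2 (cocycle_ne_zero hf₀ n ψ)), mul_comm]
  exact h ψ

theorem eventually_twist_bijective {L L' : ℝ≥0} (hL : 1 ≤ L) (hL' : 1 ≤ L')
    (hA : LipschitzWith L A) (hA' : LipschitzWith L' (⇑A⁻¹)) {f g : Torus d → ℝ}
    (hf : Continuous f) (hg : Continuous g) (hf₀ : ∀ ψ, f ψ ≠ 0) (hg₀ : ∀ ψ, g ψ ≠ 0) (n : ℕ)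
    {κ : ℝ} (hκ₀ : 0 ≤ κ) (hκ₁ : κ < 1)
    (h : (∀ ψ, |cocycle A g n ψ| ≤ κ * |cocycle A f n ψ|) ∨
      ∀ ψ, |cocycle A f n ψ| ≤ κ * |cocycle A g n ψ|) :
    ∀ᶠ β : ℝ≥0 in 𝓝 0, ∀ a b : HolderFun (gauge (T := Torus d) β) ℝ, (∀ ψ, a ψ = f ψ) →
      (∀ ψ, b ψ = g ψ) →
      Function.Bijective (HolderFun.twist (gaugeLipschitz_of_lipschitzWith β hL hA) a b) := by
  filter_upwards [eventually_mul_rpow_pow_lt_one hκ₁ (zero_lt_one.trans_le hL).ne' n,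
    eventually_mul_rpow_pow_lt_one hκ₁ (zero_lt_one.trans_le hL').ne' n] with β hκL hκL' a b ha hb
  have exists_inv {f : Torus d → ℝ} (hf : Continuous f) (hf₀ : ∀ ψ, f ψ ≠ 0)
      {a : HolderFun (gauge β) ℝ} (ha : ∀ ψ, a ψ = f ψ) :
      ∃ a' : HolderFun (gauge β) ℝ, (∀ ψ, a ψ * a' ψ = 1) ∧ ∀ ψ, a' ψ = (f ψ)⁻¹ := by
    obtain ⟨m, hm, hmf⟩ := exists_forall_le_norm hf hf₀
    obtain ⟨a', haa'⟩ := a.exists_inv hm fun ψ => ha ψ ▸ hmf ψ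
    exact ⟨a', haa', fun ψ => ha ψ ▸ eq_inv_of_mul_eq_one_right (haa' ψ)⟩
  rcases h with h | h
  · obtain ⟨a', haa', ha'⟩ := exists_inv hf hf₀ ha
    refine HolderFun.twist_bijective_of_right_lt _ haa' b n hκ₀ (fun ψ => ?_) hκL
    simp only [ha', hb]
    exact abs_prod_inv_mul_le hf₀ h ψ
  · obtain ⟨b', hbb', hb'⟩ := exists_inv hg hg₀ hb
    refine HolderFun.twist_bijective_of_left_lt _ (gaugeLipschitz_of_lipschitzWith β hL' hA') a
      hbb' n hκ₀ (fun ψ => ?_) hκL'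
    simp only [hb', ha]
    exact abs_prod_inv_mul_le hg₀ h ψ

end Rates

section PerturbedZeros

variable {𝓜 X S Y U : Type*} [NormedAddCommGroup 𝓜] [NormedSpace ℝ 𝓜]
  [NormedAddCommGroup X] [NormedSpace ℝ X] [NormedAddCommGroup S] [NormedSpace ℝ S]
  [NormedAddCommGroup Y] [NormedSpace ℝ Y] [NormedAddCommGroup U] [NormedSpace ℝ U]

theorem hasFDerivAt_bilinear_eigen (T : X →L[ℝ] Y) (Q : S →L[ℝ] Y →L[ℝ] Y) (W : U →L[ℝ] X)
    (C : X →L[ℝ] Y) (π : U →L[ℝ] S) (x₀ : X) (s₀ : S) :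
    HasFDerivAt (fun a => T (x₀ + W a) - Q (s₀ + π a) (C (x₀ + W a)))
      (T ∘L W - Q s₀ ∘L C ∘L W - Q.flip (C x₀) ∘L π) 0 := by
  have hx : HasFDerivAt (fun a => x₀ + W a) W 0 := W.hasFDerivAt.const_add x₀
  have hs : HasFDerivAt (fun a => s₀ + π a) π 0 := π.hasFDerivAt.const_add s₀
  refine ((T.hasFDerivAt.comp 0 hx).sub
    (Q.hasFDerivAt_of_bilinear hs (C.hasFDerivAt.comp 0 hx))).congr_fderiv ?_
  ext a
  simp [sub_sub]

variable [CompleteSpace Y] [CompleteSpace U]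

theorem exists_analytic_bilinear_zero (P : 𝓜 →L[ℝ] X →L[ℝ] Y) (Q : S →L[ℝ] Y →L[ℝ] Y)
    (W : U →L[ℝ] X) (C : X →L[ℝ] Y) (π : U →L[ℝ] S) {x₀ : X} {s₀ : S} {M : ℝ → 𝓜}
    (hM : AnalyticAt ℝ M 0) (hx₀ : P (M 0) x₀ = Q s₀ (C x₀))
    (hbij : Function.Bijective (P (M 0) ∘L W - Q s₀ ∘L C ∘L W - Q.flip (C x₀) ∘L π)) :
    ∃ a : ℝ → U, AnalyticAt ℝ a 0 ∧ a 0 = 0 ∧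
      ∀ᶠ ε in 𝓝 0, P (M ε) (x₀ + W (a ε)) = Q (s₀ + π (a ε)) (C (x₀ + W (a ε))) := by
  let G : ℝ × U → Y := fun p => P (M p.1) (x₀ + W p.2) - Q (s₀ + π p.2) (C (x₀ + W p.2))
  have hx : AnalyticAt ℝ (fun p : ℝ × U => x₀ + W p.2) (0, 0) :=
    analyticAt_const.add ((W.analyticAt _).comp analyticAt_snd)
  have hs : AnalyticAt ℝ (fun p : ℝ × U => s₀ + π p.2) (0, 0) :=
    analyticAt_const.add ((π.analyticAt _).comp analyticAt_snd)
  have hG : AnalyticAt ℝ G (0, 0) :=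
    (AnalyticAt.comp (g := fun q : 𝓜 × X => P q.1 q.2) (P.analyticAt_bilinear _)
      ((hM.comp_of_eq analyticAt_fst rfl).prod hx)).sub
    (AnalyticAt.comp (g := fun q : S × Y => Q q.1 q.2) (Q.analyticAt_bilinear _)
      (hs.prod ((C.analyticAt _).comp hx)))
  have hG₀ : G (0, 0) = 0 := by simp only [G, map_zero, add_zero, hx₀, sub_self]
  obtain ⟨a, ha, ha₀, hzero⟩ := exists_analytic_implicit hG hG₀ hbij
    (hasFDerivAt_bilinear_eigen (P (M 0)) Q W C π x₀ s₀)
  exact ⟨a, ha, ha₀, hzero.mono fun ε hε => sub_eq_zero.1 hε⟩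

theorem exists_analytic_quasilinear_zero {N N₁ : X → Y} {N' : X →L[ℝ] Y} (hN : AnalyticAt ℝ N 0)
    (hN₀ : N 0 = 0) (hN' : HasFDerivAt N N' 0) (hN₁ : AnalyticAt ℝ N₁ 0) (y : Y) (C : X →L[ℝ] Y)
    (S : U →L[ℝ] X) (hbij : Function.Bijective (N' ∘L S - C ∘L S)) :
    ∃ h : ℝ → X, AnalyticAt ℝ h 0 ∧ h 0 = 0 ∧
      ∀ᶠ ε in 𝓝 0, C (h ε) = N (h ε) + ε • (y + N₁ (h ε)) := by
  let G : ℝ × U → Y := fun p => N (S p.2) + p.1 • (y + N₁ (S p.2)) - C (S p.2)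
  have hS : AnalyticAt ℝ (fun p : ℝ × U => S p.2) (0, 0) := (S.analyticAt _).comp analyticAt_snd
  have hS₀ : S 0 = 0 := map_zero S
  have hG : AnalyticAt ℝ G (0, 0) :=
    ((hN.comp_of_eq hS hS₀).add (analyticAt_fst.smul
      (analyticAt_const.add (hN₁.comp_of_eq hS hS₀)))).sub ((C.analyticAt _).comp hS)
  have hG₀ : G (0, 0) = 0 := by simp only [G, hS₀, hN₀, map_zero, zero_smul, add_zero, sub_zero]
  have hderiv : HasFDerivAt (fun a => G (0, a)) (N' ∘L S - C ∘L S) 0 := by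
    simp only [G, zero_smul, add_zero]
    exact (HasFDerivAt.comp 0 (hS₀ ▸ hN') S.hasFDerivAt).sub (C ∘L S).hasFDerivAt
  obtain ⟨a, ha, ha₀, hzero⟩ := exists_analytic_implicit hG hG₀ hbij hderiv
  exact ⟨fun ε => S (a ε), (S.analyticAt _).comp ha, (congrArg S ha₀).trans hS₀,
    hzero.mono fun ε hε => (sub_eq_zero.1 hε).symm⟩

end PerturbedZeros

section FrameOperators

variable {T ι V : Type*} [Fintype ι] {ρ : T → T → ℝ≥0} [NormedAddCommGroup V] [NormedSpace ℝ V]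
  {φ : T → T} {L : ℝ≥0} (hφ : GaugeLipschitz ρ φ L)

theorem IsUniformFrame.comp {S : Type*} {v : ι → T → V} {c : ℝ} (hv : IsUniformFrame v c)
    (φ : S → T) : IsUniformFrame (fun k => v k ∘ φ) c :=
  ⟨hv.1, fun x => hv.2 (φ x)⟩

namespace HolderFun

theorem frameL_comp_piMap_bijective [FiniteDimensional ℝ V]
    (hι : Fintype.card ι = Module.finrank ℝ V) {v : ι → HolderFun ρ V} {c : ℝ}
    (hv : IsUniformFrame (fun k => v k) c) {D : ι → HolderFun ρ ℝ →L[ℝ] HolderFun ρ ℝ}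
    (hD : ∀ k, Function.Bijective (D k)) :
    Function.Bijective (frameL (fun k => comp hφ (v k)) ∘L ContinuousLinearMap.piMap D) :=
  (frameL_bijective (v := fun k => comp hφ (v k)) hι (hv.comp φ)).comp (Function.Bijective.piMap hD)

theorem sub_comp_frameL_eq_add {v e : ι → HolderFun ρ V} {Λ : ι → HolderFun ρ ℝ}
    {M : T → V →L[ℝ] V} (heigen : ∀ k x, M x (v k x) = Λ k x • v k (φ x) + e k x)
    {D : HolderFun ρ V →L[ℝ] HolderFun ρ V} (hD : ∀ u x, D u x = M x (u x)) :
    D ∘L frameL v - comp hφ ∘L frameL v = frameL (fun k => comp hφ (v k)) ∘L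
      (ContinuousLinearMap.piMap fun k => twist hφ (Λ k) (const 1)) + frameL e := by
  ext a x
  change D (frameL v a) x - frameL v a (φ x) =
    frameL _ (fun k => twist hφ (Λ k) _ (a k)) x + frameL e a x
  simp only [hD, frameL_apply, map_sum, map_smul, heigen, comp_apply, twist_apply, const_apply,
    one_mul, sub_smul, mul_smul, smul_add, Finset.sum_sub_distrib, Finset.sum_add_distrib,
    smul_comm (Λ _ x)]
  abel

theorem sub_comp_frameL_eq {v : ι → HolderFun ρ V} {Λ : ι → HolderFun ρ ℝ} {M : T → V →L[ℝ] V}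
    (heigen : ∀ k x, M x (v k x) = Λ k x • v k (φ x)) {D : HolderFun ρ V →L[ℝ] HolderFun ρ V}
    (hD : ∀ u x, D u x = M x (u x)) :
    D ∘L frameL v - comp hφ ∘L frameL v = frameL (fun k => comp hφ (v k)) ∘L
      ContinuousLinearMap.piMap fun k => twist hφ (Λ k) (const 1) := by
  have hzero : frameL (0 : ι → HolderFun ρ V) = 0 := by ext a x; simp
  rw [sub_comp_frameL_eq_add hφ (e := 0) (fun k x => by rw [heigen]; exact (add_zero _).symm) hD,
    hzero, add_zero]

/-- The linearization of the eigenvector equation in a frame, where the `i`-th coordinate of the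
unknown stands for the variation of the `i`-th eigenvalue instead of that of the `i`-th vector. -/
theorem applyL_comp_frameL_update_eq [DecidableEq ι] {v : ι → HolderFun ρ V}
    {Λ : ι → HolderFun ρ ℝ} {M : HolderFun ρ (V →L[ℝ] V)}
    (heigen : ∀ k x, M x (v k x) = Λ k x • v k (φ x)) (i : ι) :
    applyL M ∘L frameL (Function.update v i 0) -
        smulL (Λ i) ∘L comp hφ ∘L frameL (Function.update v i 0) -
        (smulL.flip (comp hφ (v i))) ∘L ContinuousLinearMap.proj i =
      frameL (fun k => comp hφ (v k)) ∘L ContinuousLinearMap.piMap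
        (Function.update (fun k => twist hφ (Λ k) (Λ i)) i (-ContinuousLinearMap.id ℝ _)) := by
  ext a x
  change M x (frameL (Function.update v i 0) a x) -
      Λ i x • frameL (Function.update v i 0) a (φ x) - a i x • v i (φ x) =
    frameL _ (fun k => Function.update (fun k => twist hφ (Λ k) (Λ i)) i
      (-ContinuousLinearMap.id ℝ _) k (a k)) x
  have hsingle : a i x • v i (φ x) = ∑ k, if k = i then a k x • v k (φ x) else 0 := by simp
  simp only [frameL_apply, map_sum, map_smul, Finset.smul_sum, hsingle,
    ← Finset.sum_sub_distrib]
  refine Finset.sum_congr rfl fun k _ => ?_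
  obtain rfl | hk := eq_or_ne k i
  · simp
  · simp only [Function.update_of_ne hk, heigen, if_neg hk, sub_zero, comp_apply, twist_apply,
      sub_smul, mul_smul, smul_comm (Λ k x)]

end HolderFun

end FrameOperators

section Continuation

variable {d : ℕ} {β : ℝ≥0} {φ : Torus d → Torus d} {L : ℝ≥0}

theorem exists_analytic_along {V : Type*} [NormedAddCommGroup V] [NormedSpace ℝ V]
    [CompleteSpace V] (hβ : β ≤ 1) {f : E d → V} (hf : AnalyticOnNhd ℝ f Set.univ)
    (hper : f.FactorsThrough proj) {h : ℝ → HolderFun (gauge (T := Torus d) β) (E d)}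
    (hh : AnalyticAt ℝ h 0) (h₀ : h 0 = 0) :
    ∃ Φ : ℝ → HolderFun (gauge (T := Torus d) β) V, AnalyticAt ℝ Φ 0 ∧
      ∀ᶠ ε in 𝓝 0, ∀ ψ, Φ ε ψ = f (rep ψ + h ε ψ) := by
  obtain ⟨N, _, hN, -, -, -, hNincr⟩ := exists_incr_superposition hβ hf (.of_factorsThrough hper)
  obtain ⟨f₀, hf₀⟩ := HolderFun.exists_of_factorsThrough_proj hβ hf hper
  refine ⟨fun ε => f₀ + N (h ε), analyticAt_const.add (hN.comp_of_eq hh h₀), ?_⟩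
  have hlim : Tendsto h (𝓝 0) (𝓝 0) := h₀ ▸ hh.continuousAt.tendsto
  filter_upwards [hlim.eventually hNincr] with ε hε ψ
  rw [HolderFun.add_apply, hε, incr, ← proj_rep ψ, hf₀, proj_rep, add_sub_cancel]

variable (hφ : GaugeLipschitz (gauge β) φ L)
  {v : Fin d → HolderFun (gauge (T := Torus d) β) (E d)}
  {Λ : Fin d → HolderFun (gauge (T := Torus d) β) ℝ} {c : ℝ}

theorem exists_analytic_conjugacy (hβ : β ≤ 1) {g : E d → E d} (hg : AnalyticOnNhd ℝ g Set.univ)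
    (hper : IsQuasiPeriodic g) {F : Torus d → E d} (hF : IsAnalyticField F)
    (hv : IsUniformFrame (fun k => v k) c)
    (heigen : ∀ i ψ, fderiv ℝ g (rep ψ) (v i ψ) = Λ i ψ • v i (φ ψ))
    (htwist : ∀ i, Function.Bijective (HolderFun.twist hφ (Λ i) (.const 1))) :
    ∃ h : ℝ → HolderFun (gauge (T := Torus d) β) (E d), AnalyticAt ℝ h 0 ∧ h 0 = 0 ∧
      ∀ᶠ ε in 𝓝 0, ∀ ψ, h ε (φ ψ) = incr g ψ (h ε ψ) + ε • F (ψ + proj (h ε ψ)) := by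
  have hF' : (F ∘ proj).FactorsThrough proj := fun x y hxy => congrArg F hxy
  obtain ⟨N, N', hN, hN₀, hN', hN'_apply, hNincr⟩ := exists_incr_superposition hβ hg hper
  obtain ⟨NF, _, hNF, -, -, -, hNFincr⟩ :=
    exists_incr_superposition hβ hF (.of_factorsThrough hF')
  obtain ⟨F₀, hF₀⟩ := HolderFun.exists_of_factorsThrough_proj hβ hF hF'
  have hbij := HolderFun.frameL_comp_piMap_bijective hφ (by simp) hv htwist
  rw [← HolderFun.sub_comp_frameL_eq hφ heigen hN'_apply] at hbij
  obtain ⟨h, hh, hh₀, hzero⟩ := exists_analytic_quasilinear_zero hN hN₀ hN' hNF F₀ _ _ hbij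
  refine ⟨h, hh, hh₀, ?_⟩
  have hlim : Tendsto h (𝓝 0) (𝓝 0) := by simpa only [hh₀] using hh.continuousAt.tendsto
  filter_upwards [hzero, hlim.eventually hNincr, hlim.eventually hNFincr] with ε hε hincr hFincr ψ
  have heq : h ε (φ ψ) = N (h ε) ψ + ε • (F₀ ψ + NF (h ε) ψ) :=
    congrArg (fun w : HolderFun _ (E d) => w ψ) hε
  have hF₀ψ : F₀ ψ = F (proj (rep ψ)) := by rw [← hF₀, proj_rep]
  rw [heq, hincr, hFincr, incr.eq_def (fun x => F (proj x)), hF₀ψ, add_sub_cancel, proj_add,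
    proj_rep]

theorem exists_analytic_eigen {M : ℝ → HolderFun (gauge (T := Torus d) β) (E d →L[ℝ] E d)}
    (hM : AnalyticAt ℝ M 0) (hv : IsUniformFrame (fun k => v k) c)
    (heigen : ∀ i ψ, M 0 ψ (v i ψ) = Λ i ψ • v i (φ ψ)) (i : Fin d)
    (htwist : ∀ k, k ≠ i → Function.Bijective (HolderFun.twist hφ (Λ k) (Λ i))) :
    ∃ (w : ℝ → HolderFun (gauge (T := Torus d) β) (E d))
      (l : ℝ → HolderFun (gauge (T := Torus d) β) ℝ),
      AnalyticAt ℝ w 0 ∧ AnalyticAt ℝ l 0 ∧ w 0 = v i ∧ l 0 = Λ i ∧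
      ∀ᶠ ε in 𝓝 0, ∀ ψ, M ε ψ (w ε ψ) = l ε ψ • w ε (φ ψ) := by
  have hD (k : Fin d) : Function.Bijective (Function.update
      (fun k => HolderFun.twist hφ (Λ k) (Λ i)) i (-ContinuousLinearMap.id ℝ _) k) := by
    obtain rfl | hk := eq_or_ne k i
    · rw [Function.update_self]
      exact neg_bijective
    · rw [Function.update_of_ne hk]
      exact htwist k hk
  have hbij := HolderFun.frameL_comp_piMap_bijective hφ (by simp) hv hD
  rw [← HolderFun.applyL_comp_frameL_update_eq hφ heigen] at hbij
  have hv₀ : HolderFun.applyL (M 0) (v i) = HolderFun.smulL (Λ i) (HolderFun.comp hφ (v i)) := by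
    ext1 ψ
    exact heigen i ψ
  obtain ⟨a, ha, ha₀, hzero⟩ :=
    exists_analytic_bilinear_zero HolderFun.applyL HolderFun.smulL _ _ _ hM hv₀ hbij
  refine ⟨fun ε => v i + HolderFun.frameL (Function.update v i 0) (a ε), fun ε => Λ i + a ε i,
    analyticAt_const.add ((ContinuousLinearMap.analyticAt _ _).comp ha),
    analyticAt_const.add (((ContinuousLinearMap.proj (R := ℝ)
      (φ := fun _ : Fin d => HolderFun _ ℝ) i).analyticAt _).comp ha), ?_, ?_, ?_⟩
  · simp only [ha₀, map_zero, add_zero]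
  · simp only [ha₀, Pi.zero_apply, add_zero]
  · filter_upwards [hzero] with ε hε ψ
    exact congrArg (fun w : HolderFun _ (E d) => w ψ) hε

end Continuation

section InverseBound

variable {X Y Z : Type*} [NormedAddCommGroup X] [NormedSpace ℝ X] [NormedAddCommGroup Y]
  [NormedSpace ℝ Y] [NormedAddCommGroup Z] [NormedSpace ℝ Z]

/-- `f` is invertible and its inverse is bounded by `C`. The bound is kept explicit because it has
to be uniform along families of operators. -/
structure HasInverseBound (f : X →L[ℝ] Y) (C : ℝ) : Prop where
  surjective : Function.Surjective f
  norm_le : ∀ x, ‖x‖ ≤ C * ‖f x‖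

namespace HasInverseBound

variable {f : X →L[ℝ] Y} {g : Y →L[ℝ] Z} {C C' : ℝ}

theorem mono (hf : HasInverseBound f C) (hC : C ≤ C') : HasInverseBound f C' :=
  ⟨hf.surjective, fun x => (hf.norm_le x).trans (by gcongr)⟩

theorem of_inverse {f' : Y →L[ℝ] X} (hl : ∀ x, f' (f x) = x) (hr : ∀ y, f (f' y) = y)
    (hC : ‖f'‖ ≤ C) : HasInverseBound f C :=
  ⟨fun y => ⟨f' y, hr y⟩, fun x => by simpa only [hl] using f'.le_of_opNorm_le hC (f x)⟩

theorem comp (hg : HasInverseBound g C') (hf : HasInverseBound f C) (hC : 0 ≤ C) :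
    HasInverseBound (g ∘L f) (C * C') := by
  refine ⟨hg.surjective.comp hf.surjective, fun x => ?_⟩
  calc ‖x‖ ≤ C * ‖f x‖ := hf.norm_le x
    _ ≤ C * (C' * ‖g (f x)‖) := by gcongr; exact hg.norm_le _
    _ = C * C' * ‖g (f x)‖ := (mul_assoc _ _ _).symm

theorem of_comp (hgf : HasInverseBound (g ∘L f) C) (hf : Function.Surjective f) :
    HasInverseBound g (‖f‖ * C) := by
  refine ⟨(show Function.Surjective (g ∘ f) from hgf.surjective).of_comp, fun y => ?_⟩
  obtain ⟨x, rfl⟩ := hf y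
  calc ‖f x‖ ≤ ‖f‖ * ‖x‖ := f.le_opNorm x
    _ ≤ ‖f‖ * (C * ‖g (f x)‖) := by gcongr; exact hgf.norm_le x
    _ = ‖f‖ * C * ‖g (f x)‖ := (mul_assoc _ _ _).symm

theorem piMap {ι : Type*} [Fintype ι] {f : ι → X →L[ℝ] Y} (hf : ∀ i, HasInverseBound (f i) C)
    (hC : 0 ≤ C) : HasInverseBound (ContinuousLinearMap.piMap f) C := by
  refine ⟨Function.Surjective.piMap fun i => (hf i).surjective, fun x => ?_⟩
  refine (pi_norm_le_iff_of_nonneg (by positivity)).2 fun i => ((hf i).norm_le (x i)).trans ?_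
  gcongr
  exact norm_le_pi_norm (ContinuousLinearMap.piMap f x) i

theorem one_sub [CompleteSpace X] {t : X →L[ℝ] X} {M κ : ℝ} (hM : ‖t‖ ≤ M) (n : ℕ) (hκ : κ < 1)
    (ht : ‖t ^ n‖ ≤ κ) : HasInverseBound (1 - t) ((∑ j ∈ Finset.range n, M ^ j) / (1 - κ)) := by
  have hunit := isUnit_one_sub_of_norm_pow_lt_one t n (ht.trans_lt hκ)
  refine ⟨(ContinuousLinearMap.isUnit_iff_bijective.1 hunit).2, fun x => ?_⟩
  have hsum : ‖∑ j ∈ Finset.range n, t ^ j‖ ≤ ∑ j ∈ Finset.range n, M ^ j := by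
    refine norm_sum_le_of_le _ fun j _ => ?_
    obtain rfl | hj := j.eq_zero_or_pos
    · rw [pow_zero, pow_zero]
      exact ContinuousLinearMap.norm_id_le
    · exact (norm_pow_le' t hj).trans (by gcongr)
  have htelescope : x = (t ^ n) x + (∑ j ∈ Finset.range n, t ^ j) ((1 - t) x) := by
    rw [← mul_apply_eq_comp, geom_sum_mul_neg]
    simp
  have hle : ‖x‖ ≤ κ * ‖x‖ + (∑ j ∈ Finset.range n, M ^ j) * ‖(1 - t) x‖ := by
    nth_rewrite 1 [htelescope]
    exact norm_add_le_of_le ((t ^ n).le_of_opNorm_le ht x)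
      (ContinuousLinearMap.le_of_opNorm_le _ hsum _)
  rw [div_mul_eq_mul_div, le_div_iff₀ (sub_pos.2 hκ)]
  linarith

theorem exists_zero [CompleteSpace X] (hf : HasInverseBound f C) (hC : 0 < C) {G : X → Y} {R : ℝ}
    (hR : 0 ≤ R)
    (hG : ∀ a b, ‖a‖ ≤ R → ‖b‖ ≤ R → ‖G a - G b - f (a - b)‖ ≤ (2 * C)⁻¹ * ‖a - b‖)
    (hG₀ : ‖G 0‖ ≤ (2 * C)⁻¹ * R) : ∃ a, ‖a‖ ≤ R ∧ G a = 0 := by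
  choose inv hinv using hf.surjective
  let rinv : f.NonlinearRightInverse :=
    ⟨inv, ⟨C, hC.le⟩, fun y => (hf.norm_le (inv y)).trans_eq (by rw [hinv]; rfl), hinv⟩
  have happrox : ApproximatesLinearOn G f (Metric.closedBall 0 R) ⟨(2 * C)⁻¹, by positivity⟩ :=
    fun a ha b hb => hG a b (mem_closedBall_zero_iff.1 ha) (mem_closedBall_zero_iff.1 hb)
  have hmem : (0 : Y) ∈ Metric.closedBall (G 0) (((rinv.nnnorm : ℝ)⁻¹ - (2 * C)⁻¹) * R) := by
    rw [Metric.mem_closedBall, dist_zero_left]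
    refine hG₀.trans_eq ?_
    change _ = (C⁻¹ - (2 * C)⁻¹) * R
    field_simp
    ring
  obtain ⟨a, ha, ha₀⟩ :=
    happrox.surjOn_closedBall_of_nonlinearRightInverse rinv hR subset_rfl hmem
  exact ⟨a, mem_closedBall_zero_iff.1 ha, ha₀⟩

theorem eq_zero_of_norm_le (hf : HasInverseBound f C) (hC : 0 < C) {x : X}
    (hx : ‖f x‖ ≤ (2 * C)⁻¹ * ‖x‖) : x = 0 := by
  have hle : ‖x‖ ≤ ‖x‖ / 2 := by
    calc ‖x‖ ≤ C * ‖f x‖ := hf.norm_le x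
      _ ≤ C * ((2 * C)⁻¹ * ‖x‖) := by gcongr
      _ = ‖x‖ / 2 := by field_simp
  rw [← norm_le_zero_iff]
  linarith

theorem add [CompleteSpace X] {e : X →L[ℝ] Y} (hf : HasInverseBound f C) (hC : 0 < C)
    (he : ‖e‖ ≤ (2 * C)⁻¹) : HasInverseBound (f + e) (2 * C) := by
  refine ⟨fun y => ?_, fun x => ?_⟩
  · obtain ⟨a, -, ha⟩ := hf.exists_zero hC (G := fun x => (f + e) x - y) (R := 2 * C * ‖y‖)
      (by positivity)
      (fun a b _ _ => by
        rw [sub_sub_sub_cancel_right, ← map_sub, _root_.add_apply, add_sub_cancel_left]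
        exact e.le_of_opNorm_le he _)
      (by rw [map_zero, zero_sub, norm_neg, inv_mul_cancel_left₀ (by positivity)])
    exact ⟨a, sub_eq_zero.1 ha⟩
  · have hle : ‖x‖ ≤ C * ‖(f + e) x‖ + ‖x‖ / 2 := by
      calc ‖x‖ ≤ C * ‖f x‖ := hf.norm_le x
        _ = C * ‖(f + e) x - e x‖ := by rw [_root_.add_apply, add_sub_cancel_right]
        _ ≤ C * (‖(f + e) x‖ + (2 * C)⁻¹ * ‖x‖) := by
          gcongr
          exact norm_sub_le_of_le le_rfl (e.le_of_opNorm_le he x)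
        _ = C * ‖(f + e) x‖ + ‖x‖ / 2 := by field_simp
    linarith

end HasInverseBound

end InverseBound

section BoundedFunctions

variable {T : Type*} {V : Type*} [NormedAddCommGroup V] [NormedSpace ℝ V]

namespace HolderFun

variable {ρ : T → T → ℝ≥0}

theorem norm_smulL_le (a : HolderFun ρ ℝ) :
    ‖(smulL a : HolderFun ρ V →L[ℝ] HolderFun ρ V)‖ ≤ 2 * ‖a‖ :=
  ContinuousLinearMap.le_of_opNorm_le _ ((norm_bilin_le (ContinuousLinearMap.lsmul ℝ ℝ)).trans
    (mul_le_of_le_one_right zero_le_two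
      (ContinuousLinearMap.opNorm_lsmul_le (𝕜 := ℝ) (R := ℝ) (E := V)))) a

theorem norm_comp_le {φ : T → T} {L : ℝ≥0} (hφ : GaugeLipschitz ρ φ L) :
    ‖(comp hφ : HolderFun ρ V →L[ℝ] HolderFun ρ V)‖ ≤ L :=
  LinearMap.mkContinuous_norm_le _ L.2 _

theorem norm_wcomp_le {φ : T → T} {L : ℝ≥0} (hφ : GaugeLipschitz ρ φ L) (c : HolderFun ρ ℝ) :
    ‖wcomp hφ c‖ ≤ 2 * ‖c‖ * L :=
  (ContinuousLinearMap.opNorm_comp_le _ _).trans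
    (mul_le_mul (norm_smulL_le c) (norm_comp_le hφ) (norm_nonneg _) (by positivity))

theorem norm_frameL_le {ι : Type*} [Fintype ι] (v : ι → HolderFun ρ V) :
    ‖frameL v‖ ≤ 2 * ∑ k, ‖v k‖ := by
  refine ContinuousLinearMap.opNorm_le_bound _ (by positivity) fun a => ?_
  rw [frameL, _root_.sum_apply, Finset.mul_sum, Finset.sum_mul]
  refine norm_sum_le_of_le _ fun k _ => ?_
  calc ‖smulL (a k) (v k)‖ ≤ 2 * ‖a k‖ * ‖v k‖ :=
        ContinuousLinearMap.le_of_opNorm_le _ (norm_smulL_le _) _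
    _ ≤ 2 * ‖v k‖ * ‖a‖ := by rw [mul_right_comm]; gcongr; exact norm_le_pi_norm a k

theorem hasInverseBound_smulL {a a' : HolderFun ρ ℝ} (haa' : ∀ x, a x * a' x = 1) :
    HasInverseBound (smulL a : HolderFun ρ V →L[ℝ] HolderFun ρ V) (2 * ‖a'‖) :=
  .of_inverse (f' := smulL a')
    (fun w => by ext x; simp [smul_smul, haa' x])
    (fun w => by ext x; simp [smul_smul, mul_comm (a' x), haa' x])
    (norm_smulL_le a')

theorem hasInverseBound_comp {φ : Equiv.Perm T} {L L' : ℝ≥0} (hφ : GaugeLipschitz ρ φ L)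
    (hφ' : GaugeLipschitz ρ (φ⁻¹ : Equiv.Perm T) L') :
    HasInverseBound (comp hφ : HolderFun ρ V →L[ℝ] HolderFun ρ V) L' :=
  .of_inverse (f' := comp hφ') (fun w => by ext x; simp) (fun w => by ext x; simp)
    (norm_comp_le hφ')

end HolderFun

/-- The gauge whose Hölder functions are the bounded functions with the sup norm, on which
composition with any map acts. -/
def boundedGauge (T : Type*) : T → T → ℝ≥0 := fun _ _ => 2

/-- The Banach space of bounded functions. -/
abbrev BoundedFun (T V : Type*) [NormedAddCommGroup V] [NormedSpace ℝ V] : Type _ :=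
  HolderFun (boundedGauge T) V

theorem gaugeLipschitz_boundedGauge (φ : T → T) : GaugeLipschitz (boundedGauge T) φ 1 :=
  ⟨le_rfl, fun _ _ => (one_mul _).ge⟩

namespace BoundedFun

theorem gaugeBound {V : Type*} [NormedAddCommGroup V] {f : T → V} {C : ℝ} (hf : ∀ x, ‖f x‖ ≤ C) :
    GaugeBound (boundedGauge T) f C C :=
  ⟨hf, fun x y => (norm_sub_le_of_le (hf x) (hf y)).trans_eq (mul_two C).symm⟩

theorem norm_le {f : BoundedFun T V} {C : ℝ} (hC : 0 ≤ C) (hf : ∀ x, ‖f x‖ ≤ C) : ‖f‖ ≤ C :=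
  HolderFun.norm_le hC (gaugeBound hf)

/-- A bounded function, as an element of the Banach space `BoundedFun`. -/
def ofBounded (f : T → V) (hf : ∃ C, ∀ x, ‖f x‖ ≤ C) : BoundedFun T V :=
  .mk f (hf.imp fun C hC => ⟨C, gaugeBound hC⟩)

@[simp] theorem ofBounded_apply (f : T → V) (hf : ∃ C, ∀ x, ‖f x‖ ≤ C) (x : T) :
    ofBounded f hf x = f x := rfl

theorem hasInverseBound_one_sub_wcomp (φ : T → T) {c : BoundedFun T ℝ} {M κ : ℝ} (hM : ‖c‖ ≤ M)
    (n : ℕ) (hκ₀ : 0 ≤ κ) (hκ₁ : κ < 1) (hc : ∀ x, |∏ j ∈ Finset.range n, c (φ^[j] x)| ≤ κ) :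
    HasInverseBound (1 - HolderFun.wcomp (gaugeLipschitz_boundedGauge φ) c)
      ((∑ j ∈ Finset.range n, (2 * M) ^ j) / (1 - κ)) := by
  have hnorm := HolderFun.norm_wcomp_le (gaugeLipschitz_boundedGauge φ) c
  rw [NNReal.coe_one, mul_one] at hnorm
  refine .one_sub (hnorm.trans (by gcongr)) n hκ₁
    (ContinuousLinearMap.opNorm_le_bound _ hκ₀ fun w => norm_le (by positivity) fun x => ?_)
  rw [HolderFun.wcomp_pow_apply, norm_mul]
  exact mul_le_mul (hc x) (w.norm_apply_le _) (norm_nonneg _) hκ₀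

theorem hasInverseBound_frameL {ι : Type*} [Fintype ι] [FiniteDimensional ℝ V]
    (hι : Fintype.card ι = Module.finrank ℝ V) {v : ι → BoundedFun T V} {c : ℝ}
    (hv : IsUniformFrame (fun k => v k) c) : HasInverseBound (HolderFun.frameL v) c⁻¹ := by
  have hc : 0 < c⁻¹ := inv_pos.2 hv.1
  refine ⟨(HolderFun.frameL_bijective hι hv).2, fun a => ?_⟩
  refine (pi_norm_le_iff_of_nonneg (by positivity)).2 fun k => norm_le (by positivity) fun x => ?_
  calc ‖a k x‖ ≤ ‖fun k => a k x‖ := norm_le_pi_norm (fun k => a k x) k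
    _ ≤ c⁻¹ * ‖HolderFun.frameL v a x‖ := by
      rw [HolderFun.frameL_apply]; exact hv.norm_le x _
    _ ≤ c⁻¹ * ‖HolderFun.frameL v a‖ := by gcongr; exact HolderFun.norm_apply_le _ x

theorem exists_hasInverseBound_twist {a a' : BoundedFun T ℝ} (haa' : ∀ x, a x * a' x = 1) (n : ℕ)
    {κ : ℝ} (hκ₀ : 0 ≤ κ) (hκ₁ : κ < 1) :
    ∃ C ≥ 0, ∀ φ : Equiv.Perm T, ((∀ x, |∏ j ∈ Finset.range n, a (φ^[j] x)| ≤ κ) ∨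
        ∀ x, |∏ j ∈ Finset.range n, a' (φ^[j] x)| ≤ κ) →
      HasInverseBound (HolderFun.twist (gaugeLipschitz_boundedGauge φ) a (.const 1)) C := by
  have hone : ∀ x : T,
      (.const 1 : BoundedFun T ℝ) x * (.const 1 : BoundedFun T ℝ) x = 1 :=
    fun x => mul_one _
  set b : BoundedFun T ℝ := HolderFun.smulL (.const 1) a
  set b' : BoundedFun T ℝ := HolderFun.smulL a' (.const 1)
  set C₁ : ℝ := (∑ j ∈ Finset.range n, (2 * ‖b‖) ^ j) / (1 - κ)
  set C₂ : ℝ := (∑ j ∈ Finset.range n, (2 * ‖b'‖) ^ j) / (1 - κ)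
  have hC₁ : 0 ≤ C₁ := div_nonneg (by positivity) (sub_nonneg.2 hκ₁.le)
  have hC₂ : 0 ≤ C₂ := div_nonneg (by positivity) (sub_nonneg.2 hκ₁.le)
  refine ⟨max (C₁ * 1 * (2 * ‖(-.const 1 : BoundedFun T ℝ)‖)) (C₂ * (2 * ‖a'‖)),
    le_max_of_le_right (by positivity), fun φ hrate => ?_⟩
  have hφ := gaugeLipschitz_boundedGauge φ
  have hφ' := gaugeLipschitz_boundedGauge ⇑(φ⁻¹ : Equiv.Perm T)
  obtain hrate | hrate := hrate
  · rw [HolderFun.twist_eq_smulL_comp_comp_one_sub_wcomp hφ hφ' a hone]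
    have hnorm : ‖HolderFun.comp hφ' b‖ ≤ ‖b‖ :=
      (ContinuousLinearMap.le_of_opNorm_le _ (HolderFun.norm_comp_le hφ') b).trans_eq (one_mul _)
    refine .mono ?_ (le_max_left _ _)
    have hsmul : HasInverseBound (HolderFun.smulL (-.const 1) : BoundedFun T ℝ →L[ℝ] _)
        (2 * ‖(-.const 1 : BoundedFun T ℝ)‖) :=
      HolderFun.hasInverseBound_smulL fun x => by simp
    refine hsmul.comp ((HolderFun.hasInverseBound_comp hφ hφ').comp ?_ hC₁) (by positivity)
    refine hasInverseBound_one_sub_wcomp _ hnorm n hκ₀ hκ₁ fun x => ?_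
    refine (congrArg _ (prod_range_inv_iterate φ b n x)).trans_le ?_
    simpa [b] using hrate ((⇑φ⁻¹)^[n] x)
  · rw [HolderFun.twist_eq_smulL_comp_one_sub_wcomp hφ haa']
    refine .mono ?_ (le_max_right _ _)
    refine (HolderFun.hasInverseBound_smulL haa').comp ?_ hC₂
    exact hasInverseBound_one_sub_wcomp φ le_rfl n hκ₀ hκ₁ fun x => by
      simpa [b'] using hrate x

theorem exists_hasInverseBound_sub_comp {ι : Type*} [Fintype ι] [FiniteDimensional ℝ V]
    (hι : Fintype.card ι = Module.finrank ℝ V) {v : ι → BoundedFun T V} {c : ℝ}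
    (hv : IsUniformFrame (fun k => v k) c) {Λ Λ' : ι → BoundedFun T ℝ}
    (hΛ : ∀ k x, Λ k x * Λ' k x = 1) {M : T → V →L[ℝ] V}
    {D : BoundedFun T V →L[ℝ] BoundedFun T V} (hD : ∀ u x, D u x = M x (u x)) {φ₀ : T → T}
    (heigen : ∀ k x, M x (v k x) = Λ k x • v k (φ₀ x)) (n : ι → ℕ) {κ : ℝ} (hκ₀ : 0 ≤ κ)
    (hκ₁ : κ < 1) :
    ∃ C > 0, ∃ τ > 0, ∀ φ : Equiv.Perm T, (∀ k x, ‖v k (φ₀ x) - v k (φ x)‖ ≤ τ) →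
      (∀ k, (∀ x, |∏ j ∈ Finset.range (n k), Λ k (φ^[j] x)| ≤ κ) ∨
        ∀ x, |∏ j ∈ Finset.range (n k), Λ' k (φ^[j] x)| ≤ κ) →
      HasInverseBound (D - HolderFun.comp (gaugeLipschitz_boundedGauge φ)) C := by
  choose C hC₀ hC using fun k => exists_hasInverseBound_twist (hΛ k) (n k) hκ₀ hκ₁
  set C₁ : ℝ := (∑ k, C k) * c⁻¹ + 1
  have hsum : 0 ≤ ∑ k, C k := Finset.sum_nonneg fun k _ => hC₀ k
  have hc : 0 < c⁻¹ := inv_pos.2 hv.1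
  have hC₁ : 0 < C₁ := by positivity
  set N : ℝ := 2 * ∑ k, ‖Λ k‖ + 1
  have hN : 0 < N := by positivity
  refine ⟨‖HolderFun.frameL v‖ * (2 * C₁) + 1, by positivity, (2 * C₁)⁻¹ / N, by positivity,
    fun φ hclose hrate => ?_⟩
  have hφ := gaugeLipschitz_boundedGauge φ
  let e (k : ι) : BoundedFun T V := HolderFun.smulL (Λ k)
    (HolderFun.comp (gaugeLipschitz_boundedGauge φ₀) (v k) - HolderFun.comp hφ (v k))
  have he : ‖HolderFun.frameL e‖ ≤ (2 * C₁)⁻¹ := by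
    have hek (k : ι) : ‖e k‖ ≤ ‖Λ k‖ * ((2 * C₁)⁻¹ / N) := norm_le (by positivity) fun x =>
      (norm_smul_le _ _).trans (mul_le_mul ((Λ k).norm_apply_le x) (hclose k x) (norm_nonneg _)
        (norm_nonneg _))
    calc ‖HolderFun.frameL e‖ ≤ 2 * ∑ k, ‖Λ k‖ * ((2 * C₁)⁻¹ / N) :=
          (HolderFun.norm_frameL_le e).trans (by gcongr; exact hek _)
      _ = (2 * ∑ k, ‖Λ k‖) / N * (2 * C₁)⁻¹ := by rw [← Finset.sum_mul]; ring
      _ ≤ (2 * C₁)⁻¹ := mul_le_of_le_one_left (by positivity)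
          ((div_le_one hN).2 (lt_add_one _).le)
  have htwist := HasInverseBound.piMap (fun k => (hC k φ (hrate k)).mono
    (Finset.single_le_sum (fun k _ => hC₀ k) (Finset.mem_univ k))) hsum
  have hframe : HasInverseBound (HolderFun.frameL fun k => HolderFun.comp hφ (v k)) c⁻¹ :=
    hasInverseBound_frameL hι (hv.comp φ)
  have hfactor : (D - HolderFun.comp hφ) ∘L HolderFun.frameL v = _ :=
    HolderFun.sub_comp_frameL_eq_add hφ (e := e)
      (fun k x => by rw [heigen, ← add_sub_cancel (v k (φ x)) (v k (φ₀ x)), smul_add]; rfl) hD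
  have hcomp := ((hframe.comp htwist hsum).mono (lt_add_one _).le).add hC₁ he
  rw [← hfactor] at hcomp
  exact (hcomp.of_comp (HolderFun.frameL_bijective hι hv).2).mono (lt_add_one _).le

section Nonlinear

variable {φ : T → T} {M : T → V →L[ℝ] V} {D : BoundedFun T V →L[ℝ] BoundedFun T V} {C r : ℝ}
  {S : T → V → V}

theorem eq_of_apply_eq (hD : ∀ u x, D u x = M x (u x))
    (hinv : HasInverseBound (D - HolderFun.comp (gaugeLipschitz_boundedGauge φ)) C) (hC : 0 < C)
    (hS : ∀ x u w, ‖u‖ ≤ r → ‖w‖ ≤ r → ‖S x u - S x w - M x (u - w)‖ ≤ (2 * C)⁻¹ * ‖u - w‖)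
    {k k' : T → V} (hk : ∀ x, ‖k x‖ ≤ r) (hk' : ∀ x, ‖k' x‖ ≤ r)
    (hkS : ∀ x, k (φ x) = S x (k x)) (hkS' : ∀ x, k' (φ x) = S x (k' x)) : k = k' := by
  let w : BoundedFun T V := ofBounded k ⟨r, hk⟩ - ofBounded k' ⟨r, hk'⟩
  have hw : w = 0 := hinv.eq_zero_of_norm_le hC <| norm_le (by positivity) fun x => by
    calc ‖(D - HolderFun.comp (gaugeLipschitz_boundedGauge φ) :
            BoundedFun T V →L[ℝ] BoundedFun T V) w x‖
        = ‖S x (k x) - S x (k' x) - M x (k x - k' x)‖ := by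
          rw [norm_sub_rev, ← hkS, ← hkS', ← ofBounded_apply k ⟨r, hk⟩ x,
            ← ofBounded_apply k' ⟨r, hk'⟩ x, ← HolderFun.sub_apply, ← hD]
          rfl
      _ ≤ (2 * C)⁻¹ * ‖w x‖ := hS x _ _ (hk x) (hk' x)
      _ ≤ (2 * C)⁻¹ * ‖w‖ := by gcongr; exact w.norm_apply_le x
  funext x
  exact sub_eq_zero.1 (congrArg (fun u : BoundedFun T V => u x) hw)

theorem exists_apply_eq [CompleteSpace V] (hD : ∀ u x, D u x = M x (u x))
    (hinv : HasInverseBound (D - HolderFun.comp (gaugeLipschitz_boundedGauge φ)) C) (hC : 0 < C)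
    (hr : 0 ≤ r)
    (hS : ∀ x u w, ‖u‖ ≤ r → ‖w‖ ≤ r → ‖S x u - S x w - M x (u - w)‖ ≤ (2 * C)⁻¹ * ‖u - w‖)
    (hS₀ : ∀ x, ‖S x 0‖ ≤ (2 * C)⁻¹ * r) (hSb : ∀ R, ∃ B, ∀ x u, ‖u‖ ≤ R → ‖S x u‖ ≤ B) :
    ∃ k : T → V, (∀ x, ‖k x‖ ≤ r) ∧ ∀ x, k (φ x) = S x (k x) := by
  let G (u : BoundedFun T V) : BoundedFun T V :=
    ofBounded (fun x => S x (u x)) ((hSb ‖u‖).imp fun B hB x => hB x _ (u.norm_apply_le x)) -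
      HolderFun.comp (gaugeLipschitz_boundedGauge φ) u
  obtain ⟨k, hkr, hk⟩ := hinv.exists_zero hC (G := G) hr
    (fun u w hu hw => norm_le (by positivity) fun x => by
      calc ‖(G u - G w -
            (D - HolderFun.comp (gaugeLipschitz_boundedGauge φ) : _ →L[ℝ] _) (u - w)) x‖
          = ‖S x (u x) - S x (w x) - M x (u x - w x)‖ := by
            change ‖S x (u x) - u (φ x) - (S x (w x) - w (φ x)) -
              (D (u - w) x - (u (φ x) - w (φ x)))‖ = _
            rw [hD, HolderFun.sub_apply]
            congr 1
            abel
        _ ≤ (2 * C)⁻¹ * ‖(u - w) x‖ :=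
          hS x _ _ ((u.norm_apply_le x).trans hu) ((w.norm_apply_le x).trans hw)
        _ ≤ (2 * C)⁻¹ * ‖u - w‖ := by gcongr; exact (u - w).norm_apply_le x)
    (norm_le (by positivity) fun x => by simpa [G] using hS₀ x)
  exact ⟨k, fun x => (k.norm_apply_le x).trans hkr, fun x =>
    (sub_eq_zero.1 (congrArg (fun u : BoundedFun T V => u x) hk)).symm⟩

end Nonlinear

end BoundedFun

end BoundedFunctions

theorem bijective_id_add_of_lipschitzWith {X : Type*} [NormedAddCommGroup X] [CompleteSpace X]
    {f : X → X} {K : ℝ≥0} (hf : LipschitzWith K f) (hK : K < 1) :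
    Function.Bijective fun x => x + f x := by
  rw [Function.bijective_iff_existsUnique]
  intro z
  have hcontr : ContractingWith K fun x => z - f x :=
    ⟨hK, LipschitzWith.of_dist_le_mul fun x y => by
      rw [dist_sub_left]; exact hf.dist_le_mul x y⟩
  exact ⟨hcontr.fixedPoint, (eq_add_of_sub_eq hcontr.fixedPoint_isFixedPt).symm,
    fun x hx => hcontr.fixedPoint_unique (sub_eq_of_eq_add hx.symm)⟩

theorem eventually_forall_lt {X T : Type*} [TopologicalSpace X] [TopologicalSpace T]
    [CompactSpace T] {Q : X × T → ℝ} (hQ : Continuous Q) {x₀ : X} {c : ℝ}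
    (h : ∀ t, Q (x₀, t) < c) : ∀ᶠ x in 𝓝 x₀, ∀ t, Q (x, t) < c := by
  have hev := isCompact_univ.eventually_forall_of_forall_eventually (x₀ := x₀)
    (P := fun x t => Q (x, t) < c)
    (fun t _ => hQ.continuousAt.eventually_lt continuousAt_const (h t))
  exact hev.mono fun x hx t => hx t trivial

/-- A continuous function on a compact space, as a bounded function. -/
def BoundedFun.ofContinuous {T V : Type*} [TopologicalSpace T] [CompactSpace T]
    [NormedAddCommGroup V] [NormedSpace ℝ V] (f : T → V) (hf : Continuous f) : BoundedFun T V :=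
  ofBounded f <| (isCompact_univ.exists_bound_of_continuousOn hf.continuousOn).imp
    fun _ h t => h t trivial

section Perturbed

variable {d : ℕ} {A : Equiv.Perm (Torus d)} {F : Torus d → E d}

theorem perturbed_zero (A : Equiv.Perm (Torus d)) (F : Torus d → E d) : perturbed A F 0 = A := by
  ext1 ψ
  rw [perturbed, zero_smul, proj_zero, add_zero]

theorem bijective_perturbed {L L' : ℝ≥0} (hA : LipschitzWith L (⇑A⁻¹)) (hF : LipschitzWith L' F)
    {ε : ℝ} (hε : ‖ε‖₊ * (L' * L) < 1) : Function.Bijective (perturbed A F ε) := by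
  have hlip : LipschitzWith (‖ε‖₊ * (L' * L)) fun y => proj (ε • F (A⁻¹ y)) := by
    have := lipschitzWith_proj.comp ((lipschitzWith_smul ε).comp (hF.comp hA))
    rwa [one_mul] at this
  have hfactor : perturbed A F ε = (fun y => y + proj (ε • F (A⁻¹ y))) ∘ A := by
    ext1 ψ
    simp [perturbed]
  rw [hfactor]
  exact (bijective_id_add_of_lipschitzWith hlip hε).comp A.bijective

theorem eventually_bijective_perturbed {L L' : ℝ≥0} (hA : LipschitzWith L (⇑A⁻¹))
    (hF : LipschitzWith L' F) : ∀ᶠ ε in 𝓝 (0 : ℝ), Function.Bijective (perturbed A F ε) := by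
  have hcont : Continuous fun ε : ℝ => ‖ε‖₊ * (L' * L) := by fun_prop
  filter_upwards [(hcont.tendsto 0).eventually_lt_const (u := 1) (by simp)] with ε hε
  exact bijective_perturbed hA hF hε

theorem continuous_perturbed (hA : Continuous A) (hF : Continuous F) :
    Continuous fun p : ℝ × Torus d => perturbed A F p.1 p.2 := by
  unfold perturbed
  exact (hA.comp continuous_snd).add
    (continuous_proj.comp (continuous_fst.smul (hF.comp continuous_snd)))

theorem continuous_perturbed_iterate (hA : Continuous A) (hF : Continuous F) (n : ℕ) :
    Continuous fun p : ℝ × Torus d => (perturbed A F p.1)^[n] p.2 := by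
  induction n with
  | zero => exact continuous_snd
  | succ n ih =>
    simp only [Function.iterate_succ_apply']
    exact (continuous_perturbed hA hF).comp (continuous_fst.prodMk ih)

theorem eventually_abs_prod_perturbed_le (hA : Continuous A) (hF : Continuous F)
    {Λ : Torus d → ℝ} (hΛ : Continuous Λ) {n : ℕ} {κ κ' : ℝ} (hκ : κ < κ')
    (h : ∀ ψ, |cocycle A Λ n ψ| ≤ κ) :
    ∀ᶠ ε in 𝓝 (0 : ℝ), ∀ ψ, |∏ j ∈ Finset.range n, Λ ((perturbed A F ε)^[j] ψ)| ≤ κ' := by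
  have hcont : Continuous fun p : ℝ × Torus d =>
      |∏ j ∈ Finset.range n, Λ ((perturbed A F p.1)^[j] p.2)| :=
    (continuous_finsetProd _ fun j _ => hΛ.comp (continuous_perturbed_iterate hA hF j)).abs
  filter_upwards [eventually_forall_lt (x₀ := 0) hcont fun ψ => by
    rw [perturbed_zero, ← cocycle_eq_iterate]
    exact (h ψ).trans_lt hκ] with ε hε ψ using (hε ψ).le

theorem eventually_norm_sub_perturbed_le {V : Type*} [NormedAddCommGroup V] (hA : Continuous A)
    (hF : Continuous F) {v : Torus d → V} (hv : Continuous v) {τ : ℝ} (hτ : 0 < τ) :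
    ∀ᶠ ε in 𝓝 (0 : ℝ), ∀ ψ, ‖v (A ψ) - v (perturbed A F ε ψ)‖ ≤ τ := by
  have hcont : Continuous fun p : ℝ × Torus d => ‖v (A p.2) - v (perturbed A F p.1 p.2)‖ :=
    ((hv.comp (hA.comp continuous_snd)).sub (hv.comp (continuous_perturbed hA hF))).norm
  filter_upwards [eventually_forall_lt (x₀ := 0) hcont fun ψ => by
    simpa [perturbed_zero] using hτ] with ε hε ψ using (hε ψ).le

theorem eventually_hasInverseBound_sub_comp_perturbed {V ι : Type*} [NormedAddCommGroup V]
    [NormedSpace ℝ V] [FiniteDimensional ℝ V] [Fintype ι]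
    (hι : Fintype.card ι = Module.finrank ℝ V) {L L' : ℝ≥0} (hA : Continuous A)
    (hA' : LipschitzWith L (⇑A⁻¹)) (hF : LipschitzWith L' F) {v : ι → Torus d → V} {c : ℝ}
    (hv : IsUniformFrame v c) (hvc : ∀ i, Continuous (v i)) {Λ : ι → Torus d → ℝ}
    (hΛ : ∀ i, Continuous (Λ i)) (hΛ₀ : ∀ i ψ, Λ i ψ ≠ 0) {M : Torus d → V →L[ℝ] V}
    {D : BoundedFun (Torus d) V →L[ℝ] BoundedFun (Torus d) V} (hD : ∀ u ψ, D u ψ = M ψ (u ψ))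
    (heigen : ∀ i ψ, M ψ (v i ψ) = Λ i ψ • v i (A ψ)) {κ : ℝ} (hκ : κ < 1)
    (hrate : ∀ i, ∃ n, (∀ ψ, |cocycle A (Λ i) n ψ| ≤ κ) ∨
      ∀ ψ, |(cocycle A (Λ i) n ψ)⁻¹| ≤ κ) :
    ∃ C > 0, ∀ᶠ ε in 𝓝 (0 : ℝ),
      HasInverseBound (D - HolderFun.comp (gaugeLipschitz_boundedGauge (perturbed A F ε))) C := by
  have hΛ' (i : ι) : Continuous fun ψ => (Λ i ψ)⁻¹ := (hΛ i).inv₀ (hΛ₀ i)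
  obtain ⟨κ', hκκ', hκ'₁⟩ := exists_between (max_lt hκ one_pos)
  choose n hn using hrate
  obtain ⟨C, hC, τ, hτ, hinv⟩ := BoundedFun.exists_hasInverseBound_sub_comp hι
    (v := fun i => .ofContinuous (v i) (hvc i)) hv
    (Λ := fun i => .ofContinuous (Λ i) (hΛ i))
    (Λ' := fun i => .ofContinuous _ (hΛ' i)) (fun i ψ => mul_inv_cancel₀ (hΛ₀ i ψ)) hD
    heigen n ((le_max_right κ 0).trans hκκ'.le) hκ'₁
  have hprod : ∀ᶠ ε in 𝓝 (0 : ℝ), ∀ i,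
      (∀ ψ, |∏ j ∈ Finset.range (n i), Λ i ((perturbed A F ε)^[j] ψ)| ≤ κ') ∨
      ∀ ψ, |∏ j ∈ Finset.range (n i), (Λ i ((perturbed A F ε)^[j] ψ))⁻¹| ≤ κ' := by
    have hlt := (le_max_left κ 0).trans_lt hκκ'
    refine eventually_all.2 fun i => (hn i).elim (fun h => ?_) fun h => ?_
    · exact (eventually_abs_prod_perturbed_le hA hF.continuous (hΛ i) hlt h).mono
        fun _ => Or.inl
    · refine (eventually_abs_prod_perturbed_le hA hF.continuous (hΛ' i) hlt fun ψ => ?_).mono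
        fun _ => Or.inr
      simpa only [cocycle, Finset.prod_inv_distrib] using h ψ
  refine ⟨C, hC, ?_⟩
  filter_upwards [eventually_bijective_perturbed hA' hF, hprod,
    eventually_all.2 fun i => eventually_norm_sub_perturbed_le hA hF.continuous (hvc i) hτ]
    with ε hbij hε hvε
  exact hinv (Equiv.ofBijective _ hbij) hvε hε

end Perturbed

section Displacement

variable {d : ℕ} {A : Equiv.Perm (Torus d)} {F : Torus d → E d} {g : E d → E d}

theorem map_add_proj_eq_add_proj_incr (hgA : ∀ x, proj (g x) = A (proj x)) (ψ : Torus d)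
    (u : E d) : A (ψ + proj u) = A ψ + proj (incr g ψ u) := by
  rw [map_add_proj hgA, incr, proj_sub, hgA (rep ψ), proj_rep, add_sub_cancel]

theorem incr_zero (g : E d → E d) (ψ : Torus d) : incr g ψ 0 = 0 := by
  rw [incr, add_zero, sub_self]

theorem IsQuasiPeriodic.incr_add (hg : IsQuasiPeriodic g) (ψ : Torus d) (u w : E d) :
    incr g ψ (u + w) = incr g ψ u + incr g (ψ + proj u) w := by
  have hrep : ψ + proj u = proj (rep ψ + u) := by rw [proj_add, proj_rep]
  rw [hrep, hg.incr_proj, incr, incr, add_assoc]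
  abel

theorem norm_incr_le {L : ℝ≥0} (hL : LipschitzWith L g) (ψ : Torus d) (u : E d) :
    ‖incr g ψ u‖ ≤ L * ‖u‖ := by
  simpa [incr, dist_eq_norm] using hL.dist_le_mul (rep ψ + u) (rep ψ)

theorem norm_incr_sub_sub_fderiv_le (hg : Differentiable ℝ g) {L : ℝ≥0}
    (hL : LipschitzWith L (fderiv ℝ g)) (ψ : Torus d) {u w : E d} {r : ℝ} (hu : ‖u‖ ≤ r)
    (hw : ‖w‖ ≤ r) :
    ‖incr g ψ u - incr g ψ w - fderiv ℝ g (rep ψ) (u - w)‖ ≤ L * r * ‖u - w‖ := by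
  have hmean := (convex_closedBall (rep ψ) r).norm_image_sub_le_of_norm_fderiv_le' (𝕜 := ℝ)
    (f := g) (φ := fderiv ℝ g (rep ψ)) (C := L * r) (x := rep ψ + w) (y := rep ψ + u)
    (fun x _ => hg x)
    (fun x hx => by
      rw [← dist_eq_norm]
      exact (hL.dist_le_mul _ _).trans (by gcongr; exact hx))
    (by simpa using hw) (by simpa using hu)
  rw [add_sub_add_left_eq_sub] at hmean
  simpa [incr] using hmean

/-- The displacement from `A_ε ψ` to `A_ε' (ψ + u)`, where `A_ε = A + ε F` and `g` is a lift of
`A`. -/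
def stepDisplacement (g : E d → E d) (F : Torus d → E d) (ε ε' : ℝ) (ψ : Torus d) (u : E d) :
    E d :=
  incr g ψ u + ε' • F (ψ + proj u) - ε • F ψ

theorem perturbed_add_proj (hgA : ∀ x, proj (g x) = A (proj x)) (ε ε' : ℝ) (ψ : Torus d)
    (u : E d) :
    perturbed A F ε' (ψ + proj u) =
      perturbed A F ε ψ + proj (stepDisplacement g F ε ε' ψ u) := by
  rw [perturbed, perturbed, map_add_proj_eq_add_proj_incr hgA, stepDisplacement, proj_sub,
    proj_add]
  abel

theorem stepDisplacement_zero (g : E d → E d) (F : Torus d → E d) (ε ε' : ℝ) (ψ : Torus d) :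
    stepDisplacement g F ε ε' ψ 0 = (ε' - ε) • F ψ := by
  rw [stepDisplacement, incr_zero, proj_zero, add_zero, zero_add, sub_smul]

theorem IsQuasiPeriodic.stepDisplacement_add (hg : IsQuasiPeriodic g) (F : Torus d → E d)
    (ε ε' ε'' : ℝ) (ψ : Torus d) (u w : E d) :
    stepDisplacement g F ε ε'' ψ (u + w) =
      stepDisplacement g F ε ε' ψ u + stepDisplacement g F ε' ε'' (ψ + proj u) w := by
  simp only [stepDisplacement, hg.incr_add, proj_add, add_assoc ψ]
  abel

theorem norm_stepDisplacement_sub_sub_fderiv_le (hg : Differentiable ℝ g) {L L' : ℝ≥0}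
    (hL : LipschitzWith L (fderiv ℝ g)) (hF : LipschitzWith L' F) (ε ε' : ℝ) (ψ : Torus d)
    {u w : E d} {r : ℝ} (hu : ‖u‖ ≤ r) (hw : ‖w‖ ≤ r) :
    ‖stepDisplacement g F ε ε' ψ u - stepDisplacement g F ε ε' ψ w -
      fderiv ℝ g (rep ψ) (u - w)‖ ≤ (L * r + |ε'| * L') * ‖u - w‖ := by
  have hFuw : ‖F (ψ + proj u) - F (ψ + proj w)‖ ≤ L' * ‖u - w‖ := by
    rw [← dist_eq_norm]
    refine (hF.dist_le_mul _ _).trans ?_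
    rw [dist_add_left, dist_eq_norm, ← proj_sub]
    gcongr
    exact norm_proj_le _
  calc _ = ‖(incr g ψ u - incr g ψ w - fderiv ℝ g (rep ψ) (u - w)) +
        ε' • (F (ψ + proj u) - F (ψ + proj w))‖ := by
        rw [stepDisplacement, stepDisplacement, smul_sub]
        congr 1
        abel
    _ ≤ L * r * ‖u - w‖ + |ε'| * (L' * ‖u - w‖) := by
        refine norm_add_le_of_le (norm_incr_sub_sub_fderiv_le hg hL ψ hu hw) ?_
        rw [norm_smul, Real.norm_eq_abs]
        gcongr
    _ = _ := by ring

theorem norm_stepDisplacement_le {L : ℝ≥0} (hL : LipschitzWith L g) {B : ℝ}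
    (hB : ∀ ψ, ‖F ψ‖ ≤ B) (ε ε' : ℝ) (ψ : Torus d) (u : E d) :
    ‖stepDisplacement g F ε ε' ψ u‖ ≤ L * ‖u‖ + |ε'| * B + |ε| * B := by
  refine norm_sub_le_of_le (norm_add_le_of_le (norm_incr_le hL ψ u) ?_) ?_ <;>
  · rw [norm_smul, Real.norm_eq_abs]
    gcongr
    exact hB _

/-- The displacement `k` semiconjugates `A_ε` to `A_ε'`, that is,
`(id + k) ∘ A_ε = A_ε' ∘ (id + k)`; the equation is stated in `ℝ^d`, for a lift `g` of `A`, rather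
than mod `2π`. -/
def IsIntertwining (A : Equiv.Perm (Torus d)) (g : E d → E d) (F : Torus d → E d) (ε ε' : ℝ)
    (k : Torus d → E d) : Prop :=
  ∀ ψ, k (perturbed A F ε ψ) = stepDisplacement g F ε ε' ψ (k ψ)

namespace IsIntertwining

variable {ε ε' ε'' : ℝ} {k k' : Torus d → E d}

theorem semiconj (hk : IsIntertwining A g F ε ε' k) (hgA : ∀ x, proj (g x) = A (proj x)) :
    Function.Semiconj (fun ψ => ψ + proj (k ψ)) (perturbed A F ε) (perturbed A F ε') := fun ψ => by
  rw [perturbed_add_proj hgA ε, ← hk]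

theorem zero : IsIntertwining A g F ε ε 0 := fun ψ => by
  simp [stepDisplacement_zero]

theorem comp (hk' : IsIntertwining A g F ε' ε'' k') (hk : IsIntertwining A g F ε ε' k)
    (hgA : ∀ x, proj (g x) = A (proj x)) (hg : IsQuasiPeriodic g) :
    IsIntertwining A g F ε ε'' fun ψ => k ψ + k' (ψ + proj (k ψ)) := fun ψ => by
  rw [hg.stepDisplacement_add F ε ε', ← hk, ← hk']
  exact congrArg (_ + k' ·) (hk.semiconj hgA ψ)

end IsIntertwining

theorem bijective_add_proj_of_comp_eq_zero {h k : Torus d → E d}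
    (hhk : ∀ ψ, h ψ + k (ψ + proj (h ψ)) = 0) (hkh : ∀ ψ, k ψ + h (ψ + proj (k ψ)) = 0) :
    Function.Bijective fun ψ => ψ + proj (h ψ) := by
  refine Function.bijective_iff_has_inverse.2
    ⟨fun ψ => ψ + proj (k ψ), fun ψ => ?_, fun ψ => ?_⟩
  · change ψ + proj (h ψ) + proj (k (ψ + proj (h ψ))) = ψ
    rw [add_assoc, ← proj_add, hhk, proj_zero, add_zero]
  · change ψ + proj (k ψ) + proj (h (ψ + proj (k ψ))) = ψ
    rw [add_assoc, ← proj_add, hkh, proj_zero, add_zero]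

section Shadowing

variable {C : ℝ} {D : BoundedFun (Torus d) (E d) →L[ℝ] BoundedFun (Torus d) (E d)}

theorem exists_shadowing (hg : AnalyticOnNhd ℝ g Set.univ) (hper : IsQuasiPeriodic g) {L : ℝ≥0}
    (hF : LipschitzWith L F) (hD : ∀ u ψ, D u ψ = fderiv ℝ g (rep ψ) (u ψ)) (hC : 0 < C)
    (hinv : ∀ᶠ ε in 𝓝 (0 : ℝ),
      HasInverseBound (D - HolderFun.comp (gaugeLipschitz_boundedGauge (perturbed A F ε))) C) :
    ∃ r > 0, ∀ᶠ p : ℝ × ℝ in 𝓝 0,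
      (∃ k, (∀ ψ, ‖k ψ‖ ≤ r / 2) ∧ IsIntertwining A g F p.1 p.2 k) ∧
      ∀ k k', (∀ ψ, ‖k ψ‖ ≤ r) → (∀ ψ, ‖k' ψ‖ ≤ r) → IsIntertwining A g F p.1 p.2 k →
        IsIntertwining A g F p.1 p.2 k' → k = k' := by
  obtain ⟨Lg, hLg⟩ := hper.exists_lipschitzWith hg
  obtain ⟨Ldg, hLdg⟩ :=
    (IsQuasiPeriodic.of_factorsThrough hper.factorsThrough_fderiv).exists_lipschitzWith hg.fderiv
  obtain ⟨B, -, hB⟩ := exists_forall_norm_le hF.continuous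
  set r : ℝ := (2 * C)⁻¹ / (2 * (Ldg + 1))
  have hr : 0 < r := by positivity
  have hsmall : ∀ᶠ p : ℝ × ℝ in 𝓝 0, Ldg * r + |p.2| * L < (2 * C)⁻¹ := by
    have hcont : Continuous fun p : ℝ × ℝ => Ldg * r + |p.2| * L := by fun_prop
    refine (hcont.tendsto 0).eventually_lt_const ?_
    have : (Ldg + 1) * r = (2 * C)⁻¹ / 2 := by simp only [r]; field_simp
    have : 0 < (2 * C)⁻¹ := by positivity
    simp only [Prod.snd_zero, abs_zero, zero_mul, add_zero]
    linarith
  have hsmall₀ : ∀ᶠ p : ℝ × ℝ in 𝓝 0, |p.2 - p.1| * B < (2 * C)⁻¹ * (r / 2) := by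
    have hcont : Continuous fun p : ℝ × ℝ => |p.2 - p.1| * B := by fun_prop
    refine (hcont.tendsto 0).eventually_lt_const ?_
    simp only [Prod.snd_zero, Prod.fst_zero, sub_zero, abs_zero, zero_mul]
    positivity
  refine ⟨r, hr, ?_⟩
  filter_upwards [(continuous_fst.tendsto (0 : ℝ × ℝ)).eventually hinv, hsmall, hsmall₀]
    with ⟨ε, ε'⟩ hinvε hε hε₀
  have hstep (ψ : Torus d) (u w : E d) (hu : ‖u‖ ≤ r) (hw : ‖w‖ ≤ r) :=
    (norm_stepDisplacement_sub_sub_fderiv_le (fun x => (hg x trivial).differentiableAt) hLdg hF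
      ε ε' ψ hu hw).trans (mul_le_mul_of_nonneg_right hε.le (norm_nonneg _))
  refine ⟨BoundedFun.exists_apply_eq hD hinvε hC (half_pos hr).le
    (fun ψ u w hu hw => hstep ψ u w (hu.trans (half_le_self hr.le)) (hw.trans (half_le_self hr.le)))
    (fun ψ => ?_) fun R => ⟨_, fun ψ u hu => (norm_stepDisplacement_le hLg hB ε ε' ψ u).trans <|
      add_le_add_left (add_le_add_left (mul_le_mul_of_nonneg_left hu Lg.2) _) _⟩,
    fun k k' => BoundedFun.eq_of_apply_eq hD hinvε hC hstep⟩
  rw [stepDisplacement_zero, norm_smul, Real.norm_eq_abs]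
  exact (mul_le_mul_of_nonneg_left (hB ψ) (abs_nonneg _)).trans hε₀.le

theorem exists_radius_isHomeomorph (hgA : ∀ x, proj (g x) = A (proj x))
    (hg : AnalyticOnNhd ℝ g Set.univ) (hper : IsQuasiPeriodic g) {L : ℝ≥0}
    (hF : LipschitzWith L F) (hD : ∀ u ψ, D u ψ = fderiv ℝ g (rep ψ) (u ψ)) (hC : 0 < C)
    (hinv : ∀ᶠ ε in 𝓝 (0 : ℝ),
      HasInverseBound (D - HolderFun.comp (gaugeLipschitz_boundedGauge (perturbed A F ε))) C) :
    ∃ r > 0, ∀ᶠ ε in 𝓝 (0 : ℝ), ∀ h : Torus d → E d, Continuous h → (∀ ψ, ‖h ψ‖ ≤ r) →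
      IsIntertwining A g F 0 ε h → IsHomeomorph fun ψ => ψ + proj (h ψ) := by
  obtain ⟨r, hr, hshadow⟩ := exists_shadowing hg hper hF hD hC hinv
  refine ⟨r / 2, half_pos hr, ?_⟩
  filter_upwards [(Continuous.prodMk_left (0 : ℝ)).tendsto' 0 (0 : ℝ × ℝ) rfl |>.eventually hshadow,
    (continuous_id.prodMk continuous_id).tendsto' (0 : ℝ) (0 : ℝ × ℝ) rfl |>.eventually hshadow]
    with ε hε hεε h hcont hhr hh
  obtain ⟨k, hkr, hk⟩ := hε.1
  have hr₀ (_ : Torus d) : ‖(0 : E d)‖ ≤ r := by simpa using hr.le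
  have hle {u w : E d} (hu : ‖u‖ ≤ r / 2) (hw : ‖w‖ ≤ r / 2) : ‖u + w‖ ≤ r :=
    (norm_add_le_of_le hu hw).trans_eq (add_halves r)
  have hhk := hshadow.self_of_nhds.2 _ 0 (fun ψ => hle (hhr ψ) (hkr _)) hr₀
    (hk.comp hh hgA hper) .zero
  have hkh := hεε.2 _ 0 (fun ψ => hle (hkr ψ) (hhr _)) hr₀ (hh.comp hk hgA hper) .zero
  exact isHomeomorph_iff_continuous_bijective.2
    ⟨continuous_id.add (continuous_proj.comp hcont),
      bijective_add_proj_of_comp_eq_zero (congrFun hhk) (congrFun hkh)⟩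

end Shadowing

end Displacement

section Exponent

variable {d : ℕ} {A : Equiv.Perm (Torus d)} {L L' : ℝ≥0}

theorem eventually_twist_one_bijective (hL : 1 ≤ L) (hL' : 1 ≤ L') (hA : LipschitzWith L A)
    (hA' : LipschitzWith L' (⇑A⁻¹)) {f : Torus d → ℝ} (hf : Continuous f) (hf₀ : ∀ ψ, f ψ ≠ 0)
    {κ : ℝ} (hκ₀ : 0 ≤ κ) (hκ₁ : κ < 1) {n : ℕ}
    (h : (∀ ψ, |cocycle A f n ψ| ≤ κ) ∨ ∀ ψ, |(cocycle A f n ψ)⁻¹| ≤ κ) :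
    ∀ᶠ β : ℝ≥0 in 𝓝 0, ∀ a : HolderFun (gauge (T := Torus d) β) ℝ, (∀ ψ, a ψ = f ψ) →
      Function.Bijective
        (HolderFun.twist (gaugeLipschitz_of_lipschitzWith β hL hA) a (.const 1)) := by
  have hone (ψ : Torus d) : |cocycle A (fun _ => 1) n ψ| = 1 := by simp [cocycle]
  refine (eventually_twist_bijective hL hL' hA hA' hf continuous_const hf₀
    (fun _ => one_ne_zero) n hκ₀ hκ₁ (h.symm.imp (fun h ψ => ?_) fun h ψ => ?_)).mono
      fun β hβ a ha => hβ a _ ha fun _ => rfl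
  · rw [hone, ← inv_le_iff_one_le_mul₀ (abs_pos.2 (cocycle_ne_zero hf₀ n ψ)), ← abs_inv]
    exact h ψ
  · rw [hone, mul_one]
    exact h ψ

theorem IsDominated.eventually_twist_bijective {Λ : Fin d → Torus d → ℝ} (hdom : IsDominated A Λ)
    (hL : 1 ≤ L) (hL' : 1 ≤ L') (hA : LipschitzWith L A) (hA' : LipschitzWith L' (⇑A⁻¹))
    (hΛ : ∀ i, Continuous (Λ i)) (hΛ₀ : ∀ i ψ, Λ i ψ ≠ 0) {i k : Fin d} (hki : k ≠ i) :
    ∀ᶠ β : ℝ≥0 in 𝓝 0, ∀ a b : HolderFun (gauge (T := Torus d) β) ℝ, (∀ ψ, a ψ = Λ k ψ) →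
      (∀ ψ, b ψ = Λ i ψ) →
      Function.Bijective (HolderFun.twist (gaugeLipschitz_of_lipschitzWith β hL hA) a b) := by
  rcases lt_or_gt_of_ne hki with hlt | hlt <;>
    obtain ⟨n, κ, hκ₀, hκ₁, hκ⟩ := (hdom.isDominatedBy_of_lt hΛ₀ hlt).exists
  · exact ToralAnosov.eventually_twist_bijective hL hL' hA hA' (hΛ k) (hΛ i) (hΛ₀ k) (hΛ₀ i) n
      hκ₀ hκ₁ (.inr fun ψ => hκ ψ ψ)
  · exact ToralAnosov.eventually_twist_bijective hL hL' hA hA' (hΛ k) (hΛ i) (hΛ₀ k) (hΛ₀ i) n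
      hκ₀ hκ₁ (.inl fun ψ => hκ ψ ψ)

theorem exists_exponent_twist_bijective {β₀ : ℝ≥0} (hβ₀ : 0 < β₀) (hA : LipschitzWith L A)
    (hA' : LipschitzWith L' (⇑A⁻¹)) {Λ : Fin d → Torus d → ℝ} (hdom : IsDominated A Λ)
    (hΛ : ∀ i, Continuous (Λ i)) (hΛ₀ : ∀ i ψ, Λ i ψ ≠ 0) {κ : ℝ} (hκ₀ : 0 ≤ κ) (hκ₁ : κ < 1)
    (hrate : ∀ i, ∃ n, (∀ ψ, |cocycle A (Λ i) n ψ| ≤ κ) ∨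
      ∀ ψ, |(cocycle A (Λ i) n ψ)⁻¹| ≤ κ) :
    ∃ β : ℝ≥0, 0 < β ∧ β ≤ β₀ ∧ ∃ (K : ℝ≥0) (hφ : GaugeLipschitz (gauge β) A K),
      ∀ a : Fin d → HolderFun (gauge (T := Torus d) β) ℝ, (∀ i ψ, a i ψ = Λ i ψ) →
        (∀ i, Function.Bijective (HolderFun.twist hφ (a i) (.const 1))) ∧
        ∀ i k, k ≠ i → Function.Bijective (HolderFun.twist hφ (a k) (a i)) := by
  have hL := le_max_right L 1
  have hL' := le_max_right L' 1
  replace hA := hA.weaken (le_max_left L 1)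
  replace hA' := hA'.weaken (le_max_left L' 1)
  have htwist₁ := eventually_all.2 fun i => (hrate i).elim fun n hn =>
    eventually_twist_one_bijective hL hL' hA hA' (hΛ i) (hΛ₀ i) hκ₀ hκ₁ hn
  have htwist := eventually_all.2 fun i => eventually_all.2 fun k => eventually_all.2
    fun hki : k ≠ i => hdom.eventually_twist_bijective hL hL' hA hA' hΛ hΛ₀ hki
  obtain ⟨β, ⟨hβ, hββ₀⟩, hβ₁, hβ₂⟩ := ((eventually_mem_set.2 (Ioc_mem_nhdsGT hβ₀)).and
    ((htwist₁.and htwist).filter_mono nhdsWithin_le_nhds)).exists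
  exact ⟨β, hβ, hββ₀, _, gaugeLipschitz_of_lipschitzWith β hL hA, fun a ha =>
    ⟨fun i => hβ₁ i _ (ha i), fun i k hki => hβ₂ i k hki _ _ (ha k) (ha i)⟩⟩

end Exponent

section Radius

theorem eventually_forall_abs_lt {p : ℝ → Prop} (hp : ∀ᶠ ε in 𝓝 (0 : ℝ), p ε) :
    ∀ᶠ ε₀ in 𝓝[>] (0 : ℝ), ∀ ε, |ε| < ε₀ → p ε := by
  obtain ⟨r, hr, hball⟩ := Metric.eventually_nhds_iff.1 hp
  filter_upwards [Ioc_mem_nhdsGT hr] with ε₀ hε₀ ε hε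
  exact hball (by simpa only [Real.dist_0_eq_abs] using hε.trans_le hε₀.2)

end Radius

section Persistence

variable {d : ℕ} {A : Equiv.Perm (Torus d)} {F : Torus d → E d} {g : E d → E d}

theorem IsAnalyticField.exists_lipschitzWith (hF : IsAnalyticField F) :
    ∃ L : ℝ≥0, LipschitzWith L F := by
  have hper : (fun x : E d => F (proj x)).FactorsThrough proj := fun x y h => congrArg F h
  obtain ⟨L, hL⟩ := (IsQuasiPeriodic.of_factorsThrough hper).exists_lipschitzWith hF
  refine ⟨L, .of_dist_le_mul fun ψ ψ' => ?_⟩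
  have hrep := norm_sub_rep_le (fun x y => by simpa only [dist_eq_norm] using hL.dist_le_mul x y)
    hper ψ ψ'
  simpa only [proj_rep, ← dist_eq_norm] using hrep

theorem tderiv_perturbed (hgA : ∀ x, proj (g x) = A (proj x)) (hg : AnalyticOnNhd ℝ g Set.univ)
    (hF : IsAnalyticField F) (ε : ℝ) (ψ : Torus d) (u : E d) :
    tderiv (perturbed A F ε) (ψ + proj u) =
      fderiv ℝ g (rep ψ + u) + ε • fderiv ℝ (fun x => F (proj x)) (rep ψ + u) := by
  have hgd := (hg (rep ψ + u) trivial).differentiableAt.hasFDerivAt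
  have hFd := (hF (rep ψ + u) trivial).differentiableAt.hasFDerivAt
  have hlift (x : E d) : proj (g x + ε • F (proj x)) = perturbed A F ε (proj x) := by
    rw [proj_add, hgA, perturbed]
  have hd := hgd.add (hFd.const_smul ε)
  rw [← hd.fderiv, ← proj_rep ψ, ← proj_add, proj_rep]
  exact tderiv_eq_of_lift hlift hd.continuousAt

theorem isIntertwining_zero_iff {ε : ℝ} {h : Torus d → E d} :
    IsIntertwining A g F 0 ε h ↔
      ∀ ψ, h (A ψ) = incr g ψ (h ψ) + ε • F (ψ + proj (h ψ)) := by
  simp only [IsIntertwining, perturbed_zero, stepDisplacement, zero_smul, sub_zero]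

theorem IsUniformFrame.eventually_linearIndependent {T ι V : Type*} [Fintype ι]
    [NormedAddCommGroup V] [NormedSpace ℝ V] {ρ : T → T → ℝ≥0} {v : ι → HolderFun ρ V} {c : ℝ}
    (hv : IsUniformFrame (fun k => v k) c) {w : ι → ℝ → HolderFun ρ V}
    (hw : ∀ k, ContinuousAt (w k) 0) (hw₀ : ∀ k, w k 0 = v k) :
    ∀ᶠ ε in 𝓝 (0 : ℝ), ∀ x, LinearIndependent ℝ fun k => w k ε x := by
  have hcont : ContinuousAt (fun ε => ∑ k, ‖w k ε - v k‖) 0 :=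
    tendsto_finsetSum _ fun k _ => ((hw k).sub continuousAt_const).norm
  filter_upwards [hcont.eventually_lt_const (by simpa [hw₀] using hv.1)] with ε hε x
  exact hv.linearIndependent_of_sum_norm_sub_lt
    ((Finset.sum_le_sum fun k _ => (w k ε - v k).norm_apply_le x).trans_lt hε)

theorem eventually_isHomeomorph_add_proj (hgA : ∀ x, proj (g x) = A (proj x))
    (hg : AnalyticOnNhd ℝ g Set.univ) (hper : IsQuasiPeriodic g) {L L' : ℝ≥0} (hA : Continuous A)
    (hA' : LipschitzWith L (⇑A⁻¹)) (hF : LipschitzWith L' F) {v : Fin d → Torus d → E d} {c : ℝ}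
    (hv : IsUniformFrame v c) (hvc : ∀ i, Continuous (v i)) {Λ : Fin d → Torus d → ℝ}
    (hΛ : ∀ i, Continuous (Λ i)) (hΛ₀ : ∀ i ψ, Λ i ψ ≠ 0)
    (heigen : ∀ i ψ, fderiv ℝ g (rep ψ) (v i ψ) = Λ i ψ • v i (A ψ)) {κ : ℝ} (hκ : κ < 1)
    (hrate : ∀ i, ∃ n, (∀ ψ, |cocycle A (Λ i) n ψ| ≤ κ) ∨
      ∀ ψ, |(cocycle A (Λ i) n ψ)⁻¹| ≤ κ)
    {β : ℝ≥0} (hβ : 0 < β) {h : ℝ → HolderFun (gauge (T := Torus d) β) (E d)}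
    (hh : ContinuousAt h 0) (h₀ : h 0 = 0)
    (hconj : ∀ᶠ ε in 𝓝 0, IsIntertwining A g F 0 ε (h ε)) :
    ∀ᶠ ε in 𝓝 0, IsHomeomorph fun ψ => ψ + proj (h ε ψ) := by
  obtain ⟨B, -, hB⟩ := exists_bound_of_factorsThrough_proj
    (continuousOn_univ.1 hg.fderiv.continuousOn) hper.factorsThrough_fderiv
  let D : BoundedFun (Torus d) (E d) →L[ℝ] BoundedFun (Torus d) (E d) :=
    HolderFun.applyL (BoundedFun.ofBounded (fun ψ => fderiv ℝ g (rep ψ)) ⟨B, fun ψ => hB (rep ψ)⟩)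
  have hD (u : BoundedFun (Torus d) (E d)) (ψ : Torus d) :
      D u ψ = fderiv ℝ g (rep ψ) (u ψ) := rfl
  obtain ⟨C, hC, hinv⟩ := eventually_hasInverseBound_sub_comp_perturbed (by simp) hA hA' hF hv hvc
    hΛ hΛ₀ hD heigen hκ hrate
  obtain ⟨r, hr, hhomeo⟩ := exists_radius_isHomeomorph hgA hg hper hF hD hC hinv
  filter_upwards [hhomeo, hconj, hh.norm.eventually_lt_const (u := r) (by simpa [h₀] using hr)]
    with ε hε hconjε hεr
  exact hε (h ε) (continuous_of_isHolder hβ ((h ε).holderNorm_le le_rfl |>.trans_lt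
    ENNReal.coe_lt_top)) (fun ψ => ((h ε).norm_apply_le ψ).trans hεr.le) hconjε

variable {β L : ℝ≥0} {v : Fin d → HolderFun (gauge (T := Torus d) β) (E d)}
  {Λ : Fin d → HolderFun (gauge (T := Torus d) β) ℝ}

theorem exists_analytic_eigenfields (hφ : GaugeLipschitz (gauge β) A L) (hβ : β ≤ 1)
    (hgA : ∀ x, proj (g x) = A (proj x)) (hg : AnalyticOnNhd ℝ g Set.univ)
    (hper : IsQuasiPeriodic g) (hF : IsAnalyticField F) {c : ℝ}
    (hv : IsUniformFrame (fun k => v k) c)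
    (heigen : ∀ i ψ, fderiv ℝ g (rep ψ) (v i ψ) = Λ i ψ • v i (A ψ))
    (htwist : ∀ i k, k ≠ i → Function.Bijective (HolderFun.twist hφ (Λ k) (Λ i)))
    {h : ℝ → HolderFun (gauge (T := Torus d) β) (E d)} (hh : AnalyticAt ℝ h 0) (h₀ : h 0 = 0) :
    ∃ (w : Fin d → ℝ → HolderFun (gauge (T := Torus d) β) (E d))
      (l : Fin d → ℝ → HolderFun (gauge (T := Torus d) β) ℝ),
      (∀ i, AnalyticAt ℝ (w i) 0) ∧ (∀ i, AnalyticAt ℝ (l i) 0) ∧ (∀ i, w i 0 = v i) ∧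
      (∀ i, l i 0 = Λ i) ∧ ∀ᶠ ε in 𝓝 0, ∀ i ψ,
        tderiv (perturbed A F ε) (ψ + proj (h ε ψ)) (w i ε ψ) = l i ε ψ • w i ε (A ψ) := by
  have hFper : (fun x : E d => F (proj x)).FactorsThrough proj := fun x y hxy => congrArg F hxy
  obtain ⟨Φ, hΦ, hΦ_apply⟩ := exists_analytic_along hβ hg.fderiv hper.factorsThrough_fderiv hh h₀
  obtain ⟨Ψ, hΨ, hΨ_apply⟩ := exists_analytic_along hβ (AnalyticOnNhd.fderiv hF)
    (IsQuasiPeriodic.of_factorsThrough hFper).factorsThrough_fderiv hh h₀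
  have heigen₀ (i : Fin d) (ψ : Torus d) :
      (Φ 0 + (0 : ℝ) • Ψ 0) ψ (v i ψ) = Λ i ψ • v i (A ψ) := by
    rw [zero_smul, add_zero, hΦ_apply.self_of_nhds, h₀, HolderFun.zero_apply, add_zero, heigen]
  choose w l hw hl hw₀ hl₀ hwl using fun i =>
    exists_analytic_eigen hφ (hΦ.add (analyticAt_id.smul hΨ)) hv heigen₀ i (htwist i)
  refine ⟨w, l, hw, hl, hw₀, hl₀, ?_⟩
  filter_upwards [eventually_all.2 hwl, hΦ_apply, hΨ_apply] with ε hε hΦε hΨε i ψ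
  rw [tderiv_perturbed hgA hg hF, ← hε i ψ, ← hΦε, ← hΨε]
  rfl

theorem exists_analytic_continuation (hA : IsAnalyticMap A)
    (hA' : IsAnalyticMap (A⁻¹ : Equiv.Perm _)) (hF : IsAnalyticField F)
    (hφ : GaugeLipschitz (gauge β) A L) (hβ₀ : 0 < β) (hβ₁ : β ≤ 1)
    (hli : ∀ ψ, LinearIndependent ℝ fun i => v i ψ) (heigen : ∀ i, IsEigenfield A (v i) (Λ i))
    {κ : ℝ} (hκ : κ < 1) (hrate : ∀ i, ∃ n, (∀ ψ, |cocycle A (Λ i) n ψ| ≤ κ) ∨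
      ∀ ψ, |(cocycle A (Λ i) n ψ)⁻¹| ≤ κ)
    (htwist₁ : ∀ i, Function.Bijective (HolderFun.twist hφ (Λ i) (.const 1)))
    (htwist : ∀ i k, k ≠ i → Function.Bijective (HolderFun.twist hφ (Λ k) (Λ i))) :
    ∃ (h : ℝ → HolderFun (gauge (T := Torus d) β) (E d))
      (w : Fin d → ℝ → HolderFun (gauge (T := Torus d) β) (E d))
      (l : Fin d → ℝ → HolderFun (gauge (T := Torus d) β) ℝ),
      AnalyticAt ℝ h 0 ∧ (∀ i, AnalyticAt ℝ (w i) 0) ∧ (∀ i, AnalyticAt ℝ (l i) 0) ∧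
      h 0 = 0 ∧ (∀ i, w i 0 = v i) ∧ (∀ i, l i 0 = Λ i) ∧ ∀ᶠ ε in 𝓝 0,
        (IsHomeomorph (fun ψ => ψ + proj (h ε ψ)) ∧
          Function.Semiconj (fun ψ => ψ + proj (h ε ψ)) A (perturbed A F ε)) ∧
        ∀ ψ, LinearIndependent ℝ (fun i => w i ε ψ) ∧ ∀ i,
          tderiv (perturbed A F ε) (ψ + proj (h ε ψ)) (w i ε ψ) = l i ε ψ • w i ε (A ψ) := by
  have continuous_coe {V : Type} [NormedAddCommGroup V] [NormedSpace ℝ V]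
      (f : HolderFun (gauge (T := Torus d) β) V) : Continuous f :=
    continuous_of_isHolder hβ₀ ((f.holderNorm_le le_rfl).trans_lt ENNReal.coe_lt_top)
  obtain ⟨g, hg, hgA, hper, hgt⟩ := hA.exists_lift
  obtain ⟨LA, hLA⟩ := hA.exists_lipschitzWith
  obtain ⟨LA', hLA'⟩ := hA'.exists_lipschitzWith
  obtain ⟨LF, hLF⟩ := hF.exists_lipschitzWith
  obtain ⟨c, hv⟩ := IsUniformFrame.exists_of_continuous (fun k => continuous_coe (v k)) hli
  have heigen_lift (i : Fin d) (ψ : Torus d) :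
      fderiv ℝ g (rep ψ) (v i ψ) = Λ i ψ • v i (A ψ) := by
    rw [← hgt, proj_rep, heigen i]
  obtain ⟨h, hh, h₀, hzero⟩ :=
    exists_analytic_conjugacy hφ hβ₁ hg hper hF hv heigen_lift htwist₁
  obtain ⟨w, l, hw, hl, hw₀, hl₀, hwl⟩ :=
    exists_analytic_eigenfields hφ hβ₁ hgA hg hper hF hv heigen_lift htwist hh h₀
  have hconj := hzero.mono fun ε hε => isIntertwining_zero_iff.2 hε
  have hhomeo := eventually_isHomeomorph_add_proj hgA hg hper hLA.continuous hLA' hLF hv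
    (fun i => continuous_coe (v i)) (fun i => continuous_coe (Λ i))
    (fun i => (heigen i).ne_zero hA hA' fun ψ => (hli ψ).ne_zero i) heigen_lift hκ hrate hβ₀
    hh.continuousAt h₀ hconj
  refine ⟨h, w, l, hh, hw, hl, h₀, hw₀, hl₀, ?_⟩
  filter_upwards [hhomeo, hconj, hwl, hv.eventually_linearIndependent
    (fun k => (hw k).continuousAt) hw₀] with ε hhomeoε hconjε hwlε hliε
  exact ⟨⟨hhomeoε, perturbed_zero A F ▸ hconjε.semiconj hgA⟩, fun ψ => ⟨hliε ψ, fun i => hwlε i ψ⟩⟩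

end Persistence

end ToralAnosov

end

open Filter Topology in
theorem mainTheorem2_general (d : ℕ) (A₀ : Equiv.Perm (Torus d)) (hA₀ : IsAnalyticMap A₀)
    (hA₀' : IsAnalyticMap A₀.symm) (Ws Wu : Torus d → Submodule ℝ (E d))
    (hsplit : IsHyperbolicSplitting A₀ Ws Wu) (F : Torus d → E d) (hF : IsAnalyticField F)
    (v₀ : Fin d → Torus d → E d) (Λ : Fin d → Torus d → ℝ) (β₀ : ℝ≥0) (hβ₀ : 0 < β₀)
    (hv₀ : ∀ i, IsHolder β₀ (v₀ i)) (hΛ : ∀ i, IsHolder β₀ (Λ i))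
    (hbasis : ∀ ψ, LinearIndependent ℝ (fun i => v₀ i ψ))
    (heq : ∀ i ψ, tderiv A₀ ψ (v₀ i ψ) = Λ i ψ • v₀ i (A₀ ψ)) (hord : IsDominated A₀ Λ) :
    ∃ (h : ℝ → Torus d → E d) (v : Fin d → ℝ → Torus d → E d) (L : Fin d → ℝ → Torus d → ℝ),
      h 0 = 0 ∧ (∀ i, v i 0 = v₀ i) ∧ (∀ i, L i 0 = Λ i) ∧
      ∃ βbar : ℝ≥0, 0 < βbar ∧ ∃ εbar : ℝ, 0 < εbar ∧
        (∀ β ≤ βbar, IsAnalyticHolder β εbar h ∧ (∀ i, IsAnalyticHolder β εbar (v i)) ∧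
          ∀ i, IsAnalyticHolder β εbar (L i)) ∧
        ∀ ε : ℝ, |ε| < εbar →
          (IsHomeomorph (fun ψ => ψ + proj (h ε ψ)) ∧
            Function.Semiconj (fun ψ => ψ + proj (h ε ψ)) A₀ (perturbed A₀ F ε)) ∧
          ∀ ψ, LinearIndependent ℝ (fun i => v i ε ψ) ∧ ∀ i,
            tderiv (perturbed A₀ F ε) (ψ + proj (h ε ψ)) (v i ε ψ) = L i ε ψ • v i ε (A₀ ψ) := by
  have hvc (i : Fin d) := continuous_of_isHolder hβ₀ (hv₀ i)
  have hne (i : Fin d) (ψ : Torus d) : v₀ i ψ ≠ 0 := (hbasis ψ).ne_zero i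
  obtain ⟨LA, hLA⟩ := hA₀.exists_lipschitzWith
  obtain ⟨LA', hLA'⟩ := IsAnalyticMap.exists_lipschitzWith hA₀'
  have hrate (i : Fin d) := hsplit.exists_cocycle_le_or_inv_cocycle_le hA₀ hA₀' (hvc i) (hne i)
    (heq i) (hsplit.forall_mem_stable_or_forall_mem_unstable hA₀ hA₀' hvc hbasis heq hord i)
    one_half_pos
  obtain ⟨β, hβ, hβle, K, hφ, htwist⟩ := exists_exponent_twist_bijective
    (lt_min hβ₀ one_pos) hLA hLA' hord (fun i => continuous_of_isHolder hβ₀ (hΛ i))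
    (fun i => IsEigenfield.ne_zero (heq i) hA₀ hA₀' (hne i)) one_half_pos.le one_half_lt_one hrate
  obtain ⟨hββ₀, hβ₁⟩ := le_min_iff.1 hβle
  choose vβ hvβ using fun i => HolderFun.exists_of_isHolder hββ₀ (hv₀ i)
  choose Λβ hΛβ using fun i => HolderFun.exists_of_isHolder hββ₀ (hΛ i)
  obtain rfl : (fun i => ⇑(vβ i)) = v₀ := funext₂ hvβ
  obtain rfl : (fun i => ⇑(Λβ i)) = Λ := funext₂ hΛβ
  obtain ⟨htwist₁, htwist₂⟩ := htwist Λβ fun _ _ => rfl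
  obtain ⟨h, w, l, hh, hw, hl, h₀, hw₀, hl₀, hsmall⟩ := exists_analytic_continuation hA₀ hA₀' hF hφ
    hβ hβ₁ hbasis heq one_half_lt_one hrate htwist₁ htwist₂
  obtain ⟨εbar, hεbar, hhε, hwε, hlε, hε⟩ := ((eventually_mem_nhdsWithin (a := (0 : ℝ))
    (s := Set.Ioi 0)).and <| (eventually_isAnalyticHolder hh).and <|
    (eventually_all.2 fun i => eventually_isAnalyticHolder (hw i)).and <|
    (eventually_all.2 fun i => eventually_isAnalyticHolder (hl i)).and <|
    eventually_forall_abs_lt hsmall).exists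
  exact ⟨fun ε => h ε, fun i ε => w i ε, fun i ε => l i ε, congrArg Subtype.val h₀,
    fun i => congrArg Subtype.val (hw₀ i), fun i => congrArg Subtype.val (hl₀ i),
    β, hβ, εbar, hεbar,
    fun β' hβ' => ⟨hhε β' hβ', fun i => hwε i β' hβ', fun i => hlε i β' hβ'⟩, hε⟩

theorem mainTheorem2 (d : ℕ)
    (A₀ : Equiv.Perm (Torus d)) (hA₀ : IsAnalyticAnosov A₀)
    (F : Torus d → E d) (hF : IsAnalyticField F)
    (v₀ : Fin d → Torus d → E d) (Λ : Fin d → Torus d → ℝ)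
    (β₀ : ℝ≥0) (hβ₀ : 0 < β₀) (hβ₀' : β₀ < 1)
    (hv₀ : ∀ i, IsHolder β₀ (v₀ i)) (hΛ : ∀ i, IsHolder β₀ (Λ i))
    (hbasis : ∀ ψ, LinearIndependent ℝ (fun i => v₀ i ψ))
    (heq : ∀ i ψ, tderiv A₀ ψ (v₀ i ψ) = Λ i ψ • v₀ i (A₀ ψ))
    (hord : IsDominated A₀ Λ) :
    ∃ (H : ℝ → Torus d → Torus d) (h : ℝ → Torus d → E d),
      (∀ ε ψ, H ε ψ = ψ + proj (h ε ψ)) ∧ (∀ ψ, h 0 ψ = 0) ∧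
      ∃ βbar : ℝ≥0, 0 < βbar ∧ ∀ β : ℝ≥0, 0 < β → β < βbar →
        ∃ εbar : ℝ, 0 < εbar ∧
          IsAnalyticHolder β εbar h ∧
          (∀ ε : ℝ, |ε| < εbar → IsHomeomorph (H ε) ∧
            ∀ ψ, H ε (A₀ ψ) = perturbed A₀ F ε (H ε ψ)) ∧
          ∃ (v : Fin d → ℝ → Torus d → E d) (L : Fin d → ℝ → Torus d → ℝ),
            (∀ i, IsAnalyticHolder β εbar (v i)) ∧
            (∀ i, IsAnalyticHolder β εbar (L i)) ∧
            (∀ i ψ, v i 0 ψ = v₀ i ψ) ∧ (∀ i ψ, L i 0 ψ = Λ i ψ) ∧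
            ∀ ε : ℝ, |ε| < εbar → ∀ ψ,
              LinearIndependent ℝ (fun i => v i ε ψ) ∧
              ∀ i, tderiv (perturbed A₀ F ε) (H ε ψ) (v i ε ψ) =
                L i ε ψ • v i ε (A₀ ψ) := by
  obtain ⟨Ws, Wu, hsplit⟩ := hA₀.splitting
  obtain ⟨h, v, L, h₀, hv, hL, βbar, hβbar, εbar, hεbar, hanalytic, hsmall⟩ :=
    mainTheorem2_general d A₀ hA₀.analytic hA₀.analytic_symm Ws Wu hsplit F hF v₀ Λ β₀ hβ₀ hv₀ hΛ
      hbasis heq hord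
  refine ⟨fun ε ψ => ψ + proj (h ε ψ), h, fun _ _ => rfl, congrFun h₀, βbar, hβbar,
    fun β _ hβ => ⟨εbar, hεbar, ?_⟩⟩
  obtain ⟨hh, hvβ, hLβ⟩ := hanalytic β hβ.le
  exact ⟨hh, fun ε hε => (hsmall ε hε).1, v, L, hvβ, hLβ, fun i => congrFun (hv i),
    fun i => congrFun (hL i), fun ε hε => (hsmall ε hε).2⟩
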